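/- Let $M\ge 2$ and $q\ge 1$ be integers, let $1\le t\le \sqrt q$ be real, and put $N=q/t^{2}$. Let $w_M$ be the Hausdorff dimension of the set of irrational $\alpha=[0;c_1,c_2,\dots]\in[0,1]$ with $c_j\le M$ for all $j$. For $a\in\mathbb Z/q\mathbb Z$, represented by an integer $0\le a<q$ (not necessarily coprime to $q$), let $a/q=[0;c_1,\dots,c_s]$ be the regular continued fraction (with $c_s\ge 2$ if $s\ge 1$), put $c_{s+1}=\infty$, and let $q_0=1,q_1,\dots,q_s=q/\gcd(a,q)$ be the denominators of its convergents. Let $$Z_M(t)=\{a\in\mathbb Z/q\mathbb Z:\ c_j\le M\ \text{ for every } 1\le j\le s+1 \text{ with } q_{j-1}<t\}.$$ An interval in $\mathbb Z/q\mathbb Z$ is a set $\mathcal I=\{x,x+1,\dots,x+L-1\}$ with $0\le L\le q$, so that $|\mathcal I|=L$; for $L\geq 1$ it is centred at its middle element if $L$ is odd and at either of its two middle elements if $L$ is even. Lemma 3.1. For every $\delta>0$ there are constants $C,c>0$ depending only on $\delta$ such that for all $M,q,t$ as above with $t\ge\delta M$ the following holds. For every interval $\mathcal I\subseteq\mathbb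 Z/q\mathbb Z$, $$|Z_M(t)\cap\mathcal I|\le C\,M^{4}\,|\mathcal I|^{w_M}N^{1-w_M}.$$ If moreover $|\mathcal I|\ge N$ and $\mathcal I$ is centred at a point of $Z_M(t)$, then $$|Z_M(t)\cap\mathcal I|\ge c\,M^{-1}\,|\mathcal I|^{w_M}N^{1-w_M}.$$ -/

import Mathlib

/-- The set `F_M` of irrational numbers `α = [0; c₁, c₂, …] ∈ [0, 1]` all of whose partial quotients
are at most `M` (for an irrational number the expansion is infinite; the stream `partDens` of
`GenContFract.of α` lists `c₁, c₂, …`). -/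
def boundedTypeSet (M : ℕ) : Set ℝ :=
  {α : ℝ | α ∈ Set.Icc (0 : ℝ) 1 ∧ Irrational α ∧
    ∀ (n : ℕ) (c : ℝ), (GenContFract.of α).partDens.get? n = some c → c ≤ (M : ℝ)}

/-- `w_M`, the Hausdorff dimension of `F_M`. -/
noncomputable def hausdorffDimBounded (M : ℕ) : ℝ :=
  (dimH (boundedTypeSet M)).toReal

/-- The regular continued fraction `[0; c₁, …, c_s]` of the rational number `a / q`, where the residue
`a` is represented by an integer in `{0, …, q - 1}`. -/
noncomputable def resFract {q : ℕ} (a : ZMod q) : GenContFract ℚ :=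
  GenContFract.of ((a.val : ℚ) / (q : ℚ))

/-- `Z_M(t) ⊆ ℤ/qℤ`: the residues `a` such that in `a / q = [0; c₁, …, c_s]` one has `c_{n+1} ≤ M` for
every `n ≥ 0` for which the denominator `q_n` of the `n`-th convergent is `< t`.  Here `c_{s+1} = ∞`:
the partial quotient `c_{n+1}` is required to exist.  (Mathlib's `dens n` is `q_n`, it is constant for
`n ≥ s`, and `partDens.get? n` is `c_{n+1}`; so the reduced denominator `q_s` has to be `≥ t`.)
The fraction `a / q` need not be in lowest terms. -/
def zarembaSet (q M : ℕ) (t : ℝ) : Set (ZMod q) :=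
  {a : ZMod q | ∀ n : ℕ, (((resFract a).dens n : ℚ) : ℝ) < t →
    ∃ c : ℚ, (resFract a).partDens.get? n = some c ∧ c ≤ (M : ℚ)}

/-- The `L` consecutive residues `x, x + 1, …, x + L - 1`. -/
def residueArc {q : ℕ} (x : ZMod q) (L : ℕ) : Set (ZMod q) :=
  {y : ZMod q | ∃ i : ℕ, i < L ∧ y = x + (i : ZMod q)}

/-- `I` is an interval in `ℤ/qℤ`. -/
def IsResidueInterval {q : ℕ} (I : Set (ZMod q)) : Prop :=
  ∃ (x : ZMod q) (L : ℕ), L ≤ q ∧ I = residueArc x L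

/-- `I` is an interval in `ℤ/qℤ` centred at `a`: the middle element if the number of
elements is odd, either of the two middle elements if it is even. -/
def IsResidueIntervalCenteredAt {q : ℕ} (I : Set (ZMod q)) (a : ZMod q) : Prop :=
  ∃ (x : ZMod q) (L k : ℕ), L ≤ q ∧ I = residueArc x L ∧ k < L ∧
    (2 * k + 1 = L ∨ 2 * k = L ∨ 2 * k + 2 = L) ∧ a = x + (k : ZMod q)

/-! Residues are sorted by the cylinders of words u over {1, …, M}. The cylinder of u is an interval
of length comparable to q(u)⁻², and a/q in the open cylinder of a word with q(u) ≥ t belongs to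
Z_M(t) (`mem_zarembaSet_of_eval`). Counting is done against a conformal mass: an additive function m
on the tree of words with m(u) within absolute constants of q(u)^(-2w), where w = w_M. It exists
because the partition sums of q(u)^(-2s) over words of length n are multiplicative up to a factor
4^s, hence lie between 1 and 4^s at their critical exponent. Covering by cylinders and a mass
distribution argument identify that exponent with the Hausdorff dimension.

Upper bound. Words stopped when the denominator first reaches t are incomparable, have mass ≫
(Mt)^(-2w), and carry at most ⌊N⌋ + 1 residues each. Those whose cylinders meet an interval of
length T⁻² have total mass ≪ M² T^(-2w) (`ConformalMass.sum_le_of_meets`). Dividing bounds their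
number by ≪ M⁴ (t/T)^(2w).

Lower bound. The core is that a cylinder with K q(v) ≤ t contains at least N/16 elements of Z_M(t)
(`exists_forall_le_card_zarembaCylinder`). If N ≥ 16, a subcylinder of length about t⁻² is long
enough. If N is bounded, intervals of length about 1/q need not contain a fraction a/q, and a
Zaremba-type existence statement is needed (`exists_zaremba_extension`): some extension of v by
letters 1 and 2, with denominator at least √q, has a fraction with denominator q in its cylinder.
That extension is sought among words v 1 g̃ f j, where g̃ is the reversal of g and g, j run over
words with denominators about S. Up to a small error, q times the value of such a word is a constant
depending on g plus a product of a factor depending on g and one depending on j. Cauchy–Schwarz and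
orthogonality of characters reduce the matter to coincidences among the first factors, which are
rare for a suitable f. The gain is a power S^(2-4w₂) up to a logarithm, so the argument rests on w₂
> 1/2 (`half_lt_hausdorffDimBounded_two`).

Induction down the tree then gives at least c N t^(2w) m(v) elements in the cylinder of v
(`exists_forall_mass_le_card_zarembaCylinder`); the sums over large letters converge uniformly in M
because 2w_M ≥ 2w₂ > 1. Near an element of Z_M(t) there is a cylinder at the scale of the given arc
whose denominator is large by a factor √M at most (`exists_small_cylinder`), which costs only M⁻¹.
-/

/-! ### Continuants and the Möbius maps `y ↦ [0; c₁, …, cₙ + y]` -/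

/-- The product of the matrices `(0 1; 1 c)` over the letters of the word `u`. -/
def cfMat (u : List ℕ) : Matrix (Fin 2) (Fin 2) ℕ :=
  (u.map fun c => !![0, 1; 1, c]).prod

/-- The denominator of `[0; u]`. -/
def cden (u : List ℕ) : ℕ := cfMat u 1 1

/-- The denominator of the last but one convergent of `[0; u]`. -/
def cden' (u : List ℕ) : ℕ := cfMat u 1 0

/-- The numerator of `[0; u]`. -/
def cnum (u : List ℕ) : ℕ := cfMat u 0 1

/-- The numerator of the last but one convergent of `[0; u]`. -/
def cnum' (u : List ℕ) : ℕ := cfMat u 0 0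

/-- All letters of the word are positive. -/
def PosWord (u : List ℕ) : Prop := ∀ c ∈ u, 1 ≤ c

/-- All letters of the word lie in `{1, …, M}`. -/
def IsWord (M : ℕ) (u : List ℕ) : Prop := ∀ c ∈ u, 1 ≤ c ∧ c ≤ M

theorem IsWord.pos {M : ℕ} {u : List ℕ} (h : IsWord M u) : PosWord u := fun c hc => (h c hc).1

theorem IsWord.mono {M M' : ℕ} (hM : M ≤ M') {u : List ℕ} (h : IsWord M u) : IsWord M' u :=
  fun c hc => ⟨(h c hc).1, (h c hc).2.trans hM⟩

theorem posWord_nil : PosWord [] := by simp [PosWord]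

theorem isWord_nil (M : ℕ) : IsWord M [] := by simp [IsWord]

theorem posWord_cons {c : ℕ} {u : List ℕ} : PosWord (c :: u) ↔ 1 ≤ c ∧ PosWord u := by
  simp [PosWord]

theorem posWord_append {u v : List ℕ} : PosWord (u ++ v) ↔ PosWord u ∧ PosWord v := by
  simp [PosWord, or_imp, forall_and]

theorem isWord_append {M : ℕ} {u v : List ℕ} :
    IsWord M (u ++ v) ↔ IsWord M u ∧ IsWord M v := by
  simp [IsWord, or_imp, forall_and]
  tauto

theorem isWord_cons {M c : ℕ} {u : List ℕ} :
    IsWord M (c :: u) ↔ (1 ≤ c ∧ c ≤ M) ∧ IsWord M u := by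
  simp [IsWord]

theorem isWord_singleton {M c : ℕ} : IsWord M [c] ↔ 1 ≤ c ∧ c ≤ M := by
  simp [IsWord]

theorem posWord_reverse {u : List ℕ} : PosWord u.reverse ↔ PosWord u := by
  simp [PosWord]

theorem isWord_reverse {M : ℕ} {u : List ℕ} : IsWord M u.reverse ↔ IsWord M u := by
  simp [IsWord]

theorem isWord_replicate_one {M : ℕ} (hM : 1 ≤ M) (k : ℕ) : IsWord M (List.replicate k 1) := by
  intro c hc
  rw [List.eq_of_mem_replicate hc]
  exact ⟨le_rfl, hM⟩

theorem IsWord.of_prefix {M : ℕ} {u v : List ℕ} (h : IsWord M v) (huv : u <+: v) : IsWord M u :=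
  fun c hc => h c (huv.subset hc)

theorem PosWord.of_prefix {u v : List ℕ} (h : PosWord v) (huv : u <+: v) : PosWord u :=
  fun c hc => h c (huv.subset hc)

theorem cfMat_append (u v : List ℕ) : cfMat (u ++ v) = cfMat u * cfMat v := by
  simp [cfMat]

@[simp] theorem cden_nil : cden [] = 1 := by simp [cden, cfMat]
@[simp] theorem cden'_nil : cden' [] = 0 := by simp [cden', cfMat]
@[simp] theorem cnum_nil : cnum [] = 0 := by simp [cnum, cfMat]
@[simp] theorem cnum'_nil : cnum' [] = 1 := by simp [cnum', cfMat]

@[simp] theorem cden_singleton (c : ℕ) : cden [c] = c := by simp [cden, cfMat]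
@[simp] theorem cden'_singleton (c : ℕ) : cden' [c] = 1 := by simp [cden', cfMat]
@[simp] theorem cnum_singleton (c : ℕ) : cnum [c] = 1 := by simp [cnum, cfMat]
@[simp] theorem cnum'_singleton (c : ℕ) : cnum' [c] = 0 := by simp [cnum', cfMat]

theorem cden_append (u v : List ℕ) : cden (u ++ v) = cden' u * cnum v + cden u * cden v := by
  simp [cden, cden', cnum, cfMat_append, Matrix.mul_apply]

theorem cden'_append (u v : List ℕ) :
    cden' (u ++ v) = cden' u * cnum' v + cden u * cden' v := by
  simp [cden, cden', cnum', cfMat_append, Matrix.mul_apply]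

theorem cnum_append (u v : List ℕ) : cnum (u ++ v) = cnum' u * cnum v + cnum u * cden v := by
  simp [cden, cnum', cnum, cfMat_append, Matrix.mul_apply]

theorem cnum'_append (u v : List ℕ) :
    cnum' (u ++ v) = cnum' u * cnum' v + cnum u * cden' v := by
  simp [cnum, cden', cnum', cfMat_append, Matrix.mul_apply]

theorem cden_snoc (u : List ℕ) (c : ℕ) : cden (u ++ [c]) = cden' u + c * cden u := by
  rw [cden_append]; simp [mul_comm]

theorem cden'_snoc (u : List ℕ) (c : ℕ) : cden' (u ++ [c]) = cden u := by
  rw [cden'_append]; simp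

theorem cden_cons (c : ℕ) (u : List ℕ) : cden (c :: u) = cnum u + c * cden u := by
  have := cden_append [c] u
  simpa using this

theorem cden'_cons (c : ℕ) (u : List ℕ) : cden' (c :: u) = cnum' u + c * cden' u := by
  have := cden'_append [c] u
  simpa using this

theorem cnum_cons (c : ℕ) (u : List ℕ) : cnum (c :: u) = cden u := by
  have := cnum_append [c] u
  simpa using this

theorem cnum'_cons (c : ℕ) (u : List ℕ) : cnum' (c :: u) = cden' u := by
  have := cnum'_append [c] u
  simpa using this

/-- Each factor is a symmetric matrix, so transposition reverses the product. Consequently the ratio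
of the last two denominators of a word is the value of the reversed word, which later turns slopes
into points of cylinders. -/
theorem cfMat_reverse (u : List ℕ) : cfMat u.reverse = (cfMat u).transpose := by
  rw [cfMat, cfMat, Matrix.transpose_list_prod, List.map_reverse, List.map_map]
  congr 2
  apply List.map_congr_left
  intro c _
  ext i j
  fin_cases i <;> fin_cases j <;> simp

theorem cden_reverse (u : List ℕ) : cden u.reverse = cden u := by
  simp [cden, cfMat_reverse]

theorem cnum_reverse (u : List ℕ) : cnum u.reverse = cden' u := by
  simp [cnum, cden', cfMat_reverse]

theorem PosWord.cden_bounds {u : List ℕ} (hu : PosWord u) : 1 ≤ cden u ∧ cnum u ≤ cden u := by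
  induction u with
  | nil => simp
  | cons c u ih =>
    obtain ⟨hc, hu⟩ := posWord_cons.1 hu
    obtain ⟨h1, h2⟩ := ih hu
    rw [cden_cons, cnum_cons]
    constructor <;> nlinarith

theorem PosWord.one_le_cden {u : List ℕ} (hu : PosWord u) : 1 ≤ cden u := hu.cden_bounds.1

theorem PosWord.cnum_le {u : List ℕ} (hu : PosWord u) : cnum u ≤ cden u := hu.cden_bounds.2

theorem PosWord.cden'_le {u : List ℕ} (hu : PosWord u) : cden' u ≤ cden u := by
  have := (posWord_reverse.2 hu).cnum_le
  rwa [cnum_reverse, cden_reverse] at this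

theorem cden_mul_le (u v : List ℕ) : cden u * cden v ≤ cden (u ++ v) := by
  rw [cden_append]; omega

theorem cden_append_le {u v : List ℕ} (hu : PosWord u) (hv : PosWord v) :
    cden (u ++ v) ≤ 2 * (cden u * cden v) := by
  rw [cden_append]
  have := Nat.mul_le_mul hu.cden'_le hv.cnum_le
  omega

theorem cden_le_of_prefix {u v : List ℕ} (hv : PosWord v) (h : u <+: v) : cden u ≤ cden v := by
  obtain ⟨z, rfl⟩ := h
  have := (posWord_append.1 hv).2.one_le_cden
  nlinarith [cden_mul_le u z]

theorem cden_snoc_le {u : List ℕ} (hu : PosWord u) (c : ℕ) :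
    cden (u ++ [c]) ≤ (c + 1) * cden u := by
  rw [cden_snoc]
  have := hu.cden'_le
  nlinarith

/-- Two further letters at least double the denominator. This exponential growth makes every
stopping procedure below terminate. -/
theorem two_pow_le_cden {u : List ℕ} (hu : PosWord u) : 2 ^ (u.length / 2) ≤ cden u := by
  induction u using List.twoStepInduction with
  | nil => simp
  | singleton c => simpa using (posWord_cons.1 hu).1
  | cons_cons a b u ih _ =>
    obtain ⟨ha, hu⟩ := posWord_cons.1 hu
    obtain ⟨hb, hu⟩ := posWord_cons.1 hu
    have := ih hu
    have h2 : (a :: b :: u).length / 2 = u.length / 2 + 1 := by simp only [List.length_cons]; omega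
    rw [h2, pow_succ, cden_cons, cnum_cons, cden_cons]
    nlinarith [Nat.mul_le_mul ha hb, Nat.zero_le (a * cnum u), hu.one_le_cden,
      Nat.mul_le_mul (Nat.mul_le_mul ha hb) (le_refl (cden u))]

theorem cden_det (u : List ℕ) :
    (cnum' u : ℤ) * cden u - cnum u * cden' u = (-1) ^ u.length := by
  induction u with
  | nil => simp
  | cons c u ih =>
    rw [cnum'_cons, cnum_cons, cden_cons, cden'_cons, List.length_cons, pow_succ, ← ih]
    push_cast
    ring

section Eval

variable {K : Type*} [Field K] [LinearOrder K] [IsStrictOrderedRing K]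

/-- The Möbius map `y ↦ [0; c₁, …, cₙ + y]` of the word `u = c₁ … cₙ`. -/
def cfEval (u : List ℕ) (y : K) : K :=
  (cnum u + cnum' u * y) / (cden u + cden' u * y)

theorem PosWord.eval_den_pos {u : List ℕ} (hu : PosWord u) {y : K} (hy : 0 ≤ y) :
    (0 : K) < cden u + cden' u * y := by
  have h1 : (1 : K) ≤ cden u := by exact_mod_cast hu.one_le_cden
  have h2 : (0 : K) ≤ cden' u := Nat.cast_nonneg _
  positivity

@[simp] theorem cfEval_nil (y : K) : cfEval [] y = y := by simp [cfEval]

theorem cfEval_append (u : List ℕ) {v : List ℕ} (hv : PosWord v) {y : K} (hy : 0 ≤ y) :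
    cfEval (u ++ v) y = cfEval u (cfEval v y) := by
  have h := (hv.eval_den_pos hy).ne'
  unfold cfEval
  rw [cden_append, cden'_append, cnum_append, cnum'_append]
  push_cast
  rw [← mul_div_mul_right (cnum u + cnum' u * ((cnum v + cnum' v * y) / (cden v + cden' v * y))) _ h]
  congr 1 <;> field_simp <;> ring

theorem cfEval_singleton (c : ℕ) (y : K) : cfEval [c] y = (c + y)⁻¹ := by
  simp [cfEval]

theorem cfEval_cons (c : ℕ) {u : List ℕ} (hu : PosWord u) {y : K} (hy : 0 ≤ y) :
    cfEval (c :: u) y = (c + cfEval u y)⁻¹ := by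
  rw [← cfEval_singleton, ← cfEval_append [c] hu hy, List.singleton_append]

theorem cfEval_nonneg (u : List ℕ) {y : K} (hy : 0 ≤ y) : 0 ≤ cfEval u y := by
  unfold cfEval; positivity

theorem PosWord.eval_le_one {u : List ℕ} (hu : PosWord u) {y : K} (hy : 0 ≤ y) (hy1 : y ≤ 1) :
    cfEval u y ≤ 1 := by
  cases u with
  | nil => simpa
  | cons c u =>
    obtain ⟨hc, hu⟩ := posWord_cons.1 hu
    rw [cfEval_cons c hu hy]
    have := cfEval_nonneg u hy
    have : (1 : K) ≤ c := by exact_mod_cast hc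
    exact inv_le_one_of_one_le₀ (by linarith)

theorem PosWord.eval_pos {u : List ℕ} (hu : PosWord u) {y : K} (hy : 0 < y) : 0 < cfEval u y := by
  cases u with
  | nil => simpa
  | cons c u =>
    obtain ⟨hc, hu⟩ := posWord_cons.1 hu
    rw [cfEval_cons c hu hy.le]
    have := cfEval_nonneg u hy.le
    have : (1 : K) ≤ c := by exact_mod_cast hc
    positivity

theorem PosWord.eval_lt_one {u : List ℕ} (hu : PosWord u) {y : K} (hy : 0 < y) (hy1 : y < 1) :
    cfEval u y < 1 := by
  cases u with
  | nil => simpa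
  | cons c u =>
    obtain ⟨hc, hu⟩ := posWord_cons.1 hu
    rw [cfEval_cons c hu hy.le]
    have := hu.eval_pos hy
    have : (1 : K) ≤ c := by exact_mod_cast hc
    exact inv_lt_one_of_one_lt₀ (by linarith)

/-- The determinant of the matrix of u is ±1, so the numerator of the difference is exactly ±(y -
z). All estimates for lengths, distances and distortion of cylinders come from this identity. -/
theorem PosWord.eval_sub {u : List ℕ} (hu : PosWord u) {y z : K} (hy : 0 ≤ y) (hz : 0 ≤ z) :
    cfEval u y - cfEval u z =
      (-1) ^ u.length * ((y - z) / ((cden u + cden' u * y) * (cden u + cden' u * z))) := by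
  have h1 := (hu.eval_den_pos hy).ne'
  have h2 := (hu.eval_den_pos hz).ne'
  have h3 : (cnum' u : K) * cden u - cnum u * cden' u = (-1) ^ u.length := by
    have := congrArg (Int.cast : ℤ → K) (cden_det u)
    push_cast at this
    exact this
  rw [← h3, cfEval, cfEval, div_sub_div _ _ h1 h2, mul_div_assoc']
  congr 1
  ring

theorem PosWord.abs_eval_sub {u : List ℕ} (hu : PosWord u) {y z : K} (hy : 0 ≤ y) (hz : 0 ≤ z) :
    |cfEval u y - cfEval u z| =
      |y - z| / ((cden u + cden' u * y) * (cden u + cden' u * z)) := by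
  rw [hu.eval_sub hy hz, abs_mul, abs_pow, abs_neg, abs_one, one_pow, one_mul, abs_div,
    abs_of_pos (mul_pos (hu.eval_den_pos hy) (hu.eval_den_pos hz))]

theorem cfEval_den_ge (u : List ℕ) {y : K} (hy : 0 ≤ y) :
    (cden u : K) ≤ cden u + cden' u * y := by
  have h2 : (0 : K) ≤ cden' u := Nat.cast_nonneg _
  nlinarith [mul_nonneg h2 hy]

theorem PosWord.eval_den_le {u : List ℕ} (hu : PosWord u) {y : K} (hy : 0 ≤ y) (hy1 : y ≤ 1) :
    (cden u + cden' u * y : K) ≤ 2 * cden u := by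
  have h2 : (cden' u : K) ≤ cden u := by exact_mod_cast hu.cden'_le
  nlinarith [mul_nonneg (Nat.cast_nonneg (α := K) (cden' u)) hy]

theorem PosWord.abs_eval_sub_le {u : List ℕ} (hu : PosWord u) {y z : K} (hy : 0 ≤ y)
    (hz : 0 ≤ z) : |cfEval u y - cfEval u z| ≤ |y - z| / (cden u : K) ^ 2 := by
  rw [hu.abs_eval_sub hy hz]
  have h1 : (1 : K) ≤ cden u := by exact_mod_cast hu.one_le_cden
  have h2 := cfEval_den_ge u hy
  have h3 := cfEval_den_ge u hz
  apply div_le_div_of_nonneg_left (abs_nonneg _) (by positivity)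
  rw [sq]
  exact mul_le_mul h2 h3 (by positivity) (by linarith)

theorem PosWord.le_abs_eval_sub {u : List ℕ} (hu : PosWord u) {y z : K} (hy : 0 ≤ y)
    (hy1 : y ≤ 1) (hz : 0 ≤ z) (hz1 : z ≤ 1) :
    |y - z| / (4 * (cden u : K) ^ 2) ≤ |cfEval u y - cfEval u z| := by
  rw [hu.abs_eval_sub hy hz]
  have h2 := hu.eval_den_le hy hy1
  have h3 := hu.eval_den_le hz hz1
  have h4 := hu.eval_den_pos hy
  have h5 := hu.eval_den_pos hz
  apply div_le_div_of_nonneg_left (abs_nonneg _) (by positivity)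
  calc _ ≤ (2 * cden u : K) * (2 * cden u) := mul_le_mul h2 h3 h5.le (by linarith)
    _ = _ := by ring

theorem PosWord.eval_injOn {u : List ℕ} (hu : PosWord u) {y z : K} (hy : 0 ≤ y)
    (hz : 0 ≤ z) (h : cfEval u y = cfEval u z) : y = z := by
  have h1 := hu.abs_eval_sub hy hz
  rw [h, sub_self, abs_zero, eq_comm, div_eq_zero_iff] at h1
  rcases h1 with h1 | h1
  · exact sub_eq_zero.1 (abs_eq_zero.1 h1)
  · exact absurd h1 (mul_pos (hu.eval_den_pos hy) (hu.eval_den_pos hz)).ne'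

theorem cfEval_cast (u : List ℕ) (y : ℚ) : ((cfEval u y : ℚ) : ℝ) = cfEval u (y : ℝ) := by
  simp [cfEval]

/-- If two open cylinders intersect then one of the words is a prefix of the other. -/
theorem prefix_or_prefix_of_eval_eq {u v : List ℕ} (hu : PosWord u) (hv : PosWord v) {y z : K}
    (hy : 0 < y) (hy1 : y < 1) (hz : 0 < z) (hz1 : z < 1) (h : cfEval u y = cfEval v z) :
    u <+: v ∨ v <+: u := by
  induction u generalizing v with
  | nil => simp
  | cons c u ih =>
    cases v with
    | nil => simp
    | cons d v =>
      have hu' := (posWord_cons.1 hu).2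
      have hv' := (posWord_cons.1 hv).2
      rw [cfEval_cons c hu' hy.le, cfEval_cons d hv' hz.le, inv_inj] at h
      have h1 := hu'.eval_pos hy
      have h2 := hu'.eval_lt_one hy hy1
      have h3 := hv'.eval_pos hz
      have h4 := hv'.eval_lt_one hz hz1
      have hcd : c = d := by
        have a1 : (c : K) < d + 1 := by linarith
        have a2 : (d : K) < c + 1 := by linarith
        norm_cast at a1 a2
        omega
      subst hcd
      rcases ih hu' hv' (by simpa using h) with h | h
      · left; simpa using h
      · right; simpa using h

end Eval

/-! ### Words and the regular continued fraction expansion -/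

section Expansion

variable {K : Type*} [Field K] [LinearOrder K] [IsStrictOrderedRing K] [FloorRing K]

theorem of_s_get?_zero {K : Type*} [Field K] [LinearOrder K] [FloorRing K] {x : K} (hx : Int.fract x ≠ 0) :
    (GenContFract.of x).s.get? 0 = some ⟨1, ⌊(Int.fract x)⁻¹⌋⟩ :=
  GenContFract.of_s_head hx

theorem of_s_get?_eq_of_fract_eq {x y : K} (h : Int.fract x = Int.fract y) (n : ℕ) :
    (GenContFract.of x).s.get? n = (GenContFract.of y).s.get? n := by
  cases n with
  | succ n => rw [GenContFract.of_s_succ, GenContFract.of_s_succ, h]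
  | zero =>
    by_cases hx : Int.fract x = 0
    · obtain ⟨a, ha⟩ := Int.fract_eq_zero_iff.1 hx
      obtain ⟨b, hb⟩ := Int.fract_eq_zero_iff.1 (h ▸ hx)
      rw [← ha, ← hb, GenContFract.of_s_of_int, GenContFract.of_s_of_int]
    · rw [of_s_get?_zero hx, of_s_get?_zero (h ▸ hx), h]

/-- One step of the Gauss map. Besides forcing c ≥ 1, the hypothesis `1 < c + y` excludes c = 1, y =
0, where the value 1 has fractional part 0 and the expansion stops at once. -/
theorem of_inv_natCast_add {c : ℕ} {y : K} (hy : 0 ≤ y) (hy1 : y < 1) (h : 1 < (c : K) + y) :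
    (GenContFract.of ((c + y)⁻¹)).s.get? 0 = some ⟨1, (c : K)⟩ ∧
      ∀ n, (GenContFract.of ((c + y)⁻¹)).s.get? (n + 1) = (GenContFract.of y).s.get? n := by
  have h0 : 0 < ((c : K) + y)⁻¹ := by positivity
  have hfr : Int.fract ((c : K) + y)⁻¹ = ((c : K) + y)⁻¹ :=
    Int.fract_eq_self.2 ⟨h0.le, inv_lt_one_of_one_lt₀ h⟩
  constructor
  · rw [of_s_get?_zero (by rw [hfr]; exact h0.ne'), hfr, inv_inv]
    have : ⌊(c : K) + y⌋ = c := by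
      rw [Int.floor_eq_iff]
      push_cast
      constructor <;> linarith
    rw [this]
    simp
  · intro n
    rw [GenContFract.of_s_succ, hfr, inv_inv]
    apply of_s_get?_eq_of_fract_eq
    simp

/-- The expansion of `[0; u + z]` starts with the letters of `u` and continues with that of `z`. -/
theorem of_cfEval {u : List ℕ} (hu : PosWord u) {z : K} (hz : 0 < z) (hz1 : z < 1) :
    (∀ (k : ℕ) (c : ℕ), u[k]? = some c →
      (GenContFract.of (cfEval u z)).s.get? k = some ⟨1, (c : K)⟩) ∧
    ∀ k, (GenContFract.of (cfEval u z)).s.get? (u.length + k) = (GenContFract.of z).s.get? k := by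
  induction u with
  | nil => simp
  | cons c u ih =>
    obtain ⟨hc, hu⟩ := posWord_cons.1 hu
    obtain ⟨h1, h2⟩ := ih hu
    have hc' : (1 : K) ≤ c := by exact_mod_cast hc
    have hp := hu.eval_pos hz
    obtain ⟨h3, h4⟩ := of_inv_natCast_add hp.le (hu.eval_lt_one hz hz1)
      (show 1 < (c : K) + cfEval u z by linarith)
    rw [cfEval_cons c hu hz.le]
    constructor
    · intro k d hk
      cases k with
      | zero => simp at hk; rw [h3, hk]
      | succ k => rw [h4]; exact h1 k d (by simpa using hk)
    · intro k
      rw [List.length_cons, add_right_comm, h4, h2]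

theorem of_dens_eq_cden {K : Type*} [Field K] [LinearOrder K] [FloorRing K] {x : K} {u : List ℕ}
    (h : ∀ (k : ℕ) (c : ℕ), u[k]? = some c → (GenContFract.of x).s.get? k = some ⟨1, (c : K)⟩) :
    ∀ k ≤ u.length, (GenContFract.of x).dens k = cden (u.take k) := by
  intro k
  induction k using Nat.twoStepInduction with
  | zero => intro _; simp [GenContFract.zeroth_den_eq_one]
  | one =>
    intro hk
    have hg : u[0]? = some u[0] := List.getElem?_eq_getElem hk
    rw [GenContFract.first_den_eq (h 0 _ hg), List.take_succ_eq_append_getElem hk]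
    simp
  | more k ih1 ih2 =>
    intro hk
    have hg : u[k + 1]? = some u[k + 1] := List.getElem?_eq_getElem hk
    rw [GenContFract.dens_recurrence (h _ _ hg) (ih1 (by omega)) (ih2 (by omega)),
      List.take_succ_eq_append_getElem hk, cden_snoc, List.take_succ_eq_append_getElem (by omega),
      cden'_snoc]
    push_cast
    ring

/-- A number in `[0, 1)` with at least `n` partial quotients is of the form `[0; u + z]`, where `u`
is the word of the first `n` of them. -/
theorem exists_word_of_partDens {n : ℕ} {x : K} (hx : 0 ≤ x) (hx1 : x < 1)
    (h : ∀ k < n, ∃ c, (GenContFract.of x).partDens.get? k = some c) :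
    ∃ (u : List ℕ) (z : K), u.length = n ∧ PosWord u ∧ 0 ≤ z ∧ z < 1 ∧ x = cfEval u z ∧
      ∀ (k : ℕ) (c : ℕ), u[k]? = some c →
        (GenContFract.of x).s.get? k = some ⟨1, (c : K)⟩ := by
  induction n generalizing x with
  | zero => exact ⟨[], x, rfl, posWord_nil, hx, hx1, by simp, by simp⟩
  | succ n ih =>
    have hx0 : x ≠ 0 := by
      rintro rfl
      obtain ⟨c, hc⟩ := h 0 (by omega)
      obtain ⟨gp, hgp, -⟩ := GenContFract.exists_s_b_of_partDen hc
      have := GenContFract.of_s_of_int K 0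
      rw [Int.cast_zero] at this
      rw [this] at hgp
      simp at hgp
    have hxp : 0 < x := lt_of_le_of_ne hx hx0.symm
    have hxi : 1 < x⁻¹ := (one_lt_inv₀ hxp).2 hx1
    obtain ⟨c, hc⟩ : ∃ c : ℕ, (c : ℤ) = ⌊x⁻¹⌋ :=
      ⟨⌊x⁻¹⌋.toNat, Int.toNat_of_nonneg (Int.floor_nonneg.2 (by linarith))⟩
    have hc1 : 1 ≤ c := by
      have : (1 : ℤ) ≤ ⌊x⁻¹⌋ := Int.le_floor.2 (by push_cast; exact hxi.le)
      omega
    have hcy : (c : K) + Int.fract x⁻¹ = x⁻¹ := by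
      rw [← Int.floor_add_fract x⁻¹, ← hc]
      simp
    have hxe : x = ((c : K) + Int.fract x⁻¹)⁻¹ := by rw [hcy, inv_inv]
    obtain ⟨h3, h4⟩ := of_inv_natCast_add (Int.fract_nonneg x⁻¹) (Int.fract_lt_one x⁻¹)
      (by rw [hcy]; exact hxi)
    rw [← hxe] at h3 h4
    obtain ⟨u, z, hlen, hu, hz, hz1, hxz, hs⟩ := ih (Int.fract_nonneg x⁻¹) (Int.fract_lt_one x⁻¹)
      (by
        intro k hk
        obtain ⟨d, hd⟩ := h (k + 1) (by omega)
        obtain ⟨gp, hgp, rfl⟩ := GenContFract.exists_s_b_of_partDen hd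
        rw [h4] at hgp
        exact ⟨_, GenContFract.partDen_eq_s_b hgp⟩)
    refine ⟨c :: u, z, by simp [hlen], posWord_cons.2 ⟨hc1, hu⟩, hz, hz1, ?_, ?_⟩
    · rw [cfEval_cons c hu hz, ← hxz]; exact hxe
    · intro k d hk
      cases k with
      | zero => simp at hk; rw [h3, hk]
      | succ k => rw [h4]; exact hs k d (by simpa using hk)

end Expansion

/-! ### Membership in Z_M(t) in terms of words. -/

section Zaremba

variable {q M : ℕ} {t : ℝ}

/-- The expansion of an element of `Z_M(t)` starts with a word whose denominator is the first one
to reach `T ≤ t`. -/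
theorem exists_stopWord_of_mem_zarembaSet {a : ZMod q} [NeZero q] (ha : a ∈ zarembaSet q M t)
    {T : ℝ} (hT : T ≤ t) :
    ∃ (u : List ℕ) (z : ℝ), IsWord M u ∧ T ≤ cden u ∧ (u ≠ [] → (cden u.dropLast : ℝ) < T) ∧
      0 ≤ z ∧ z < 1 ∧ (a.val : ℝ) / q = cfEval u z := by
  have hq : (0 : ℚ) < q := by exact_mod_cast NeZero.pos q
  set x : ℚ := (a.val : ℚ) / q with hx
  have hx0 : 0 ≤ x := by positivity
  have hx1 : x < 1 := by
    rw [hx, div_lt_one hq]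
    exact_mod_cast a.val_lt
  have key : ∀ n, (∀ k < n, (((resFract a).dens k : ℚ) : ℝ) < T) →
      ∃ (u : List ℕ) (z : ℚ), u.length = n ∧ IsWord M u ∧ 0 ≤ z ∧ z < 1 ∧ x = cfEval u z ∧
        ∀ k ≤ n, (resFract a).dens k = cden (u.take k) := by
    intro n hn
    have hpd : ∀ k < n, ∃ c : ℚ, (resFract a).partDens.get? k = some c ∧ c ≤ (M : ℚ) :=
      fun k hk => ha k ((hn k hk).trans_le hT)
    obtain ⟨u, z, hlen, hu, hz, hz1, hxz, hs⟩ := exists_word_of_partDens (n := n) hx0 hx1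
      (fun k hk => (hpd k hk).imp fun _ h => h.1)
    refine ⟨u, z, hlen, fun c hc => ⟨hu c hc, ?_⟩, hz, hz1, hxz, ?_⟩
    · obtain ⟨k, hk⟩ := List.mem_iff_getElem?.1 hc
      have hkn : k < n := by
        rw [← hlen]
        exact (List.getElem?_eq_some_iff.1 hk).1
      obtain ⟨d, hd, hdM⟩ := hpd k hkn
      have h1 := GenContFract.partDen_eq_s_b (hs k c hk)
      have h2 : (resFract a).partDens.get? k = some (c : ℚ) := h1
      rw [h2] at hd
      simp only [Option.some.injEq] at hd
      rw [← hd] at hdM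
      exact_mod_cast hdM
    · intro k hk
      exact of_dens_eq_cden hs k (hlen ▸ hk)
  -- If all denominators stayed below T, every partial quotient would exist, and the denominators
  -- would grow exponentially.
  have hex : ∃ n, T ≤ (((resFract a).dens n : ℚ) : ℝ) := by
    by_contra hcon
    push Not at hcon
    obtain ⟨n, hn⟩ := pow_unbounded_of_one_lt T (one_lt_two : (1 : ℝ) < 2)
    obtain ⟨u, z, hlen, hu, -, -, -, hd⟩ := key (2 * n) (fun k _ => hcon k)
    have h1 := hcon (2 * n)
    rw [hd _ le_rfl, ← hlen, List.take_length] at h1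
    have h2 := two_pow_le_cden hu.pos
    rw [hlen, Nat.mul_div_cancel_left _ (by norm_num)] at h2
    have h3 : (2 : ℝ) ^ n ≤ cden u := by exact_mod_cast h2
    push_cast at h1
    linarith
  classical
  obtain ⟨u, z, hlen, hu, hz, hz1, hxz, hd⟩ := key (Nat.find hex)
    (fun k hk => not_le.1 (Nat.find_min hex hk))
  refine ⟨u, (z : ℝ), hu, ?_, ?_, by exact_mod_cast hz, by exact_mod_cast hz1, ?_⟩
  · have := Nat.find_spec hex
    rw [hd _ le_rfl, ← hlen, List.take_length] at this
    simpa using this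
  · intro hne
    have hpos : 0 < u.length := List.length_pos_iff.2 hne
    have h1 := not_le.1 (Nat.find_min hex (m := u.length - 1) (by omega))
    rw [hd _ (by omega), ← List.dropLast_eq_take] at h1
    simpa using h1
  · rw [← cfEval_cast, ← hxz, hx]
    push_cast
    rfl

/-- Denominators are monotone, so an index n with q_n < t ≤ q(u) lies strictly inside u. The next
partial quotient therefore exists and is a letter of u. -/
theorem mem_zarembaSet_of_word {a : ZMod q} {u : List ℕ} (hu : IsWord M u)
    (h : ∀ (k : ℕ) (c : ℕ), u[k]? = some c → (resFract a).s.get? k = some ⟨1, (c : ℚ)⟩)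
    (ht : t ≤ cden u) : a ∈ zarembaSet q M t := by
  intro n hn
  have hlt : n < u.length := by
    by_contra hcon
    have hmono : (resFract a).dens u.length ≤ (resFract a).dens n :=
      monotone_nat_of_le_succ (f := (resFract a).dens) (fun k => GenContFract.of_den_mono)
        (not_lt.1 hcon)
    rw [show (resFract a).dens u.length = _ from of_dens_eq_cden h _ le_rfl,
      List.take_length] at hmono
    have : ((cden u : ℚ) : ℝ) ≤ (((resFract a).dens n : ℚ) : ℝ) := by exact_mod_cast hmono
    push_cast at this
    linarith
  have hg : u[n]? = some u[n] := List.getElem?_eq_getElem hlt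
  exact ⟨_, GenContFract.partDen_eq_s_b (h _ _ hg), 
    Nat.cast_le.2 (hu _ (List.getElem_mem hlt)).2⟩

/-- The inverse Möbius map has integer coefficients, so the tail of a rational number is rational;
its denominator cannot vanish because the determinant is ±1. This passes from real cylinders to
expansions over ℚ. -/
theorem exists_rat_eval_eq {u : List ℕ} (hu : PosWord u) {z : ℝ} (hz : 0 < z) {x : ℚ}
    (h : (x : ℝ) = cfEval u z) : ∃ y : ℚ, (y : ℝ) = z ∧ x = cfEval u y := by
  have hX := (hu.eval_den_pos hz.le).ne'
  have hdet : (cnum' u : ℝ) * cden u - cnum u * cden' u = (-1) ^ u.length := by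
    have := congrArg (Int.cast : ℤ → ℝ) (cden_det u)
    push_cast at this
    exact this
  have h1 : (x : ℝ) * (cden u + cden' u * z) = cnum u + cnum' u * z := by
    rw [h, cfEval, div_mul_cancel₀ _ hX]
  have hne : (cnum' u : ℝ) - x * cden' u ≠ 0 := by
    intro h0
    have h2 : (x : ℝ) * cden u = cnum u := by
      have : (x : ℝ) * cden u - cnum u = z * (cnum' u - x * cden' u) := by linarith
      rw [h0, mul_zero] at this
      linarith
    have h3 : ((-1 : ℝ)) ^ u.length = 0 := by
      rw [← hdet, ← h2, show (cnum' u : ℝ) = x * cden' u by linarith]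
      ring
    exact absurd h3 (pow_ne_zero _ (by norm_num))
  have hyz : (((x * cden u - cnum u) / (cnum' u - x * cden' u) : ℚ) : ℝ) = z := by
    push_cast
    rw [div_eq_iff hne]
    linarith
  refine ⟨_, hyz, ?_⟩
  have : ((x : ℚ) : ℝ) = ((cfEval u ((x * cden u - cnum u) / (cnum' u - x * cden' u)) : ℚ) : ℝ) := by
    rw [cfEval_cast, hyz, h]
  exact_mod_cast this

/-- A residue in the open cylinder of a word with large denominator belongs to `Z_M(t)`. -/
theorem mem_zarembaSet_of_eval {a : ZMod q} {u : List ℕ} (hu : IsWord M u) (ht : t ≤ cden u)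
    {z : ℝ} (hz : 0 < z) (hz1 : z < 1) (h : (a.val : ℝ) / q = cfEval u z) :
    a ∈ zarembaSet q M t := by
  obtain ⟨y, rfl, hy⟩ := exists_rat_eval_eq hu.pos hz (x := (a.val : ℚ) / q)
    (by push_cast; exact h)
  refine mem_zarembaSet_of_word hu ?_ ht
  rw [resFract, hy]
  exact (of_cfEval hu.pos (by exact_mod_cast hz) (by exact_mod_cast hz1)).1

/-- The same for `[0; u + 1 / ζ]` with the word `u ⌊ζ⌋`; here `ζ` may be an integer. -/
theorem mem_zarembaSet_of_eval_inv {a : ZMod q} {u : List ℕ} {c : ℕ} (hu : IsWord M (u ++ [c]))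
    (ht : t ≤ cden (u ++ [c])) {ζ : ℝ} (hζ : 1 < ζ) (hc : (c : ℝ) ≤ ζ) (hc1 : ζ < c + 1)
    (h : (a.val : ℝ) / q = cfEval u ζ⁻¹) : a ∈ zarembaSet q M t := by
  have hu' := (isWord_append.1 hu).1
  have hz : 0 < ζ⁻¹ := by positivity
  have hz1 : ζ⁻¹ < 1 := inv_lt_one_of_one_lt₀ hζ
  obtain ⟨y, hyz, hy⟩ := exists_rat_eval_eq hu'.pos hz (x := (a.val : ℚ) / q)
    (by push_cast; exact h)
  have hyζ : (y : ℝ)⁻¹ = ζ := by rw [hyz, inv_inv]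
  have hyz1 : c ≤ y⁻¹ := by
    have : ((c : ℚ) : ℝ) ≤ ((y⁻¹ : ℚ) : ℝ) := by push_cast; rw [hyζ]; exact hc
    exact_mod_cast this
  have hyz2 : y⁻¹ < c + 1 := by
    have : ((y⁻¹ : ℚ) : ℝ) < ((c + 1 : ℚ) : ℝ) := by push_cast; rw [hyζ]; exact hc1
    exact_mod_cast this
  have hyz3 : 1 < y⁻¹ := by
    have : ((1 : ℚ) : ℝ) < ((y⁻¹ : ℚ) : ℝ) := by push_cast; rw [hyζ]; exact hζ
    exact_mod_cast this
  rw [← hyz] at hz hz1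
  obtain ⟨h1, h2⟩ := of_cfEval hu'.pos (K := ℚ) (z := y) (by exact_mod_cast hz)
    (by exact_mod_cast hz1)
  obtain ⟨h3, -⟩ := of_inv_natCast_add (c := c) (y := y⁻¹ - c) (by linarith) (by linarith)
    (by simpa using hyz3)
  refine mem_zarembaSet_of_word hu ?_ ht
  rw [resFract, hy]
  intro k d hk
  rcases lt_trichotomy k u.length with hlt | rfl | hgt
  · rw [List.getElem?_append_left hlt] at hk
    exact h1 k d hk
  · simp at hk
    have := h2 0
    rw [add_zero] at this
    rw [this, ← hk]
    simpa using h3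
  · rw [List.getElem?_eq_none (by simp; omega)] at hk
    simp at hk

end Zaremba

section

/-! ### The conformal mass on the tree of words -/

open Filter Topology

/-- The words of length `n` over `{1, …, M}`. -/
def words (M n : ℕ) : Finset (List ℕ) :=
  match n with
  | 0 => {[]}
  | n + 1 => (Finset.Icc 1 M ×ˢ words M n).image fun p => p.1 :: p.2

theorem mem_words {M n : ℕ} {u : List ℕ} : u ∈ words M n ↔ IsWord M u ∧ u.length = n := by
  induction n generalizing u with
  | zero =>
    simp only [words, Finset.mem_singleton, List.length_eq_zero_iff]
    exact ⟨fun h => ⟨h ▸ isWord_nil M, h⟩, fun h => h.2⟩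
  | succ n ih =>
    simp only [words, Finset.mem_image, Finset.mem_product, Finset.mem_Icc, Prod.exists, ih]
    constructor
    · rintro ⟨c, v, ⟨hc, hv, rfl⟩, rfl⟩
      exact ⟨isWord_cons.2 ⟨hc, hv⟩, by simp⟩
    · rintro ⟨h, hl⟩
      cases u with
      | nil => simp at hl
      | cons c v => exact ⟨c, v, ⟨(isWord_cons.1 h).1, (isWord_cons.1 h).2, by simpa using hl⟩, rfl⟩

theorem sum_words_add (M n k : ℕ) (f : List ℕ → ℝ) :
    ∑ u ∈ words M (n + k), f u = ∑ u ∈ words M n, ∑ v ∈ words M k, f (u ++ v) := by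
  rw [← Finset.sum_product']
  symm
  refine Finset.sum_nbij' (fun p => p.1 ++ p.2) (fun u => (u.take n, u.drop n)) ?_ ?_ ?_ ?_ ?_
  · rintro ⟨u, v⟩ h
    simp only [Finset.mem_product, mem_words] at h ⊢
    exact ⟨isWord_append.2 ⟨h.1.1, h.2.1⟩, by simp [h.1.2, h.2.2]⟩
  · intro u h
    simp only [Finset.mem_product, mem_words] at h ⊢
    refine ⟨⟨fun c hc => h.1 c (List.mem_of_mem_take hc), by simp [h.2]⟩,
      ⟨fun c hc => h.1 c (List.mem_of_mem_drop hc), by simp [h.2]⟩⟩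
  · rintro ⟨u, v⟩ h
    simp only [Finset.mem_product, mem_words] at h
    simp [← h.1.2]
  · intro u _
    simp
  · rintro ⟨u, v⟩ _
    rfl

theorem sum_words_one (M : ℕ) (f : List ℕ → ℝ) :
    ∑ u ∈ words M 1, f u = ∑ c ∈ Finset.Icc 1 M, f [c] := by
  symm
  refine Finset.sum_nbij (fun c => [c]) ?_ ?_ ?_ ?_
  · intro c hc
    simp only [mem_words, isWord_singleton]
    simpa using hc
  · intro a _ b _ h
    simpa using h
  · intro u hu
    obtain ⟨h1, h2⟩ := mem_words.1 hu
    obtain ⟨c, rfl⟩ := List.length_eq_one_iff.1 h2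
    exact ⟨c, by simpa [isWord_singleton] using h1, rfl⟩
  · intros; rfl

theorem sum_words_cons (M n : ℕ) (f : List ℕ → ℝ) :
    ∑ u ∈ words M (n + 1), f u = ∑ c ∈ Finset.Icc 1 M, ∑ u ∈ words M n, f (c :: u) := by
  rw [add_comm, sum_words_add, sum_words_one]
  simp

theorem sum_words_snoc (M n : ℕ) (f : List ℕ → ℝ) :
    ∑ u ∈ words M (n + 1), f u = ∑ u ∈ words M n, ∑ c ∈ Finset.Icc 1 M, f (u ++ [c]) := by
  rw [sum_words_add]
  exact Finset.sum_congr rfl fun u _ => sum_words_one M fun v => f (u ++ v)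

/-- The weight `q(u)^{-2s}`. -/
noncomputable def cfWeight (s : ℝ) (u : List ℕ) : ℝ := (cden u : ℝ) ^ (-(2 * s))

/-- The partition sum over the words of length `n`. -/
noncomputable def cfSum (M : ℕ) (s : ℝ) (n : ℕ) : ℝ := ∑ u ∈ words M n, cfWeight s u

theorem PosWord.one_le_cden_real {u : List ℕ} (hu : PosWord u) : (1 : ℝ) ≤ cden u := by
  exact_mod_cast hu.one_le_cden

theorem cfWeight_pos (s : ℝ) {u : List ℕ} (hu : PosWord u) : 0 < cfWeight s u :=
  Real.rpow_pos_of_pos (by linarith [hu.one_le_cden_real]) _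

@[simp] theorem cfWeight_nil (s : ℝ) : cfWeight s [] = 1 := by simp [cfWeight]

theorem cfWeight_append_le {s : ℝ} (hs : 0 ≤ s) {u v : List ℕ} (hu : PosWord u) (hv : PosWord v) :
    cfWeight s (u ++ v) ≤ cfWeight s u * cfWeight s v := by
  have h1 := hu.one_le_cden_real
  have h2 := hv.one_le_cden_real
  rw [cfWeight, cfWeight, cfWeight, ← Real.mul_rpow (by linarith) (by linarith)]
  refine Real.rpow_le_rpow_of_nonpos (by positivity) ?_ (by linarith)
  exact_mod_cast cden_mul_le u v

theorem le_cfWeight_append {s : ℝ} (hs : 0 ≤ s) {u v : List ℕ} (hu : PosWord u)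
    (hv : PosWord v) :
    (4 : ℝ) ^ (-s) * (cfWeight s u * cfWeight s v) ≤ cfWeight s (u ++ v) := by
  have h1 := hu.one_le_cden_real
  have h2 := hv.one_le_cden_real
  have h3 := (posWord_append.2 ⟨hu, hv⟩).one_le_cden_real
  have h4 : (4 : ℝ) ^ (-s) = 2 ^ (-(2 * s)) := by
    rw [show (4 : ℝ) = 2 ^ (2 : ℝ) by norm_num, ← Real.rpow_mul (by norm_num)]
    congr 1; ring
  rw [h4, cfWeight, cfWeight, cfWeight, ← Real.mul_rpow (by linarith) (by linarith),
    ← Real.mul_rpow (by linarith) (by positivity)]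
  refine Real.rpow_le_rpow_of_nonpos (by linarith) ?_ (by linarith)
  exact_mod_cast cden_append_le hu hv

theorem cfWeight_anti {u : List ℕ} (hu : PosWord u) {s s' : ℝ} (h : s ≤ s') :
    cfWeight s' u ≤ cfWeight s u :=
  Real.rpow_le_rpow_of_exponent_le hu.one_le_cden_real (by linarith)

theorem cfSum_anti (M n : ℕ) {s s' : ℝ} (h : s ≤ s') : cfSum M s' n ≤ cfSum M s n :=
  Finset.sum_le_sum fun _ hu => cfWeight_anti (mem_words.1 hu).1.pos h

theorem continuous_cfSum (M n : ℕ) : Continuous fun s => cfSum M s n := by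
  refine continuous_finsetSum _ fun u hu => ?_
  have := (mem_words.1 hu).1.pos.one_le_cden_real
  exact Real.continuous_const_rpow (by linarith) |>.comp (by fun_prop)

@[simp] theorem cfSum_zero (M : ℕ) (s : ℝ) : cfSum M s 0 = 1 := by simp [cfSum, words]

theorem cfSum_nonneg (M : ℕ) (s : ℝ) (n : ℕ) : 0 ≤ cfSum M s n :=
  Finset.sum_nonneg fun _ hu => (cfWeight_pos s (mem_words.1 hu).1.pos).le

theorem sum_cfWeight_append_le {M : ℕ} {s : ℝ} (hs : 0 ≤ s) {u : List ℕ} (hu : PosWord u) (k : ℕ) :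
    ∑ v ∈ words M k, cfWeight s (u ++ v) ≤ cfWeight s u * cfSum M s k := by
  rw [cfSum, Finset.mul_sum]
  exact Finset.sum_le_sum fun v hv => cfWeight_append_le hs hu (mem_words.1 hv).1.pos

theorem le_sum_cfWeight_append {M : ℕ} {s : ℝ} (hs : 0 ≤ s) {u : List ℕ} (hu : PosWord u) (k : ℕ) :
    (4 : ℝ) ^ (-s) * (cfWeight s u * cfSum M s k) ≤ ∑ v ∈ words M k, cfWeight s (u ++ v) := by
  rw [cfSum, Finset.mul_sum, Finset.mul_sum]
  exact Finset.sum_le_sum fun v hv => le_cfWeight_append hs hu (mem_words.1 hv).1.pos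

theorem cfSum_add_le {M : ℕ} {s : ℝ} (hs : 0 ≤ s) (n k : ℕ) :
    cfSum M s (n + k) ≤ cfSum M s n * cfSum M s k := by
  rw [cfSum, sum_words_add]
  conv_rhs => rw [cfSum, Finset.sum_mul]
  exact Finset.sum_le_sum fun u hu => sum_cfWeight_append_le hs (mem_words.1 hu).1.pos k

theorem le_cfSum_add {M : ℕ} {s : ℝ} (hs : 0 ≤ s) (n k : ℕ) :
    (4 : ℝ) ^ (-s) * (cfSum M s n * cfSum M s k) ≤ cfSum M s (n + k) := by
  conv_rhs => rw [cfSum, sum_words_add]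
  conv_lhs => rw [cfSum, Finset.sum_mul, Finset.mul_sum]
  exact Finset.sum_le_sum fun u hu => le_sum_cfWeight_append hs (mem_words.1 hu).1.pos k

theorem cfSum_mul_le {M : ℕ} {s : ℝ} (hs : 0 ≤ s) (n k : ℕ) :
    cfSum M s (n * k) ≤ cfSum M s n ^ k := by
  induction k with
  | zero => simp
  | succ k ih =>
    rw [Nat.mul_succ, pow_succ]
    exact (cfSum_add_le hs _ _).trans (mul_le_mul_of_nonneg_right ih (cfSum_nonneg _ _ _))

/-- Concatenation loses a factor 4^(-s), so it is the sum divided by 4^s that is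
supermultiplicative. -/
theorem le_cfSum_mul {M : ℕ} {s : ℝ} (hs : 0 ≤ s) (n k : ℕ) :
    (4 : ℝ) ^ s * (cfSum M s n / 4 ^ s) ^ (k + 1) ≤ cfSum M s (n * (k + 1)) := by
  have h4 : (0 : ℝ) < 4 ^ s := by positivity
  induction k with
  | zero => simp [mul_div_cancel₀, h4.ne']
  | succ k ih =>
    rw [Nat.mul_succ]
    refine le_trans ?_ (le_cfSum_add hs _ _)
    rw [Real.rpow_neg (by norm_num), pow_succ (_ / _)]
    calc _ = (4 ^ s)⁻¹ * ((4 ^ s * (cfSum M s n / 4 ^ s) ^ (k + 1)) * cfSum M s n) := by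
          field_simp
      _ ≤ _ := by
          gcongr
          exact cfSum_nonneg _ _ _

/-- The critical exponent of the partition sums. -/
noncomputable def critExp (M : ℕ) : ℝ := sInf {s : ℝ | 0 ≤ s ∧ ∃ n, cfSum M s n < 1}

theorem critExp_set_nonempty (M : ℕ) : {s : ℝ | 0 ≤ s ∧ ∃ n, cfSum M s n < 1}.Nonempty := by
  obtain ⟨k, hk⟩ := exists_pow_lt_of_lt_one (show (0 : ℝ) < 1 / ((words M 2).card + 1) by positivity)
    (show (1 / 4 : ℝ) < 1 by norm_num)
  refine ⟨k, by positivity, 2, ?_⟩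
  have h : ∀ u ∈ words M 2, cfWeight k u ≤ (1 / 4 : ℝ) ^ k := by
    intro u hu
    obtain ⟨h1, h2⟩ := mem_words.1 hu
    have h3 := two_pow_le_cden h1.pos
    rw [h2] at h3
    have h4 : (2 : ℝ) ≤ cden u := by exact_mod_cast h3
    calc cfWeight k u ≤ (2 : ℝ) ^ (-(2 * (k : ℝ))) :=
          Real.rpow_le_rpow_of_nonpos (by norm_num) h4 (by simp)
      _ = (1 / 4 : ℝ) ^ k := by
          rw [Real.rpow_neg (by norm_num), Real.rpow_mul (by norm_num), Real.rpow_natCast,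
            one_div, inv_pow]
          norm_num
  calc cfSum M k 2 ≤ ∑ _u ∈ words M 2, (1 / 4 : ℝ) ^ k := Finset.sum_le_sum h
    _ = (words M 2).card * (1 / 4 : ℝ) ^ k := by simp
    _ ≤ ((words M 2).card + 1) * (1 / 4 : ℝ) ^ k := by gcongr; linarith
    _ < ((words M 2).card + 1) * (1 / ((words M 2).card + 1)) := by gcongr
    _ = 1 := by field_simp

theorem critExp_set_bddBelow (M : ℕ) : BddBelow {s : ℝ | 0 ≤ s ∧ ∃ n, cfSum M s n < 1} :=
  ⟨0, fun _ h => h.1⟩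

theorem critExp_nonneg (M : ℕ) : 0 ≤ critExp M :=
  le_csInf (critExp_set_nonempty M) fun _ h => h.1

theorem exists_cfSum_lt_one {M : ℕ} {s : ℝ} (hs : critExp M < s) : ∃ n, cfSum M s n < 1 := by
  obtain ⟨s', ⟨-, n, hn⟩, h⟩ := exists_lt_of_csInf_lt (critExp_set_nonempty M) hs
  exact ⟨n, (cfSum_anti M n h.le).trans_lt hn⟩

/-- A partition sum below 1 would, by continuity, still be below 1 at a slightly smaller exponent,
against the infimum. At exponent 0 the sum counts words, and there is at least one. -/
theorem one_le_cfSum_critExp {M : ℕ} (hM : 1 ≤ M) (n : ℕ) : 1 ≤ cfSum M (critExp M) n := by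
  by_contra! h
  rcases (critExp_nonneg M).eq_or_lt with h0 | h0
  · rw [← h0, cfSum] at h
    have : ∑ u ∈ words M n, cfWeight 0 u = (words M n).card := by simp [cfWeight]
    rw [this] at h
    have h1 : (words M n).card = 0 := by
      have : (words M n).card < 1 := by exact_mod_cast h
      omega
    rw [Finset.card_eq_zero] at h1
    have h2 : List.replicate n 1 ∈ words M n :=
      mem_words.2 ⟨isWord_replicate_one hM n, by simp⟩
    simp [h1] at h2
  · have h1 : ∀ᶠ s in 𝓝 (critExp M), cfSum M s n < 1 :=
      (continuous_cfSum M n).continuousAt.eventually_lt continuousAt_const h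
    obtain ⟨ε, hε, h2⟩ := Metric.eventually_nhds_iff.1 h1
    set s := max 0 (critExp M - ε / 2) with hs
    have hs1 : s < critExp M := max_lt h0 (by linarith)
    have h3 : cfSum M s n < 1 := by
      apply h2
      rw [Real.dist_eq, abs_lt]
      have := le_max_right 0 (critExp M - ε / 2)
      constructor <;> linarith
    exact absurd (csInf_le (critExp_set_bddBelow M) ⟨le_max_left _ _, n, h3⟩) (not_le.2 hs1)

/-- A sum exceeding 4^s at the critical exponent would do so at some larger s, and
supermultiplicativity would then keep the sums along multiples of n above 1. But beyond the critical
exponent some sum is below 1, and submultiplicativity bounds the sums along its multiples by 1. -/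
theorem cfSum_critExp_le (M : ℕ) (n : ℕ) : cfSum M (critExp M) n ≤ 4 ^ critExp M := by
  by_contra! h
  have h1 : ∀ᶠ s in 𝓝 (critExp M), (4 : ℝ) ^ s < cfSum M s n :=
    (Real.continuous_const_rpow (by norm_num : (4 : ℝ) ≠ 0)).continuousAt.eventually_lt
      (continuous_cfSum M n).continuousAt h
  obtain ⟨ε, hε, h2⟩ := Metric.eventually_nhds_iff.1 h1
  have h3 : (4 : ℝ) ^ (critExp M + ε / 2) < cfSum M (critExp M + ε / 2) n := by
    apply h2
    rw [Real.dist_eq, abs_lt]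
    constructor <;> linarith
  set s := critExp M + ε / 2 with hs
  have hs0 : 0 ≤ s := by linarith [critExp_nonneg M]
  obtain ⟨k, hk⟩ := exists_cfSum_lt_one (show critExp M < s by linarith)
  have h4 : (0 : ℝ) < 4 ^ s := by positivity
  have h6 : (1 : ℝ) ≤ 4 ^ s := Real.one_le_rpow (by norm_num) hs0
  cases k with
  | zero => simp at hk
  | succ k =>
    have h5 := le_cfSum_mul (M := M) hs0 n k
    have h7 : cfSum M s ((k + 1) * n) ≤ 1 :=
      (cfSum_mul_le hs0 _ _).trans (pow_le_one₀ (cfSum_nonneg _ _ _) hk.le)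
    rw [mul_comm (k + 1)] at h7
    have h8 : 1 < (cfSum M s n / 4 ^ s) ^ (k + 1) :=
      one_lt_pow₀ ((one_lt_div h4).2 h3) (by omega)
    nlinarith

/-- The conformal mass at the critical exponent. -/
theorem exists_mass_critExp {M : ℕ} (hM : 1 ≤ M) :
    ∃ m : List ℕ → ℝ, m [] = 1 ∧
      (∀ u, IsWord M u → m u = ∑ c ∈ Finset.Icc 1 M, m (u ++ [c])) ∧
      ∀ u, IsWord M u → (4 : ℝ) ^ (-(2 * critExp M)) * cfWeight (critExp M) u ≤ m u ∧
        m u ≤ (4 : ℝ) ^ critExp M * cfWeight (critExp M) u := by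
  set s := critExp M with hs
  have hs0 : 0 ≤ s := critExp_nonneg M
  -- The share of u in the partition sum of level n. It is additive in u as soon as n > |u|, and its
  -- bounds are uniform in n.
  set mn : ℕ → List ℕ → ℝ := fun n u =>
    (∑ z ∈ words M (n - u.length), cfWeight s (u ++ z)) / cfSum M s n with hmn
  have h4 : (0 : ℝ) < 4 ^ s := by positivity
  have hP : ∀ n, 0 < cfSum M s n := fun n => zero_lt_one.trans_le (one_le_cfSum_critExp hM n)
  have hbd : ∀ n u, IsWord M u → (4 : ℝ) ^ (-(2 * s)) * cfWeight s u ≤ mn n u ∧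
      mn n u ≤ (4 : ℝ) ^ s * cfWeight s u := by
    intro n u hu
    have hw := cfWeight_pos s hu.pos
    have h1 := sum_cfWeight_append_le (M := M) hs0 hu.pos (n - u.length)
    have h2 := le_sum_cfWeight_append (M := M) hs0 hu.pos (n - u.length)
    have h3 := one_le_cfSum_critExp hM (n - u.length)
    have h3' := cfSum_critExp_le M (n - u.length)
    have h5 := one_le_cfSum_critExp hM n
    have h5' := cfSum_critExp_le M n
    rw [← hs] at h3 h3' h5 h5'
    constructor
    · rw [le_div_iff₀ (hP n)]
      refine le_trans ?_ h2
      have h6 : (4 : ℝ) ^ (-(2 * s)) = 4 ^ (-s) * (4 ^ s)⁻¹ := by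
        rw [← Real.rpow_neg (by norm_num), ← Real.rpow_add (by norm_num)]
        congr 1; ring
      rw [h6]
      calc (4 : ℝ) ^ (-s) * (4 ^ s)⁻¹ * cfWeight s u * cfSum M s n
          ≤ (4 : ℝ) ^ (-s) * (4 ^ s)⁻¹ * cfWeight s u * 4 ^ s := by gcongr
        _ = (4 : ℝ) ^ (-s) * (cfWeight s u * 1) := by field_simp
        _ ≤ _ := by gcongr
    · rw [div_le_iff₀ (hP n)]
      refine h1.trans ?_
      calc cfWeight s u * cfSum M s (n - u.length) ≤ cfWeight s u * 4 ^ s := by gcongr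
        _ = 4 ^ s * cfWeight s u * 1 := by ring
        _ ≤ _ := by gcongr
  -- A limit along a nonprincipal ultrafilter exists for all words simultaneously and inherits both
  -- additivity and bounds.
  set F : Ultrafilter ℕ := hyperfilter ℕ with hF
  have hlim : ∀ u, ∃ x, IsWord M u → Tendsto (fun n => mn n u) F (𝓝 x) := by
    intro u
    by_cases hu : IsWord M u
    · have hc : IsCompact (Set.Icc ((4 : ℝ) ^ (-(2 * s)) * cfWeight s u)
        ((4 : ℝ) ^ s * cfWeight s u)) := isCompact_Icc
      obtain ⟨x, -, hx⟩ := hc.ultrafilter_le_nhds (F.map fun n => mn n u) (by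
        rw [le_principal_iff]
        exact Filter.univ_mem' (f := (F : Filter ℕ)) (fun n => hbd n u hu))
      exact ⟨x, fun _ => hx⟩
    · exact ⟨0, fun h => absurd h hu⟩
  choose m hm using hlim
  have hge : ∀ k : ℕ, ∀ᶠ n in (F : Filter ℕ), k ≤ n := fun k =>
    (Nat.hyperfilter_le_atTop) (eventually_ge_atTop k)
  refine ⟨m, ?_, ?_, ?_⟩
  · refine tendsto_nhds_unique (hm [] (isWord_nil M)) (tendsto_const_nhds.congr fun n => ?_)
    simp only [hmn, List.length_nil, Nat.sub_zero, List.nil_append]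
    exact (div_self (hP n).ne').symm
  · intro u hu
    have h1 : Tendsto (fun n => ∑ c ∈ Finset.Icc 1 M, mn n (u ++ [c])) F
        (𝓝 (∑ c ∈ Finset.Icc 1 M, m (u ++ [c]))) :=
      tendsto_finsetSum _ fun c hc =>
        hm _ (isWord_append.2 ⟨hu, isWord_singleton.2 (by simpa using hc)⟩)
    refine tendsto_nhds_unique (hm u hu) (h1.congr' ?_)
    filter_upwards [hge (u.length + 1)] with n hn
    simp only [hmn]
    rw [← Finset.sum_div, show n - u.length = (n - (u.length + 1)) + 1 by omega, sum_words_cons]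
    congr 1
    refine Finset.sum_congr rfl fun c _ => ?_
    simp
  · intro u hu
    exact ⟨ge_of_tendsto (hm u hu) (Eventually.of_forall fun n => (hbd n u hu).1),
      le_of_tendsto (hm u hu) (Eventually.of_forall fun n => (hbd n u hu).2)⟩

end

section

/-! ### The Hausdorff dimension is the critical exponent -/

open Filter Topology MeasureTheory

theorem mem_boundedTypeSet_partDens {M : ℕ} {x : ℝ} (hx : x ∈ boundedTypeSet M) (n : ℕ) :
    ∃ u ∈ words M n, ∃ z : ℝ, 0 ≤ z ∧ z < 1 ∧ x = cfEval u z := by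
  obtain ⟨⟨h0, h1⟩, hirr, hb⟩ := hx
  have hx1 : x < 1 := lt_of_le_of_ne h1 hirr.ne_one
  have hsome : ∀ k, ∃ c, (GenContFract.of x).partDens.get? k = some c := by
    intro k
    by_contra hcon
    push Not at hcon
    have hnone := Option.eq_none_iff_forall_ne_some.2 hcon
    have hterm : (GenContFract.of x).Terminates :=
      ⟨k, GenContFract.terminatedAt_iff_partDen_none.2 hnone⟩
    obtain ⟨r, hr⟩ := (GenContFract.terminates_iff_rat x).1 hterm
    exact hirr ⟨r, hr.symm⟩
  obtain ⟨u, z, hlen, hu, hz, hz1, hxz, hs⟩ :=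
    exists_word_of_partDens (n := n) h0 hx1 fun k _ => hsome k
  refine ⟨u, mem_words.2 ⟨fun c hc => ⟨hu c hc, ?_⟩, hlen⟩, z, hz, hz1, hxz⟩
  obtain ⟨k, hk⟩ := List.mem_iff_getElem?.1 hc
  have := hb k c (GenContFract.partDen_eq_s_b (hs k c hk))
  exact_mod_cast this

theorem ediam_cylinder_le {u : List ℕ} (hu : PosWord u) :
    Metric.ediam (cfEval u '' Set.Icc (0 : ℝ) 1) ≤ ENNReal.ofReal (((cden u : ℝ) ^ 2)⁻¹) := by
  refine Metric.ediam_le ?_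
  rintro _ ⟨y, hy, rfl⟩ _ ⟨z, hz, rfl⟩
  rw [edist_dist, Real.dist_eq]
  refine ENNReal.ofReal_le_ofReal ((hu.abs_eval_sub_le hy.1 hz.1).trans ?_)
  rw [div_eq_mul_inv]
  refine mul_le_of_le_one_left (by positivity) ?_
  rw [abs_le]
  constructor <;> linarith [hy.1, hy.2, hz.1, hz.2]

theorem cfWeight_eq_rpow (s : ℝ) (u : List ℕ) : cfWeight s u = (((cden u : ℝ) ^ 2)⁻¹) ^ s := by
  rw [cfWeight, Real.inv_rpow (by positivity), ← Real.rpow_natCast, ← Real.rpow_mul (by positivity),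
    Real.rpow_neg (by positivity)]
  norm_num

/-- Above the critical exponent some partition sum of length k is below 1. The cylinders of words of
length k n then cover with sum of d-th powers of diameters at most the n-th power of that sum. -/
theorem dimH_boundedTypeSet_le (M : ℕ) :
    dimH (boundedTypeSet M) ≤ ENNReal.ofReal (critExp M) := by
  refine le_of_forall_gt_imp_ge_of_dense fun d hd => ?_
  rcases eq_or_ne d ⊤ with rfl | hdt
  · exact le_top
  lift d to NNReal using hdt
  have hs : critExp M < d := by
    have := (ENNReal.ofReal_lt_iff_lt_toReal (critExp_nonneg M) (by simp)).1 hd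
    simpa using this
  obtain ⟨k, hk⟩ := exists_cfSum_lt_one hs
  have hk0 : k ≠ 0 := by rintro rfl; simp at hk
  refine dimH_le_of_hausdorffMeasure_ne_top (ne_top_of_le_ne_top ENNReal.one_ne_top ?_)
  have hpos : ∀ n, ∀ i : {u // u ∈ words M (k * n)}, PosWord i.1 :=
    fun n i => (mem_words.1 i.2).1.pos
  refine (Measure.hausdorffMeasure_le_liminf_sum (ι := fun n : ℕ => {u // u ∈ words M (k * n)})
    (d : ℝ) (boundedTypeSet M) (l := atTop)
    (fun n : ℕ => ENNReal.ofReal (((2 : ℝ) ^ (n / 2))⁻¹)) ?_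
    (fun n i => cfEval i.1 '' Set.Icc (0 : ℝ) 1) ?_ ?_).trans ?_
  · rw [← ENNReal.ofReal_zero]
    refine ENNReal.tendsto_ofReal (tendsto_inv_atTop_zero.comp ?_)
    exact (tendsto_pow_atTop_atTop_of_one_lt (one_lt_two : (1 : ℝ) < 2)).comp
      (Nat.tendsto_div_const_atTop (by norm_num))
  · refine Eventually.of_forall fun n i => (ediam_cylinder_le (hpos n i)).trans ?_
    refine ENNReal.ofReal_le_ofReal (inv_anti₀ (by positivity) ?_)
    have h1 := two_pow_le_cden (hpos n i)
    rw [(mem_words.1 i.2).2] at h1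
    have h2 : 2 ^ (n / 2) ≤ cden i.1 :=
      (Nat.pow_le_pow_right (by norm_num)
        (Nat.div_le_div_right (Nat.le_mul_of_pos_left n (Nat.pos_of_ne_zero hk0)))).trans h1
    have h3 : (2 : ℝ) ^ (n / 2) ≤ cden i.1 := by exact_mod_cast h2
    have := (hpos n i).one_le_cden_real
    nlinarith
  · refine Eventually.of_forall fun n x hx => ?_
    obtain ⟨u, hu, z, hz, hz1, rfl⟩ := mem_boundedTypeSet_partDens hx (k * n)
    exact Set.mem_iUnion.2 ⟨⟨u, hu⟩, z, ⟨hz, hz1.le⟩, rfl⟩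
  · have hle : ∀ n : ℕ, ∑ i : {u // u ∈ words M (k * n)},
        Metric.ediam (cfEval i.1 '' Set.Icc (0 : ℝ) 1) ^ (d : ℝ) ≤ 1 := by
      intro n
      calc _ ≤ ∑ i : {u // u ∈ words M (k * n)}, ENNReal.ofReal (cfWeight d i.1) := by
            refine Finset.sum_le_sum fun i _ => ?_
            rw [cfWeight_eq_rpow, ← ENNReal.ofReal_rpow_of_nonneg (by positivity) (by positivity)]
            exact ENNReal.rpow_le_rpow (ediam_cylinder_le (hpos n i)) (by positivity)
        _ = ENNReal.ofReal (cfSum M d (k * n)) := by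
            rw [cfSum, ← Finset.sum_coe_sort (words M (k * n)) (cfWeight d),
              ENNReal.ofReal_sum_of_nonneg fun i _ => (cfWeight_pos _ (hpos n i)).le]
        _ ≤ 1 := by
            rw [ENNReal.ofReal_le_one]
            exact (cfSum_mul_le d.coe_nonneg _ _).trans (pow_le_one₀ (cfSum_nonneg _ _ _) hk.le)
    refine (liminf_le_liminf (Eventually.of_forall hle)).trans ?_
    simp

/-- The hypothesis makes g injective with an s-Hölder inverse onto [0, 1). A Hölder map of exponent
s multiplies dimension by at most 1/s, and the image has dimension 1. -/
theorem le_dimH_of_expanding {F : Set ℝ} {s C : ℝ} (hs : 0 < s) (g : ℝ → ℝ)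
    (hg : ∀ r ∈ Set.Ico (0 : ℝ) 1, g r ∈ F)
    (h : ∀ r ∈ Set.Ico (0 : ℝ) 1, ∀ r' ∈ Set.Ico (0 : ℝ) 1, |r - r'| ≤ C * |g r - g r'| ^ s) :
    ENNReal.ofReal s ≤ dimH F := by
  have hinj : Set.InjOn g (Set.Ico 0 1) := by
    intro r hr r' hr' hrr
    have := h r hr r' hr'
    rw [hrr, sub_self, abs_zero, Real.zero_rpow hs.ne', mul_zero] at this
    exact sub_eq_zero.1 (abs_eq_zero.1 (le_antisymm this (abs_nonneg _)))
  set f := Function.invFunOn g (Set.Ico 0 1) with hf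
  have hfg : ∀ r ∈ Set.Ico (0 : ℝ) 1, f (g r) = r := fun r hr =>
    hinj.leftInvOn_invFunOn hr
  have hhol : HolderOnWith C.toNNReal s.toNNReal f (g '' Set.Ico 0 1) := by
    rintro _ ⟨r, hr, rfl⟩ _ ⟨r', hr', rfl⟩
    rw [hfg r hr, hfg r' hr', edist_dist, edist_dist, Real.dist_eq, Real.dist_eq,
      Real.coe_toNNReal s hs.le, ENNReal.ofReal_rpow_of_nonneg (abs_nonneg _) hs.le]
    by_cases hC : 0 ≤ C
    · change _ ≤ ENNReal.ofReal C * _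
      rw [← ENNReal.ofReal_mul hC]
      exact ENNReal.ofReal_le_ofReal (h r hr r' hr')
    · have h1 := h r hr r' hr'
      have h2 : 0 ≤ |g r - g r'| ^ s := by positivity
      have h3 : |r - r'| ≤ 0 := h1.trans (by nlinarith)
      rw [ENNReal.ofReal_eq_zero.2 h3]
      exact zero_le
  have h1 := hhol.dimH_image_le (Real.toNNReal_pos.2 hs)
  have h2 : f '' (g '' Set.Ico 0 1) = Set.Ico (0 : ℝ) 1 := by
    rw [Set.image_image]
    ext r
    constructor
    · rintro ⟨r', hr', rfl⟩
      simpa only [hfg r' hr'] using hr'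
    · intro hr
      exact ⟨r, hr, hfg r hr⟩
  have h3 : dimH (Set.Ico (0 : ℝ) 1) = 1 := by
    rw [Real.dimH_of_nonempty_interior (by simp)]
    simp
  rw [h2, h3] at h1
  have h4 : dimH (g '' Set.Ico 0 1) ≤ dimH F := by
    apply dimH_mono
    rintro _ ⟨r, hr, rfl⟩
    exact hg r hr
  have h5 : (s.toNNReal : ENNReal) ≠ 0 := by
    simpa using hs
  have h6 := (ENNReal.le_div_iff_mul_le (Or.inl h5) (Or.inl ENNReal.coe_ne_top)).1 h1
  rw [one_mul] at h6
  exact h6.trans h4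

/-- The left endpoint of the interval of the word `u` in the subdivision of an interval of length
`m p` into intervals of lengths `m (p u)`. -/
noncomputable def massLeft (m : List ℕ → ℝ) : List ℕ → List ℕ → ℝ
  | _, [] => 0
  | p, c :: u => ∑ d ∈ Finset.Ico 1 c, m (p ++ [d]) + massLeft m (p ++ [c]) u

theorem massLeft_snoc (m : List ℕ → ℝ) (p u : List ℕ) (c : ℕ) :
    massLeft m p (u ++ [c]) = massLeft m p u + ∑ d ∈ Finset.Ico 1 c, m (p ++ u ++ [d]) := by
  induction u generalizing p with
  | nil => simp [massLeft]
  | cons a u ih => simp [massLeft, ih, add_assoc]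

theorem exists_mem_subinterval {M : ℕ} {f : ℕ → ℝ} {a r : ℝ} (h0 : a ≤ r)
    (h1 : r < a + ∑ c ∈ Finset.Icc 1 M, f c) :
    ∃ c, 1 ≤ c ∧ c ≤ M ∧ a + ∑ d ∈ Finset.Ico 1 c, f d ≤ r ∧
      r < a + ∑ d ∈ Finset.Ico 1 c, f d + f c := by
  induction M with
  | zero => simp at h1; linarith
  | succ M ih =>
    by_cases h : r < a + ∑ c ∈ Finset.Icc 1 M, f c
    · obtain ⟨c, hc1, hc2, hc3⟩ := ih h
      exact ⟨c, hc1, by omega, hc3⟩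
    · have h2 : Finset.Ico 1 (M + 1) = Finset.Icc 1 M := by ext; simp
      refine ⟨M + 1, by omega, le_rfl, ?_, ?_⟩
      · rw [h2]; exact not_lt.1 h
      · rw [h2, add_assoc, ← Finset.sum_Icc_succ_top (by omega)]
        exact h1

/-- The word of the first `n` letters of a sequence. -/
def initWord (ω : ℕ → ℕ) (n : ℕ) : List ℕ := (List.range n).map ω

theorem initWord_succ (ω : ℕ → ℕ) (n : ℕ) : initWord ω (n + 1) = initWord ω n ++ [ω n] := by
  simp [initWord, List.range_succ]

theorem isWord_initWord {M : ℕ} {ω : ℕ → ℕ} (hω : ∀ n, 1 ≤ ω n ∧ ω n ≤ M) (n : ℕ) :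
    IsWord M (initWord ω n) := by
  intro c hc
  obtain ⟨k, -, rfl⟩ := List.mem_map.1 hc
  exact hω k

/-- The masses subdivide [0, 1) into nested half-open intervals, one for each word, and r selects
one child at each step. This is the inverse distribution function of the mass. -/
theorem exists_seq_of_mass {M : ℕ} {m : List ℕ → ℝ} (hm1 : m [] = 1)
    (hm2 : ∀ u, IsWord M u → m u = ∑ c ∈ Finset.Icc 1 M, m (u ++ [c])) {r : ℝ}
    (hr : r ∈ Set.Ico (0 : ℝ) 1) :
    ∃ ω : ℕ → ℕ, (∀ n, 1 ≤ ω n ∧ ω n ≤ M) ∧ ∀ n, massLeft m [] (initWord ω n) ≤ r ∧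
      r < massLeft m [] (initWord ω n) + m (initWord ω n) := by
  have step : ∀ u, ∃ c, IsWord M u → massLeft m [] u ≤ r → r < massLeft m [] u + m u →
      (1 ≤ c ∧ c ≤ M) ∧ massLeft m [] (u ++ [c]) ≤ r ∧
        r < massLeft m [] (u ++ [c]) + m (u ++ [c]) := by
    intro u
    by_cases h : IsWord M u ∧ massLeft m [] u ≤ r ∧ r < massLeft m [] u + m u
    · obtain ⟨hu, h1, h2⟩ := h
      rw [hm2 u hu] at h2
      obtain ⟨c, h3, h4, h5, h6⟩ := exists_mem_subinterval h1 h2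
      refine ⟨c, fun _ _ _ => ⟨⟨h3, h4⟩, ?_⟩⟩
      rw [massLeft_snoc]
      simpa using ⟨h5, h6⟩
    · exact ⟨0, fun h1 h2 h3 => absurd ⟨h1, h2, h3⟩ h⟩
  choose f hf using step
  set U : ℕ → List ℕ := fun n => Nat.rec [] (fun _ u => u ++ [f u]) n with hU
  have hU1 : ∀ n, U (n + 1) = U n ++ [f (U n)] := fun n => rfl
  have hUP : ∀ n, IsWord M (U n) ∧ massLeft m [] (U n) ≤ r ∧
      r < massLeft m [] (U n) + m (U n) := by
    intro n
    induction n with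
    | zero => exact ⟨isWord_nil M, by simpa [hU, massLeft] using hr.1,
        by simpa [hU, massLeft, hm1] using hr.2⟩
    | succ n ih =>
      obtain ⟨h1, h2, h3⟩ := hf (U n) ih.1 ih.2.1 ih.2.2
      rw [hU1]
      exact ⟨isWord_append.2 ⟨ih.1, isWord_singleton.2 h1⟩, h2, h3⟩
  have hω : ∀ n, initWord (fun n => f (U n)) n = U n := by
    intro n
    induction n with
    | zero => rfl
    | succ n ih => rw [initWord_succ, ih, hU1]
  refine ⟨fun n => f (U n), fun n => ?_, fun n => ?_⟩
  · exact (hf (U n) (hUP n).1 (hUP n).2.1 (hUP n).2.2).1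
  · rw [hω]
    exact (hUP n).2

theorem continuousOn_cfEval {u : List ℕ} (hu : PosWord u) :
    ContinuousOn (fun y : ℝ => cfEval u y) (Set.Icc 0 1) := by
  unfold cfEval
  exact ContinuousOn.div (by fun_prop) (by fun_prop) fun y hy => (hu.eval_den_pos hy.1).ne'

/-- The infinite continued fraction with the given partial quotients. -/
theorem exists_point_of_seq {M : ℕ} {ω : ℕ → ℕ} (hω : ∀ n, 1 ≤ ω n ∧ ω n ≤ M) :
    ∃ x ∈ boundedTypeSet M, ∀ n, ∃ z : ℝ, 1 / ((M : ℝ) + 1) ≤ z ∧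
      z ≤ 1 - 1 / ((M : ℝ) + 2) ∧ x = cfEval (initWord ω n) z := by
  have hW := fun n => (isWord_initWord hω n).pos
  have hne : (⋂ n, cfEval (initWord ω n) '' Set.Icc (0 : ℝ) 1).Nonempty := by
    have hcomp : ∀ n, IsCompact (cfEval (initWord ω n) '' Set.Icc (0 : ℝ) 1) := fun n =>
      isCompact_Icc.image_of_continuousOn (continuousOn_cfEval (hW n))
    refine IsCompact.nonempty_iInter_of_sequence_nonempty_isCompact_isClosed _ ?_ ?_ (hcomp 0)
      fun n => (hcomp n).isClosed
    · rintro n _ ⟨z, hz, rfl⟩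
      have hp : PosWord [ω n] := (isWord_singleton.2 (hω n)).pos
      rw [initWord_succ, cfEval_append _ hp hz.1]
      exact ⟨_, ⟨cfEval_nonneg _ hz.1, hp.eval_le_one hz.1 hz.2⟩, rfl⟩
    · exact fun n => ⟨_, 0, by simp, rfl⟩
  obtain ⟨x, hx⟩ := hne
  have hx' : ∀ n, ∃ z : ℝ, (0 ≤ z ∧ z ≤ 1) ∧ x = cfEval (initWord ω n) z := by
    intro n
    obtain ⟨z, hz, h⟩ := Set.mem_iInter.1 hx n
    exact ⟨z, hz, h.symm⟩
  choose z hz hxz using hx'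
  have hrec : ∀ n, z n = ((ω n : ℝ) + z (n + 1))⁻¹ := by
    intro n
    have hp : PosWord [ω n] := (isWord_singleton.2 (hω n)).pos
    have h := hxz (n + 1)
    rw [initWord_succ, cfEval_append _ hp (hz _).1, hxz n] at h
    rw [(hW n).eval_injOn (hz n).1 (cfEval_nonneg _ (hz _).1) h, cfEval_singleton]
  have hM : (0 : ℝ) ≤ M := Nat.cast_nonneg M
  have hω' : ∀ n, (1 : ℝ) ≤ ω n ∧ (ω n : ℝ) ≤ M := fun n => by exact_mod_cast hω n
  -- The tails stay away from 0 and 1. This makes the expansion of x unambiguous and later separates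
  -- points with different letters.
  have hlow : ∀ n, 1 / ((M : ℝ) + 1) ≤ z n := by
    intro n
    rw [hrec n, one_div]
    have := hω' n
    have := hz (n + 1)
    exact inv_anti₀ (by linarith) (by linarith)
  have hupp : ∀ n, z n ≤ 1 - 1 / ((M : ℝ) + 2) := by
    intro n
    have h1 := hω' n
    have h2 := hlow (n + 1)
    have h3 : 1 - 1 / ((M : ℝ) + 2) = (1 + 1 / ((M : ℝ) + 1))⁻¹ := by field_simp; ring
    rw [hrec n, h3]
    have : 0 < 1 / ((M : ℝ) + 1) := by positivity
    exact inv_anti₀ (by linarith) (by linarith)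
  have hpos : ∀ n, 0 < z n := fun n => lt_of_lt_of_le (by positivity) (hlow n)
  have hlt : ∀ n, z n < 1 := fun n => by
    have : 0 < 1 / ((M : ℝ) + 2) := by positivity
    linarith [hupp n]
  have hget : ∀ k, (GenContFract.of x).s.get? k = some ⟨1, (ω k : ℝ)⟩ := by
    intro k
    rw [hxz (k + 1)]
    refine (of_cfEval (hW _) (hpos _) (hlt _)).1 k (ω k) ?_
    simp [initWord]
  refine ⟨x, ⟨?_, ?_, ?_⟩, fun n => ⟨z n, hlow n, hupp n, hxz n⟩⟩
  · have h0 : x = z 0 := by have := hxz 0; simpa [initWord] using this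
    rw [h0]
    exact hz 0
  · rintro ⟨r, hr⟩
    obtain ⟨k, hk⟩ := (GenContFract.terminates_iff_rat x).2 ⟨r, hr.symm⟩
    have hk' : (GenContFract.of x).s.get? k = none := hk
    rw [hget] at hk'
    simp at hk'
  · intro n c hc
    rw [GenContFract.partDen_eq_s_b (hget n)] at hc
    simp only [Option.some.injEq] at hc
    rw [← hc]
    exact (hω' n).2

/-- The map sends r to the continued fraction coded by r. If the codes of r and r' share exactly the
word u, then |r - r'| is at most m(u), hence ≪ q(u)^(-2s), while the images are at distance ≫
q(u)⁻², with a constant depending on M. -/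
theorem le_dimH_boundedTypeSet {M : ℕ} (hM : 1 ≤ M) :
    ENNReal.ofReal (critExp M) ≤ dimH (boundedTypeSet M) := by
  rcases (critExp_nonneg M).eq_or_lt with h0 | hs
  · simp [← h0]
  obtain ⟨m, hm1, hm2, hm3⟩ := exists_mass_critExp hM
  set s := critExp M with hsdef
  have hpt : ∀ r, ∃ x, ∃ ω : ℕ → ℕ, r ∈ Set.Ico (0 : ℝ) 1 → x ∈ boundedTypeSet M ∧
      (∀ n, 1 ≤ ω n ∧ ω n ≤ M) ∧ (∀ n, massLeft m [] (initWord ω n) ≤ r ∧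
      r < massLeft m [] (initWord ω n) + m (initWord ω n)) ∧
      ∀ n, ∃ z : ℝ, 1 / ((M : ℝ) + 1) ≤ z ∧ z ≤ 1 - 1 / ((M : ℝ) + 2) ∧
        x = cfEval (initWord ω n) z := by
    intro r
    by_cases hr : r ∈ Set.Ico (0 : ℝ) 1
    · obtain ⟨ω, h1, h2⟩ := exists_seq_of_mass hm1 hm2 hr
      obtain ⟨x, hx, h3⟩ := exists_point_of_seq h1
      exact ⟨x, ω, fun _ => ⟨hx, h1, h2, h3⟩⟩
    · exact ⟨0, 0, fun h => absurd h hr⟩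
  choose g ω hgω using hpt
  set κ : ℝ := 1 / ((M : ℝ) + 2) / ((M : ℝ) + 1) ^ 2 / 4 with hκ
  have hM0 : (0 : ℝ) ≤ M := Nat.cast_nonneg M
  have hκ0 : 0 < κ := by positivity
  refine le_dimH_of_expanding (C := (4 / κ) ^ s) hs g (fun r hr => (hgω r hr).1) ?_
  intro r hr r' hr'
  obtain ⟨-, h1, h2, h3⟩ := hgω r hr
  obtain ⟨-, h1', h2', h3'⟩ := hgω r' hr'
  have hclose : ∀ n, initWord (ω r) n = initWord (ω r') n →
      |r - r'| ≤ 4 ^ s * (((cden (initWord (ω r) n) : ℝ) ^ 2)⁻¹) ^ s := by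
    intro n hn
    rw [← cfWeight_eq_rpow]
    refine le_trans ?_ (hm3 _ (isWord_initWord h1 n)).2
    have a1 := h2 n
    have a2 := h2' n
    rw [← hn] at a2
    rw [abs_le]
    constructor <;> linarith
  by_cases heq : ∀ n, ω r n = ω r' n
  · have hinit : ∀ n, initWord (ω r) n = initWord (ω r') n := fun n => by
      rw [funext heq]
    have hzero : |r - r'| ≤ 0 := by
      have hlim : Tendsto (fun n : ℕ => (4 : ℝ) ^ s * (((2 : ℝ) ^ n)⁻¹) ^ s) atTop (𝓝 0) := by
        have h5 : Tendsto (fun n : ℕ => ((2 : ℝ) ^ n)⁻¹) atTop (𝓝 0) :=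
          tendsto_inv_atTop_zero.comp (tendsto_pow_atTop_atTop_of_one_lt one_lt_two)
        have h6 := (h5.rpow_const (p := s) (Or.inr hs.le)).const_mul ((4 : ℝ) ^ s)
        rwa [Real.zero_rpow hs.ne', mul_zero] at h6
      refine ge_of_tendsto hlim (Eventually.of_forall fun n => (hclose (2 * n) (hinit _)).trans ?_)
      have h7 := two_pow_le_cden (isWord_initWord h1 (2 * n)).pos
      have h8 : (initWord (ω r) (2 * n)).length / 2 = n := by simp [initWord]
      rw [h8] at h7
      have h9 : (2 : ℝ) ^ n ≤ cden (initWord (ω r) (2 * n)) := by exact_mod_cast h7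
      have h10 := (isWord_initWord h1 (2 * n)).pos.one_le_cden_real
      gcongr
      nlinarith
    exact hzero.trans (by positivity)
  · push Not at heq
    classical
    set n := Nat.find heq with hn
    have hne := Nat.find_spec heq
    have hmin : ∀ k < n, ω r k = ω r' k := fun k hk => not_not.1 (Nat.find_min heq hk)
    have hinit : initWord (ω r) n = initWord (ω r') n := by
      refine List.map_congr_left fun k hk => hmin k (List.mem_range.1 hk)
    obtain ⟨z, hz1, hz2, hz⟩ := h3 (n + 1)
    obtain ⟨z', hz1', hz2', hz'⟩ := h3' (n + 1)
    have hzp : 0 < 1 / ((M : ℝ) + 1) := by positivity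
    have hzq : 0 < 1 / ((M : ℝ) + 2) := by positivity
    have hp := (isWord_singleton.2 (h1 n)).pos
    have hp' := (isWord_singleton.2 (h1' n)).pos
    have hc : (1 : ℝ) ≤ ω r n ∧ (ω r n : ℝ) ≤ M := by exact_mod_cast h1 n
    have hc' : (1 : ℝ) ≤ ω r' n ∧ (ω r' n : ℝ) ≤ M := by exact_mod_cast h1' n
    rw [initWord_succ, cfEval_append _ hp (by linarith), cfEval_singleton] at hz
    rw [initWord_succ, cfEval_append _ hp' (by linarith), cfEval_singleton, ← hinit] at hz'
    have hle1 : ∀ a b : ℝ, 1 ≤ a → 0 ≤ b → (a + b)⁻¹ ≤ 1 := fun a b ha hb =>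
      inv_le_one_of_one_le₀ (by linarith)
    have hdist := (isWord_initWord h1 n).pos.le_abs_eval_sub (K := ℝ)
      (y := ((ω r n : ℝ) + z)⁻¹) (z := ((ω r' n : ℝ) + z')⁻¹)
      (inv_nonneg.2 (by linarith)) (hle1 _ _ hc.1 (by linarith))
      (inv_nonneg.2 (by linarith)) (hle1 _ _ hc'.1 (by linarith))
    rw [← hz, ← hz'] at hdist
    have hgap : 1 / ((M : ℝ) + 2) ≤ |((ω r' n : ℝ) + z') - (ω r n + z)| := by
      have h12 : 1 / ((M : ℝ) + 2) ≤ 1 / ((M : ℝ) + 1) := by gcongr; norm_num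
      rcases lt_or_gt_of_ne hne with h | h
      · have : (ω r n : ℝ) + 1 ≤ ω r' n := by exact_mod_cast h
        exact le_trans (by linarith) (le_abs_self _)
      · have : (ω r' n : ℝ) + 1 ≤ ω r n := by exact_mod_cast h
        exact le_trans (by linarith) (neg_le_abs _)
    have hkey : κ * ((cden (initWord (ω r) n) : ℝ) ^ 2)⁻¹ ≤ |g r - g r'| := by
      refine le_trans ?_ hdist
      have hinv : ((ω r n : ℝ) + z)⁻¹ - ((ω r' n : ℝ) + z')⁻¹ =
          (((ω r' n : ℝ) + z') - (ω r n + z)) / ((ω r n + z) * (ω r' n + z')) := by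
        have : (ω r n : ℝ) + z ≠ 0 := by linarith
        have : (ω r' n : ℝ) + z' ≠ 0 := by linarith
        field_simp
      rw [hinv, abs_div, abs_of_pos (mul_pos (by linarith : 0 < (ω r n : ℝ) + z)
        (by linarith : 0 < (ω r' n : ℝ) + z'))]
      have hden : ((ω r n : ℝ) + z) * (ω r' n + z') ≤ ((M : ℝ) + 1) ^ 2 := by
        rw [sq]
        exact mul_le_mul (by linarith) (by linarith) (by linarith) (by linarith)
      have hden0 : 0 < ((ω r n : ℝ) + z) * (ω r' n + z') :=
        mul_pos (by linarith) (by linarith)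
      have hκ' : κ * ((cden (initWord (ω r) n) : ℝ) ^ 2)⁻¹ =
          1 / ((M : ℝ) + 2) / ((M : ℝ) + 1) ^ 2 / (4 * (cden (initWord (ω r) n) : ℝ) ^ 2) := by
        rw [hκ, ← div_eq_mul_inv, div_div _ (4 : ℝ)]
      rw [hκ']
      gcongr
    have h4κ : ((cden (initWord (ω r) n) : ℝ) ^ 2)⁻¹ ≤ |g r - g r'| / κ := by
      rw [le_div_iff₀ hκ0, mul_comm]; exact hkey
    refine (hclose n hinit).trans ?_
    rw [← Real.mul_rpow (by norm_num) (by positivity), ← Real.mul_rpow (by positivity) (by positivity)]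
    refine Real.rpow_le_rpow (by positivity) ?_ hs.le
    calc 4 * ((cden (initWord (ω r) n) : ℝ) ^ 2)⁻¹ ≤ 4 * (|g r - g r'| / κ) := by gcongr
      _ = 4 / κ * |g r - g r'| := by ring

theorem hausdorffDimBounded_eq {M : ℕ} (hM : 1 ≤ M) : hausdorffDimBounded M = critExp M := by
  rw [hausdorffDimBounded, le_antisymm (dimH_boundedTypeSet_le M) (le_dimH_boundedTypeSet hM),
    ENNReal.toReal_ofReal (critExp_nonneg M)]

theorem hausdorffDimBounded_nonneg (M : ℕ) : 0 ≤ hausdorffDimBounded M := ENNReal.toReal_nonneg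

theorem hausdorffDimBounded_mono {M M' : ℕ} (h : M ≤ M') :
    hausdorffDimBounded M ≤ hausdorffDimBounded M' := by
  refine ENNReal.toReal_mono (Real.dimH_ne_top _) (dimH_mono fun x hx => ⟨hx.1, hx.2.1, ?_⟩)
  exact fun n c hc => (hx.2.2 n c hc).trans (by exact_mod_cast h)

theorem hausdorffDimBounded_le_one (M : ℕ) : hausdorffDimBounded M ≤ 1 := by
  have h : dimH (boundedTypeSet M) ≤ 1 := Real.dimH_univ ▸ dimH_mono (Set.subset_univ _)
  simpa [hausdorffDimBounded] using ENNReal.toReal_mono ENNReal.one_ne_top h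

/-- The partition sums for the alphabet `{1, 2}` at `s = 1 / 2` grow exponentially. -/
theorem cfSum_two_half_ge (n : ℕ) :
    ((1005 : ℝ) / 1000) ^ n * (1 / 4) ≤ cfSum 2 (1 / 2) (n + 1) := by
  -- A test function for the transfer operator at s = 1/2: with θ = q'/q in [1/3, 1], the function
  -- 1/(1 + 3θ/4) is multiplied by at least 1.005. The lower bound on θ requires a nonempty word,
  -- hence the length n + 1.
  set A : ℕ → ℝ := fun n => ∑ u ∈ words 2 (n + 1), ((cden u : ℝ) + 3 / 4 * cden' u)⁻¹ with hA
  have hbase : 1 / 4 ≤ A 0 := by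
    simp only [hA]
    rw [sum_words_one, show Finset.Icc 1 2 = {1, 2} by rfl]
    norm_num
  have hthird : ∀ n, ∀ u ∈ words 2 (n + 1), cden u ≤ 3 * cden' u := by
    intro n u hu
    obtain ⟨h1, h2⟩ := mem_words.1 hu
    obtain ⟨v, c, rfl⟩ := List.eq_nil_or_concat'  u |>.resolve_left (by rintro rfl; simp at h2)
    obtain ⟨hv, hc⟩ := isWord_append.1 h1
    have := (isWord_singleton.1 hc).2
    have := cden_snoc_le hv.pos c
    rw [cden'_snoc]
    nlinarith
  have hstep : ∀ n, (1005 : ℝ) / 1000 * A n ≤ A (n + 1) := by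
    intro n
    simp only [hA]
    rw [sum_words_snoc 2 (n + 1), Finset.mul_sum]
    refine Finset.sum_le_sum fun u hu => ?_
    have hp := (mem_words.1 hu).1.pos
    have h1 : (1 : ℝ) ≤ cden u := hp.one_le_cden_real
    have h2 : (cden' u : ℝ) ≤ cden u := by exact_mod_cast hp.cden'_le
    have h3 : (cden u : ℝ) ≤ 3 * cden' u := by exact_mod_cast hthird n u hu
    rw [show Finset.Icc 1 2 = {1, 2} by rfl, Finset.sum_pair (by norm_num)]
    simp only [cden_snoc, cden'_snoc]
    push_cast
    set x : ℝ := (cden u : ℝ)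
    set y : ℝ := (cden' u : ℝ)
    rw [← div_eq_mul_inv, inv_eq_one_div, inv_eq_one_div, div_add_div _ _ (by linarith)
      (by linarith), div_le_div_iff₀ (by linarith) (mul_pos (by linarith) (by linarith))]
    nlinarith [mul_nonneg (sub_nonneg.2 h2) (sub_nonneg.2 h3), mul_nonneg (sub_nonneg.2 h2)
      (sub_nonneg.2 h2), mul_nonneg (sub_nonneg.2 h3) (sub_nonneg.2 h3)]
  have hpow : ∀ n, ((1005 : ℝ) / 1000) ^ n * (1 / 4) ≤ A n := by
    intro n
    induction n with
    | zero => simpa using hbase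
    | succ n ih =>
      rw [pow_succ]
      have := hstep n
      nlinarith
  refine (hpow n).trans (Finset.sum_le_sum fun u hu => ?_)
  have h1 := (mem_words.1 hu).1.pos.one_le_cden_real
  have h2 : (0 : ℝ) ≤ cden' u := Nat.cast_nonneg _
  rw [cfWeight, show -(2 * (1 / 2 : ℝ)) = -1 by norm_num, Real.rpow_neg_one]
  exact inv_anti₀ (by linarith) (by linarith)

/-- Otherwise the partition sums at 1/2 would be bounded by those at the critical exponent, hence by
4, contradicting their exponential growth. -/
theorem half_lt_hausdorffDimBounded_two : 1 / 2 < hausdorffDimBounded 2 := by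
  rw [hausdorffDimBounded_eq (by norm_num)]
  by_contra! h
  obtain ⟨n, hn⟩ := pow_unbounded_of_one_lt (16 : ℝ) (show (1 : ℝ) < 1005 / 1000 by norm_num)
  have h1 := cfSum_two_half_ge n
  have h2 := cfSum_anti 2 (n + 1) h
  have h3 := cfSum_critExp_le 2 (n + 1)
  have h4 : (4 : ℝ) ^ critExp 2 ≤ 4 := by
    calc (4 : ℝ) ^ critExp 2 ≤ 4 ^ (1 : ℝ) :=
          Real.rpow_le_rpow_of_exponent_le (by norm_num) (by linarith)
      _ = 4 := by norm_num
  linarith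

/-- The conformal mass on the tree of words over `{1, …, M}`. -/
theorem exists_mass {M : ℕ} (hM : 1 ≤ M) :
    ∃ m : List ℕ → ℝ, m [] = 1 ∧
      (∀ u, IsWord M u → m u = ∑ c ∈ Finset.Icc 1 M, m (u ++ [c])) ∧
      ∀ u, IsWord M u → cfWeight (hausdorffDimBounded M) u / 16 ≤ m u ∧
        m u ≤ 4 * cfWeight (hausdorffDimBounded M) u := by
  obtain ⟨m, h1, h2, h3⟩ := exists_mass_critExp hM
  rw [← hausdorffDimBounded_eq hM] at h3
  have hw := hausdorffDimBounded_le_one M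
  refine ⟨m, h1, h2, fun u hu => ?_⟩
  have hpos := (cfWeight_pos (hausdorffDimBounded M) hu.pos).le
  constructor
  · refine le_trans ?_ (h3 u hu).1
    rw [div_eq_inv_mul]
    gcongr
    calc (16 : ℝ)⁻¹ = 4 ^ (-2 : ℝ) := by norm_num
      _ ≤ _ := Real.rpow_le_rpow_of_exponent_le (by norm_num) (by linarith)
  · refine (h3 u hu).2.trans ?_
    gcongr
    calc (4 : ℝ) ^ hausdorffDimBounded M ≤ 4 ^ (1 : ℝ) :=
          Real.rpow_le_rpow_of_exponent_le (by norm_num) hw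
      _ = 4 := by norm_num

end

section

/-! ### Conformal masses, stopping words and intervals -/

open MeasureTheory

/-- An additive function on the tree of words over `{1, …, M}` which is comparable to
`q(u)^{-2w}`, where `w` is the dimension of the limit set. -/
structure ConformalMass (M : ℕ) (m : List ℕ → ℝ) : Prop where
  nil : m [] = 1
  add : ∀ u, IsWord M u → m u = ∑ c ∈ Finset.Icc 1 M, m (u ++ [c])
  ge : ∀ u, IsWord M u → cfWeight (hausdorffDimBounded M) u / 16 ≤ m u
  le : ∀ u, IsWord M u → m u ≤ 4 * cfWeight (hausdorffDimBounded M) u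

theorem exists_conformalMass {M : ℕ} (hM : 1 ≤ M) : ∃ m, ConformalMass M m := by
  obtain ⟨m, h1, h2, h3⟩ := exists_mass hM
  exact ⟨m, h1, h2, fun u hu => (h3 u hu).1, fun u hu => (h3 u hu).2⟩

/-- No word of the family is a proper prefix of another one. -/
def IsIncomparable (S : Finset (List ℕ)) : Prop := ∀ u ∈ S, ∀ v ∈ S, u <+: v → u = v

theorem IsIncomparable.mono {S S' : Finset (List ℕ)} (h : IsIncomparable S) (hS : S' ⊆ S) :
    IsIncomparable S' := fun u hu v hv => h u (hS hu) v (hS hv)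

/-- The denominator of `u` is at least `T`, and `u` is minimal with this property. -/
def IsStop (T : ℝ) (u : List ℕ) : Prop := T ≤ cden u ∧ (u ≠ [] → (cden u.dropLast : ℝ) < T)

theorem exists_stop_prefix {T : ℝ} (u : List ℕ) (h : T ≤ cden u) :
    ∃ v, v <+: u ∧ IsStop T v := by
  induction u using List.reverseRecOn with
  | nil => exact ⟨[], List.prefix_rfl, h, by simp⟩
  | append_singleton u c ih =>
    by_cases hu : T ≤ cden u
    · obtain ⟨v, hv, hs⟩ := ih hu
      exact ⟨v, hv.trans (List.prefix_append _ _), hs⟩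
    · exact ⟨u ++ [c], List.prefix_rfl, h, by simpa using hu⟩

theorem IsStop.eq_of_prefix {T : ℝ} {u v : List ℕ} (hu : IsStop T u) (hv : IsStop T v)
    (hp : PosWord v) (h : u <+: v) : u = v := by
  by_contra hne
  obtain ⟨z, rfl⟩ := h
  have hz : z ≠ [] := by rintro rfl; simp at hne
  have h1 : u <+: (u ++ z).dropLast := by
    rw [List.dropLast_append_of_ne_nil hz]
    exact List.prefix_append _ _
  have h2 := hv.2 (by simp [hz])
  have h3 := cden_le_of_prefix (hp.of_prefix (List.dropLast_prefix _)) h1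
  have h4 : (cden u : ℝ) ≤ cden (u ++ z).dropLast := by exact_mod_cast h3
  linarith [hu.1]

theorem IsStop.cden_le {M : ℕ} {T : ℝ} (hT : 1 ≤ T) {u : List ℕ} (hu : IsStop T u)
    (hw : IsWord M u) : (cden u : ℝ) ≤ (M + 1) * T := by
  rcases List.eq_nil_or_concat' u with rfl | ⟨v, c, rfl⟩
  · simp
    nlinarith [Nat.cast_nonneg (α := ℝ) M]
  · have h1 := hu.2 (by simp)
    rw [List.dropLast_concat] at h1
    obtain ⟨hv, hc⟩ := isWord_append.1 hw
    have h2 := cden_snoc_le hv.pos c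
    have h3 : (cden (v ++ [c]) : ℝ) ≤ (c + 1) * cden v := by exact_mod_cast h2
    have h4 : (c : ℝ) ≤ M := by exact_mod_cast (isWord_singleton.1 hc).2
    refine h3.trans ?_
    exact mul_le_mul (by linarith) h1.le (Nat.cast_nonneg _) (by positivity)

namespace ConformalMass

variable {M : ℕ} {m : List ℕ → ℝ}

theorem pos (hm : ConformalMass M m) {u : List ℕ} (hu : IsWord M u) : 0 < m u :=
  lt_of_lt_of_le (div_pos (cfWeight_pos _ hu.pos) (by norm_num)) (hm.ge u hu)

theorem le_of_le_cden (hm : ConformalMass M m) {u : List ℕ} (hu : IsWord M u) {T : ℝ} (hT : 0 < T) (h : T ≤ cden u) :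
    m u ≤ 4 * T ^ (-(2 * hausdorffDimBounded M)) := by
  refine (hm.le u hu).trans (mul_le_mul_of_nonneg_left ?_ (by norm_num))
  exact Real.rpow_le_rpow_of_nonpos hT h (by linarith [hausdorffDimBounded_nonneg M])

theorem ge_of_cden_le (hm : ConformalMass M m) {u : List ℕ} (hu : IsWord M u) {T : ℝ} (h : cden u ≤ T) :
    T ^ (-(2 * hausdorffDimBounded M)) / 16 ≤ m u := by
  refine le_trans (div_le_div_of_nonneg_right ?_ (by norm_num)) (hm.ge u hu)
  exact Real.rpow_le_rpow_of_nonpos (by linarith [hu.pos.one_le_cden_real]) h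
    (by linarith [hausdorffDimBounded_nonneg M])

theorem eq_sum_append (hm : ConformalMass M m) {u : List ℕ} (hu : IsWord M u) (k : ℕ) :
    m u = ∑ z ∈ words M k, m (u ++ z) := by
  induction k with
  | zero => simp [words]
  | succ k ih =>
    rw [ih, sum_words_snoc]
    refine Finset.sum_congr rfl fun z hz => ?_
    rw [hm.add _ (isWord_append.2 ⟨hu, (mem_words.1 hz).1⟩)]
    simp

theorem eq_sum_filter (hm : ConformalMass M m) {u : List ℕ} (hu : IsWord M u) {n : ℕ} (hn : u.length ≤ n) :
    m u = ∑ y ∈ words M n with u <+: y, m y := by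
  rw [hm.eq_sum_append hu (n - u.length)]
  refine Finset.sum_nbij (fun z => u ++ z) ?_ ?_ ?_ ?_
  · intro z hz
    obtain ⟨h1, h2⟩ := mem_words.1 hz
    simp only [Finset.mem_filter, mem_words]
    exact ⟨⟨isWord_append.2 ⟨hu, h1⟩, by simp [h2]; omega⟩, List.prefix_append _ _⟩
  · intro a _ b _ h
    simpa using h
  · rintro _ hy
    simp only [Finset.coe_filter, Set.mem_ofPred_eq, mem_words] at hy
    obtain ⟨⟨h1, h2⟩, z, rfl⟩ := hy
    refine ⟨z, mem_words.2 ⟨(isWord_append.1 h1).2, ?_⟩, rfl⟩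
    simp at h2
    omega
  · intros; rfl

/-- All words are extended to a common length n; extensions of incomparable words form disjoint
families. -/
theorem sum_incomparable (hm : ConformalMass M m) {S : Finset (List ℕ)} (hS : IsIncomparable S)
    (hw : ∀ u ∈ S, IsWord M u) {n : ℕ} (hn : ∀ u ∈ S, u.length ≤ n) :
    ∑ u ∈ S, m u = ∑ y ∈ S.biUnion fun u => {y ∈ words M n | u <+: y}, m y := by
  rw [Finset.sum_biUnion]
  · exact Finset.sum_congr rfl fun u hu => hm.eq_sum_filter (hw u hu) (hn u hu)
  · intro u hu v hv huv
    rw [Function.onFun, Finset.disjoint_left]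
    intro y hy hy'
    simp only [Finset.mem_filter] at hy hy'
    rcases List.prefix_or_prefix_of_prefix hy.2 hy'.2 with h | h
    · exact huv (hS u hu v hv h)
    · exact huv (hS v hv u hu h).symm

theorem sum_le (hm : ConformalMass M m) {S : Finset (List ℕ)} (hS : IsIncomparable S) (hw : ∀ u ∈ S, IsWord M u)
    {v : List ℕ} (hv : IsWord M v) (hvS : ∀ u ∈ S, v <+: u) : ∑ u ∈ S, m u ≤ m v := by
  have hn : ∀ u ∈ S, u.length ≤ S.sup List.length + v.length := fun u hu =>
    (Finset.le_sup (f := List.length) hu).trans (Nat.le_add_right _ _)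
  rw [hm.sum_incomparable hS hw hn,
    hm.eq_sum_filter hv (Nat.le_add_left v.length (S.sup List.length))]
  refine Finset.sum_le_sum_of_subset_of_nonneg ?_ fun y hy _ =>
    (hm.pos (mem_words.1 (Finset.mem_filter.1 hy).1).1).le
  intro y hy
  simp only [Finset.mem_biUnion, Finset.mem_filter] at hy ⊢
  obtain ⟨u, hu, hy, huy⟩ := hy
  exact ⟨hy, (hvS u hu).trans huy⟩

end ConformalMass

/-- The open interval between the endpoints of a cylinder is covered by the open cylinder. -/
theorem uIoo_subset_image {u : List ℕ} (hu : PosWord u) :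
    Set.uIoo (cfEval u (0 : ℝ)) (cfEval u 1) ⊆ cfEval u '' Set.Ioo (0 : ℝ) 1 := by
  intro x hx
  rcases le_total (cfEval u (0 : ℝ)) (cfEval u 1) with h | h
  · rw [Set.uIoo_of_le h] at hx
    exact intermediate_value_Ioo zero_le_one (continuousOn_cfEval hu) hx
  · rw [Set.uIoo_of_ge h] at hx
    exact intermediate_value_Ioo' zero_le_one (continuousOn_cfEval hu) hx

theorem le_abs_eval_one_sub {u : List ℕ} (hu : PosWord u) :
    1 / (2 * (cden u : ℝ) ^ 2) ≤ |cfEval u (1 : ℝ) - cfEval u 0| := by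
  rw [hu.abs_eval_sub zero_le_one le_rfl]
  have h1 := hu.one_le_cden_real
  have h2 : (cden' u : ℝ) ≤ cden u := by exact_mod_cast hu.cden'_le
  simp only [sub_zero, abs_one, mul_one, mul_zero, add_zero]
  apply one_div_le_one_div_of_le (by positivity)
  nlinarith

/-- A packing argument: the open cylinders are disjoint, have length at least 1/(2R²), and lie in
the interval enlarged by 1/T² on each side. -/
theorem card_le_of_meets {V : Finset (List ℕ)} (hV : IsIncomparable V) (hp : ∀ v ∈ V, PosWord v)
    {T R α β : ℝ} (hT : 0 < T) (hαβ : α ≤ β) (hTR : ∀ v ∈ V, T ≤ cden v ∧ cden v ≤ R)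
    (hmeet : ∀ v ∈ V, ∃ y ∈ Set.Icc (0 : ℝ) 1, cfEval v y ∈ Set.Icc α β) :
    (V.card : ℝ) ≤ (β - α + 2 / T ^ 2) * (2 * R ^ 2) := by
  classical
  rcases V.eq_empty_or_nonempty with rfl | ⟨v₀, hv₀⟩
  · simp
    have : 0 < 2 / T ^ 2 := by positivity
    nlinarith [sq_nonneg R]
  have hR : 0 < R := hT.trans_le ((hTR v₀ hv₀).1.trans (hTR v₀ hv₀).2)
  set I : List ℕ → Set ℝ := fun v => Set.uIoo (cfEval v (0 : ℝ)) (cfEval v 1) with hI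
  have hvol : ∀ v ∈ V, ENNReal.ofReal (1 / (2 * R ^ 2)) ≤ volume (I v) := by
    intro v hv
    change _ ≤ volume (Set.Ioo _ _)
    rw [Real.volume_Ioo, max_sub_min_eq_abs]
    refine ENNReal.ofReal_le_ofReal (le_trans ?_ (le_abs_eval_one_sub (hp v hv)))
    have h1 := (hp v hv).one_le_cden_real
    have h2 := (hTR v hv).2
    gcongr
  have hdisj : (V : Set (List ℕ)).PairwiseDisjoint I := by
    intro u hu v hv huv
    rw [Function.onFun, Set.disjoint_left]
    intro x hx hx'
    obtain ⟨y, hy, rfl⟩ := uIoo_subset_image (hp u hu) hx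
    obtain ⟨z, hz, h⟩ := uIoo_subset_image (hp v hv) hx'
    rcases prefix_or_prefix_of_eval_eq (hp u hu) (hp v hv) hy.1 hy.2 hz.1 hz.2 h.symm with h | h
    · exact huv (hV u hu v hv h)
    · exact huv (hV v hv u hu h).symm
  have hsub : ⋃ v ∈ V, I v ⊆ Set.Icc (α - 1 / T ^ 2) (β + 1 / T ^ 2) := by
    intro x hx
    simp only [Set.mem_iUnion] at hx
    obtain ⟨v, hv, hx⟩ := hx
    obtain ⟨z, hz, rfl⟩ := uIoo_subset_image (hp v hv) hx
    obtain ⟨y, hy, hyI⟩ := hmeet v hv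
    have h1 := (hp v hv).abs_eval_sub_le hz.1.le hy.1
    have h2 : |z - y| ≤ 1 := by
      rw [abs_le]; constructor <;> linarith [hz.1, hz.2, hy.1, hy.2]
    have h3 : |z - y| / (cden v : ℝ) ^ 2 ≤ 1 / T ^ 2 := by
      have := (hTR v hv).1
      gcongr
    have h4 := abs_le.1 (h1.trans h3)
    constructor <;> linarith [hyI.1, hyI.2, h4.1, h4.2]
  have hmeas := measure_mono (μ := volume) hsub
  rw [measure_biUnion_finset hdisj fun v _ => measurableSet_Ioo, Real.volume_Icc] at hmeas
  have h5 : (V.card : ENNReal) * ENNReal.ofReal (1 / (2 * R ^ 2)) ≤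
      ENNReal.ofReal (β + 1 / T ^ 2 - (α - 1 / T ^ 2)) := by
    refine le_trans ?_ hmeas
    rw [← nsmul_eq_mul]
    exact Finset.card_nsmul_le_sum _ _ _ hvol
  rw [← ENNReal.ofReal_natCast, ← ENNReal.ofReal_mul (Nat.cast_nonneg _)] at h5
  have h6 : 0 ≤ β + 1 / T ^ 2 - (α - 1 / T ^ 2) := by
    have : 0 < 1 / T ^ 2 := by positivity
    linarith
  have h7 := (ENNReal.ofReal_le_ofReal_iff h6).1 h5
  rw [mul_one_div, div_le_iff₀ (by positivity)] at h7
  refine h7.trans (le_of_eq ?_)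
  ring

/-- The total mass of incomparable words whose cylinders meet an interval of length `T⁻²`. -/
theorem ConformalMass.sum_le_of_meets {M : ℕ} {m : List ℕ → ℝ} (hm : ConformalMass M m)
    {S : Finset (List ℕ)} (hS : IsIncomparable S) (hw : ∀ u ∈ S, IsWord M u) {T α β : ℝ}
    (hT : 1 ≤ T) (hαβ : α ≤ β) (hlen : β - α ≤ 1 / T ^ 2) (hTS : ∀ u ∈ S, T ≤ cden u)
    (hmeet : ∀ u ∈ S, ∃ y ∈ Set.Icc (0 : ℝ) 1, cfEval u y ∈ Set.Icc α β) :
    ∑ u ∈ S, m u ≤ 24 * (M + 1) ^ 2 * T ^ (-(2 * hausdorffDimBounded M)) := by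
  classical
  -- Each word is replaced by its prefix stopped at level T. These prefixes have denominators
  -- between T and (M + 1) T, so packing leaves at most 6 (M + 1)² of them, each of mass at most 4
  -- T^(-2w).
  have hpre : ∀ u, ∃ v, u ∈ S → v <+: u ∧ IsStop T v := by
    intro u
    by_cases hu : u ∈ S
    · obtain ⟨v, h⟩ := exists_stop_prefix u (hTS u hu)
      exact ⟨v, fun _ => h⟩
    · exact ⟨[], fun h => absurd h hu⟩
  choose p hp using hpre
  have hVw : ∀ v ∈ S.image p, IsWord M v ∧ IsStop T v := by
    intro v hv
    obtain ⟨u, hu, rfl⟩ := Finset.mem_image.1 hv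
    exact ⟨(hw u hu).of_prefix (hp u hu).1, (hp u hu).2⟩
  have hVi : IsIncomparable (S.image p) := fun u hu v hv h =>
    (hVw u hu).2.eq_of_prefix (hVw v hv).2 (hVw v hv).1.pos h
  have hcard := card_le_of_meets hVi (fun v hv => (hVw v hv).1.pos) (T := T) (R := (M + 1) * T)
    (by linarith) hαβ (fun v hv => ⟨(hVw v hv).2.1, (hVw v hv).2.cden_le hT (hVw v hv).1⟩) (by
      intro v hv
      obtain ⟨u, hu, rfl⟩ := Finset.mem_image.1 hv
      obtain ⟨y, hy, hyI⟩ := hmeet u hu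
      obtain ⟨z, hz⟩ := (hp u hu).1
      have hzp : PosWord z := (posWord_append.1 (hz ▸ (hw u hu).pos)).2
      rw [← hz, cfEval_append _ hzp hy.1] at hyI
      exact ⟨_, ⟨cfEval_nonneg z hy.1, hzp.eval_le_one hy.1 hy.2⟩, hyI⟩)
  have hT0 : 0 < T := by linarith
  have hcard' : ((S.image p).card : ℝ) ≤ 6 * ((M : ℝ) + 1) ^ 2 := by
    refine hcard.trans ?_
    calc (β - α + 2 / T ^ 2) * (2 * (((M : ℝ) + 1) * T) ^ 2)
        ≤ (1 / T ^ 2 + 2 / T ^ 2) * (2 * (((M : ℝ) + 1) * T) ^ 2) := by gcongr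
      _ = 6 * ((M : ℝ) + 1) ^ 2 := by field_simp; ring
  calc ∑ u ∈ S, m u = ∑ v ∈ S.image p, ∑ u ∈ S with p u = v, m u :=
        (Finset.sum_fiberwise_of_maps_to (fun u hu => Finset.mem_image_of_mem p hu) _).symm
    _ ≤ ∑ v ∈ S.image p, m v := by
        refine Finset.sum_le_sum fun v hv => ?_
        refine hm.sum_le (hS.mono (Finset.filter_subset _ _))
          (fun u hu => hw u (Finset.filter_subset _ _ hu)) (hVw v hv).1 fun u hu => ?_
        obtain ⟨hu', rfl⟩ := Finset.mem_filter.1 hu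
        exact (hp u hu').1
    _ ≤ ∑ _v ∈ S.image p, 4 * T ^ (-(2 * hausdorffDimBounded M)) :=
        Finset.sum_le_sum fun v hv => hm.le_of_le_cden (hVw v hv).1 hT0 (hVw v hv).2.1
    _ = (S.image p).card * (4 * T ^ (-(2 * hausdorffDimBounded M))) := by
        rw [Finset.sum_const, nsmul_eq_mul]
    _ ≤ 6 * ((M : ℝ) + 1) ^ 2 * (4 * T ^ (-(2 * hausdorffDimBounded M))) := by gcongr
    _ = _ := by ring

/-- The words over `{1, 2}` whose denominator is the first to reach `2 ^ n`. -/
noncomputable def stopWords (n : ℕ) : Finset (List ℕ) := by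
  classical
  exact ((Finset.range (2 * n + 1)).biUnion (words 2)).filter fun u => IsStop ((2 : ℝ) ^ n) u

theorem mem_stopWords {n : ℕ} {u : List ℕ} :
    u ∈ stopWords n ↔ IsWord 2 u ∧ u.length ≤ 2 * n ∧ IsStop ((2 : ℝ) ^ n) u := by
  classical
  simp only [stopWords, Finset.mem_filter, Finset.mem_biUnion, Finset.mem_range, mem_words]
  constructor
  · rintro ⟨⟨k, hk, hu, rfl⟩, hs⟩
    exact ⟨hu, by omega, hs⟩
  · rintro ⟨hu, hl, hs⟩
    exact ⟨⟨_, by omega, hu, rfl⟩, hs⟩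

theorem isIncomparable_stopWords (n : ℕ) : IsIncomparable (stopWords n) := fun _ hu _ hv h =>
  (mem_stopWords.1 hu).2.2.eq_of_prefix (mem_stopWords.1 hv).2.2 (mem_stopWords.1 hv).1.pos h

theorem cden_le_of_mem_stopWords {n : ℕ} {u : List ℕ} (hu : u ∈ stopWords n) :
    (cden u : ℝ) ≤ 3 * 2 ^ n := by
  obtain ⟨h1, -, h2⟩ := mem_stopWords.1 hu
  have := h2.cden_le (one_le_pow₀ (by norm_num)) h1
  norm_num at this
  exact this

theorem ConformalMass.sum_stopWords {m : List ℕ → ℝ} (hm : ConformalMass 2 m) (n : ℕ) :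
    ∑ u ∈ stopWords n, m u = 1 := by
  classical
  rw [hm.sum_incomparable (isIncomparable_stopWords n) (fun u hu => (mem_stopWords.1 hu).1)
    (fun u hu => (mem_stopWords.1 hu).2.1), ← hm.nil, hm.eq_sum_append (isWord_nil 2) (2 * n)]
  refine Finset.sum_congr ?_ fun _ _ => rfl
  ext y
  simp only [Finset.mem_biUnion, Finset.mem_filter]
  constructor
  · rintro ⟨u, -, hy, -⟩
    exact hy
  · intro hy
    obtain ⟨hw, hl⟩ := mem_words.1 hy
    have h1 := two_pow_le_cden hw.pos
    rw [hl, Nat.mul_div_cancel_left _ (by norm_num)] at h1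
    obtain ⟨u, hu, hs⟩ := exists_stop_prefix (T := (2 : ℝ) ^ n) y (by exact_mod_cast h1)
    exact ⟨u, mem_stopWords.2 ⟨hw.of_prefix hu, hl ▸ hu.length_le, hs⟩, hy, hu⟩

end

section

/-! ### A bilinear equidistribution criterion -/

open Complex

/-- Orthogonality of the characters modulo P: the residues of l B j are distinct, so only the
diagonal survives, and the sum of b j² is at most ε. -/
theorem sum_normSq_expSum {κ : Type*} {J : Finset κ} {b : κ → ℝ} (hb0 : ∀ j ∈ J, 0 ≤ b j)
    (hb1 : ∑ j ∈ J, b j = 1) {B : κ → ℤ} {P : ℕ} {ζ : ℂ} (hζ : IsPrimitiveRoot ζ P)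
    {ε : ℝ} (hbε : ∀ j ∈ J, b j ≤ ε) {l : ℤ}
    (hB : ∀ j ∈ J, ∀ j' ∈ J, j ≠ j' → ¬ (P : ℤ) ∣ l * (B j - B j')) (hP : 0 < P) :
    ∑ r ∈ Finset.range P, ‖∑ j ∈ J, (b j : ℂ) * ζ ^ (l * (r : ℤ) * B j)‖ ^ 2 ≤ P * ε := by
  classical
  have hζ0 : ζ ≠ 0 := hζ.ne_zero hP.ne'
  have hnorm : ‖ζ‖ = 1 := hζ.norm'_eq_one hP.ne'
  have hconj : ∀ n : ℤ, (starRingEnd ℂ) (ζ ^ n) = ζ ^ (-n) := by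
    intro n
    rw [map_zpow₀, zpow_neg, ← inv_zpow]
    congr 1
    rw [Complex.inv_def, Complex.normSq_eq_norm_sq, hnorm]
    simp
  have hexp : ∀ r : ℕ, ((‖∑ j ∈ J, (b j : ℂ) * ζ ^ (l * (r : ℤ) * B j)‖ ^ 2 : ℝ) : ℂ) =
      ∑ j ∈ J, ∑ j' ∈ J, (b j : ℂ) * b j' * (ζ ^ (l * (B j - B j'))) ^ r := by
    intro r
    rw [← Complex.normSq_eq_norm_sq, ← Complex.mul_conj, map_sum, Finset.sum_mul_sum]
    refine Finset.sum_congr rfl fun j _ => Finset.sum_congr rfl fun j' _ => ?_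
    rw [map_mul, Complex.conj_ofReal, hconj, ← zpow_natCast (ζ ^ _), ← zpow_mul,
      mul_mul_mul_comm, ← zpow_add₀ hζ0]
    congr 2
    ring
  have hsum : ((∑ r ∈ Finset.range P, ‖∑ j ∈ J, (b j : ℂ) * ζ ^ (l * (r : ℤ) * B j)‖ ^ 2 : ℝ) : ℂ)
      = ((P * ∑ j ∈ J, b j ^ 2 : ℝ) : ℂ) := by
    rw [Complex.ofReal_sum, Finset.sum_congr rfl fun r _ => hexp r]
    push_cast
    rw [Finset.sum_comm, Finset.mul_sum]
    refine Finset.sum_congr rfl fun j hj => ?_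
    rw [Finset.sum_comm, Finset.sum_eq_single j]
    · simp only [sub_self, mul_zero, zpow_zero, one_pow, mul_one, Finset.sum_const,
        Finset.card_range, nsmul_eq_mul]
      ring
    · intro j' hj' hne
      rw [← Finset.mul_sum]
      have hx1 : ζ ^ (l * (B j - B j')) ≠ 1 := by
        rw [Ne, hζ.zpow_eq_one_iff_dvd]
        exact hB j hj j' hj' hne.symm
      have hxP : (ζ ^ (l * (B j - B j'))) ^ P = 1 := by
        rw [← zpow_natCast, ← zpow_mul, mul_comm, zpow_mul, zpow_natCast, hζ.pow_eq_one, one_zpow]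
      rw [geom_sum_eq hx1, hxP]
      simp
    · intro h; exact absurd hj h
  have hsum' := Complex.ofReal_injective hsum
  rw [hsum']
  refine mul_le_mul_of_nonneg_left ?_ (Nat.cast_nonneg P)
  calc ∑ j ∈ J, b j ^ 2 ≤ ∑ j ∈ J, ε * b j := Finset.sum_le_sum fun j hj => by
        nlinarith [hb0 j hj, hbε j hj]
    _ = ε := by rw [← Finset.mul_sum, hb1, mul_one]

theorem norm_geom_sum_sq_le {x : ℂ} (hx : ‖x‖ = 1) {δ : ℝ} (hδ : 0 < δ) (h : δ ≤ ‖x - 1‖) (K : ℕ) :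
    ‖∑ n ∈ Finset.range K, x ^ n‖ ^ 2 ≤ 4 / δ ^ 2 := by
  have hx1 : x ≠ 1 := by rintro rfl; simp at h; linarith
  rw [geom_sum_eq hx1, norm_div, div_pow]
  have h1 : ‖x ^ K - 1‖ ≤ 2 := by
    refine (norm_sub_le _ _).trans ?_
    rw [norm_pow, hx]
    norm_num
  have h2 : ‖x ^ K - 1‖ ^ 2 ≤ 4 := by nlinarith [norm_nonneg (x ^ K - 1)]
  gcongr

/-- If the collisions of the integers `N g` modulo `P` and the weights `b j` are small, then one of
the products `z g * ζ ^ (N g * B j)` is close to `1`. -/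
theorem exists_phase_near_one {ι κ : Type*} {G : Finset ι} {J : Finset κ} {a : ι → ℝ} {b : κ → ℝ}
    (ha0 : ∀ g ∈ G, 0 ≤ a g) (ha1 : ∑ g ∈ G, a g = 1)
    (hb0 : ∀ j ∈ J, 0 ≤ b j) (hb1 : ∑ j ∈ J, b j = 1) {N : ι → ℤ} {B : κ → ℤ} {P : ℕ} (hP : 0 < P)
    {ζ : ℂ} (hζ : IsPrimitiveRoot ζ P) {z : ι → ℂ} (hz : ∀ g, ‖z g‖ = 1) {K : ℕ} {δ ε₁ ε₂ : ℝ}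
    (hδ : 0 < δ) (hK : 8 / δ ^ 2 ≤ K)
    (hcoll : ∑ g ∈ G, ∑ g' ∈ G with N g % P = N g' % P, a g * a g' ≤ ε₁)
    (hbε : ∀ j ∈ J, b j ≤ ε₂)
    (hB : ∀ j ∈ J, ∀ j' ∈ J, j ≠ j' → B j ≠ B j' ∧ K * |B j - B j'| < P)
    (hsmall : P * (ε₁ * ε₂) < 1 / (2 * K) ^ 2) :
    ∃ g ∈ G, ∃ j ∈ J, ‖z g * ζ ^ (N g * B j) - 1‖ < δ := by
  classical
  have hζ0 : ζ ≠ 0 := hζ.ne_zero hP.ne'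
  have hnorm : ‖ζ‖ = 1 := hζ.norm'_eq_one hP.ne'
  have hK0 : (0 : ℝ) < K := lt_of_lt_of_le (by positivity) hK
  by_contra! hcon
  set x : ι → κ → ℂ := fun g j => z g * ζ ^ (N g * B j) with hx
  have hxn : ∀ g j, ‖x g j‖ = 1 := fun g j => by simp [hx, hz, hnorm]
  have hx0 : ∀ g j, x g j ≠ 0 := fun g j => by
    rw [← norm_pos_iff, hxn]; exact one_pos
  -- If every product is at distance at least δ from 1, each geometric sum of length K is bounded
  -- independently of K, so the weighted mean square is at most K/2. Expanding the square shows
  -- below that it exceeds K/2.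
  have hupper : ∑ g ∈ G, ∑ j ∈ J, a g * b j * ‖∑ n ∈ Finset.range K, x g j ^ n‖ ^ 2 ≤ K / 2 := by
    calc _ ≤ ∑ g ∈ G, ∑ j ∈ J, a g * b j * (K / 2 : ℝ) := by
          refine Finset.sum_le_sum fun g hg => Finset.sum_le_sum fun j hj => ?_
          refine mul_le_mul_of_nonneg_left ?_ (mul_nonneg (ha0 g hg) (hb0 j hj))
          refine (norm_geom_sum_sq_le (hxn g j) hδ (hcon g hg j hj) K).trans ?_
          have : 4 / δ ^ 2 = (8 / δ ^ 2) / 2 := by ring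
          linarith
      _ = K / 2 := by
          simp only [← Finset.sum_mul, ← Finset.mul_sum, hb1, mul_one, ha1, one_mul]
  -- The l-th moment is small: grouping the g by the residue of N g modulo P, Cauchy–Schwarz
  -- separates the collision energy from the character sum over j.
  have hT : ∀ l : ℤ, l ≠ 0 → |l| < K →
      ‖∑ g ∈ G, ∑ j ∈ J, ((a g * b j : ℝ) : ℂ) * x g j ^ l‖ ^ 2 ≤ P * (ε₁ * ε₂) := by
    intro l hl hlK
    set F : ℤ → ℝ := fun n => ‖∑ j ∈ J, (b j : ℂ) * ζ ^ (l * n * B j)‖ with hF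
    set ρ : ι → ℕ := fun g => (N g % P).toNat with hρ
    have hPz : (P : ℤ) ≠ 0 := by exact_mod_cast hP.ne'
    have hρcast : ∀ g, (ρ g : ℤ) = N g % P := fun g =>
      Int.toNat_of_nonneg (Int.emod_nonneg _ hPz)
    have hρlt : ∀ g ∈ G, ρ g ∈ Finset.range P := fun g _ => by
      rw [Finset.mem_range]
      have := Int.emod_lt_of_pos (N g) (show (0 : ℤ) < P by exact_mod_cast hP)
      rw [← hρcast] at this
      exact_mod_cast this
    have hFρ : ∀ g, F (N g) = F (ρ g) := by
      intro g
      simp only [hF]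
      congr 1
      refine Finset.sum_congr rfl fun j _ => ?_
      congr 1
      have h1 : l * N g * B j = l * (ρ g : ℤ) * B j + (P : ℤ) * (l * (N g / P) * B j) := by
        rw [hρcast]
        have := Int.emod_add_mul_ediv (N g) P
        linear_combination (- l * B j) * this
      rw [h1, zpow_add₀ hζ0, zpow_mul ζ (P : ℤ), zpow_natCast, hζ.pow_eq_one, one_zpow, mul_one]
    have h1 : ‖∑ g ∈ G, ∑ j ∈ J, ((a g * b j : ℝ) : ℂ) * x g j ^ l‖ ≤ ∑ g ∈ G, a g * F (N g) := by
      refine (norm_sum_le _ _).trans (Finset.sum_le_sum fun g hg => le_of_eq ?_)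
      have h2 : ∑ j ∈ J, ((a g * b j : ℝ) : ℂ) * x g j ^ l =
          ((a g : ℂ) * z g ^ l) * ∑ j ∈ J, (b j : ℂ) * ζ ^ (l * N g * B j) := by
        rw [Finset.mul_sum]
        refine Finset.sum_congr rfl fun j _ => ?_
        simp only [hx]
        rw [mul_zpow, ← zpow_mul]
        push_cast
        rw [show N g * B j * l = l * N g * B j by ring]
        ring
      rw [h2, norm_mul, norm_mul, norm_zpow, hz, one_zpow, mul_one, Complex.norm_real,
        Real.norm_of_nonneg (ha0 g hg)]
    have h3 : ∑ g ∈ G, a g * F (N g) =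
        ∑ r ∈ Finset.range P, (∑ g ∈ G with ρ g = r, a g) * F r := by
      rw [← Finset.sum_fiberwise_of_maps_to hρlt]
      refine Finset.sum_congr rfl fun r _ => ?_
      rw [Finset.sum_mul]
      refine Finset.sum_congr rfl fun g hg => ?_
      rw [hFρ, (Finset.mem_filter.1 hg).2]
    have h4 : ∑ r ∈ Finset.range P, (∑ g ∈ G with ρ g = r, a g) ^ 2 ≤ ε₁ := by
      refine le_trans (le_of_eq ?_) hcoll
      rw [← Finset.sum_fiberwise_of_maps_to hρlt]
      refine Finset.sum_congr rfl fun r _ => ?_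
      rw [sq, Finset.sum_mul_sum]
      refine Finset.sum_congr rfl fun g hg => ?_
      refine Finset.sum_congr ?_ fun _ _ => rfl
      ext g'
      simp only [Finset.mem_filter]
      refine and_congr_right fun _ => ?_
      rw [← (Finset.mem_filter.1 hg).2, ← hρcast, ← hρcast, Nat.cast_inj, eq_comm]
    have h5 := sum_normSq_expSum hb0 hb1 hζ hbε (l := l) (B := B) (by
      intro j hj j' hj' hne hdvd
      obtain ⟨h6, h7⟩ := hB j hj j' hj' hne
      have h8 : l * (B j - B j') ≠ 0 := mul_ne_zero hl (sub_ne_zero.2 h6)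
      have h9 := Int.le_of_dvd (abs_pos.2 h8) ((dvd_abs _ _).2 hdvd)
      rw [abs_mul] at h9
      have h10 : |l| * |B j - B j'| ≤ K * |B j - B j'| :=
        mul_le_mul_of_nonneg_right hlK.le (abs_nonneg _)
      omega) hP
    have hε₂ : 0 ≤ ε₂ := by
      rcases J.eq_empty_or_nonempty with rfl | ⟨j, hj⟩
      · simp at hb1
      · exact (hb0 j hj).trans (hbε j hj)
    calc ‖∑ g ∈ G, ∑ j ∈ J, ((a g * b j : ℝ) : ℂ) * x g j ^ l‖ ^ 2
        ≤ (∑ r ∈ Finset.range P, (∑ g ∈ G with ρ g = r, a g) * F r) ^ 2 := by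
          rw [← h3]
          exact pow_le_pow_left₀ (norm_nonneg _) h1 2
      _ ≤ (∑ r ∈ Finset.range P, (∑ g ∈ G with ρ g = r, a g) ^ 2) *
            ∑ r ∈ Finset.range P, F r ^ 2 := Finset.sum_mul_sq_le_sq_mul_sq _ _ _
      _ ≤ ε₁ * (P * ε₂) := by
          refine mul_le_mul h4 h5 (Finset.sum_nonneg fun _ _ => sq_nonneg _) ?_
          exact (Finset.sum_nonneg fun _ _ => sq_nonneg _).trans h4
      _ = P * (ε₁ * ε₂) := by ring
  have hexp : ∀ g j, ((‖∑ n ∈ Finset.range K, x g j ^ n‖ ^ 2 : ℝ) : ℂ) =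
      ∑ n ∈ Finset.range K, ∑ n' ∈ Finset.range K, x g j ^ ((n : ℤ) - n') := by
    intro g j
    rw [← Complex.normSq_eq_norm_sq, ← Complex.mul_conj, map_sum, Finset.sum_mul_sum]
    refine Finset.sum_congr rfl fun n _ => Finset.sum_congr rfl fun n' _ => ?_
    rw [zpow_sub₀ (hx0 g j), zpow_natCast, zpow_natCast, div_eq_mul_inv]
    congr 1
    rw [map_pow, ← inv_pow]
    congr 1
    rw [Complex.inv_def, Complex.normSq_eq_norm_sq, hxn]
    simp
  have hlower : ((∑ g ∈ G, ∑ j ∈ J, a g * b j * ‖∑ n ∈ Finset.range K, x g j ^ n‖ ^ 2 : ℝ) : ℂ) =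
      ∑ n ∈ Finset.range K, ∑ n' ∈ Finset.range K,
        ∑ g ∈ G, ∑ j ∈ J, ((a g * b j : ℝ) : ℂ) * x g j ^ ((n : ℤ) - n') := by
    have : ∀ g j, (((a g * b j * ‖∑ n ∈ Finset.range K, x g j ^ n‖ ^ 2 : ℝ)) : ℂ) =
        ∑ n ∈ Finset.range K, ∑ n' ∈ Finset.range K,
          ((a g * b j : ℝ) : ℂ) * x g j ^ ((n : ℤ) - n') := by
      intro g j
      rw [Complex.ofReal_mul, hexp, Finset.mul_sum]
      exact Finset.sum_congr rfl fun n _ => Finset.mul_sum _ _ _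
    rw [Complex.ofReal_sum]
    simp_rw [Complex.ofReal_sum, this]
    rw [Finset.sum_congr rfl fun g _ => Finset.sum_comm, Finset.sum_comm]
    refine Finset.sum_congr rfl fun n _ => ?_
    rw [Finset.sum_congr rfl fun g _ => Finset.sum_comm, Finset.sum_comm]
  -- Diagonal terms equal 1 and the off-diagonal ones exceed -1/(2K); summing over K² pairs gives
  -- more than K - K/2.
  have hE : ∀ n ∈ Finset.range K, ∀ n' ∈ Finset.range K,
      (if n = n' then (1 : ℝ) else 0) - 1 / (2 * K) <
        (∑ g ∈ G, ∑ j ∈ J, ((a g * b j : ℝ) : ℂ) * x g j ^ ((n : ℤ) - n')).re := by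
    intro n hn n' hn'
    rw [Finset.mem_range] at hn hn'
    by_cases hnn : n = n'
    · subst hnn
      simp only [sub_self, zpow_zero, mul_one, if_true]
      have : ∑ g ∈ G, ∑ j ∈ J, ((a g * b j : ℝ) : ℂ) = ((1 : ℝ) : ℂ) := by
        rw [← ha1]
        push_cast
        refine Finset.sum_congr rfl fun g _ => ?_
        rw [← Finset.mul_sum, ← Complex.ofReal_sum, hb1]
        simp
      rw [this, Complex.ofReal_re]
      have : 0 < 1 / (2 * (K : ℝ)) := by positivity
      linarith
    · rw [if_neg hnn, zero_sub]
      have h1 := hT ((n : ℤ) - n') (by omega) (by rw [abs_lt]; omega)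
      have h2 := h1.trans_lt hsmall
      rw [← one_div_pow] at h2
      have h3 := lt_of_pow_lt_pow_left₀ 2 (by positivity) h2
      have h4 := Complex.abs_re_le_norm
        (∑ g ∈ G, ∑ j ∈ J, ((a g * b j : ℝ) : ℂ) * x g j ^ ((n : ℤ) - n'))
      have h5 := (abs_le.1 h4).1
      linarith
  have hlow2 := congrArg Complex.re hlower
  rw [Complex.ofReal_re, Complex.re_sum] at hlow2
  have hKne : (Finset.range K).Nonempty := by
    rw [Finset.nonempty_range_iff]
    rintro rfl
    simp at hK0
  have h6 : ∑ n ∈ Finset.range K, ∑ n' ∈ Finset.range K,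
      ((if n = n' then (1 : ℝ) else 0) - 1 / (2 * K)) <
      ∑ n ∈ Finset.range K, (∑ n' ∈ Finset.range K,
        ∑ g ∈ G, ∑ j ∈ J, ((a g * b j : ℝ) : ℂ) * x g j ^ ((n : ℤ) - n')).re := by
    refine Finset.sum_lt_sum_of_nonempty hKne fun n hn => ?_
    rw [Complex.re_sum]
    exact Finset.sum_lt_sum_of_nonempty hKne fun n' hn' => hE n hn n' hn'
  rw [← hlow2] at h6
  have h7 : ∑ n ∈ Finset.range K, ∑ n' ∈ Finset.range K,
      ((if n = n' then (1 : ℝ) else 0) - 1 / (2 * K)) = K / 2 := by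
    have : ∀ n ∈ Finset.range K, ∑ n' ∈ Finset.range K,
        ((if n = n' then (1 : ℝ) else 0) - 1 / (2 * K)) = 1 / 2 := by
      intro n hn
      rw [Finset.sum_sub_distrib, Finset.sum_ite_eq, if_pos hn, Finset.sum_const,
        Finset.card_range, nsmul_eq_mul]
      field_simp
      norm_num
    rw [Finset.sum_congr rfl this, Finset.sum_const, Finset.card_range, nsmul_eq_mul]
    ring
  linarith

end

section

/-! ### Extending words to fractions with denominator `q` -/

open Filter Topology

/-- Appending the letter 1 at most doubles the denominator, so no dyadic range is skipped. -/
theorem exists_append_ones {u : List ℕ} (hu : PosWord u) {R : ℝ} (hR : cden u ≤ R) :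
    ∃ k, R ≤ cden (u ++ List.replicate k 1) ∧ (cden (u ++ List.replicate k 1) : ℝ) < 2 * R := by
  have hR1 : 1 ≤ R := hu.one_le_cden_real.trans hR
  have hpos : ∀ k, PosWord (u ++ List.replicate k 1) := fun k =>
    posWord_append.2 ⟨hu, (isWord_replicate_one le_rfl k).pos⟩
  have hex : ∃ k, R ≤ cden (u ++ List.replicate k 1) := by
    obtain ⟨n, hn⟩ := pow_unbounded_of_one_lt R (one_lt_two : (1 : ℝ) < 2)
    refine ⟨2 * n, hn.le.trans ?_⟩
    have h1 := two_pow_le_cden (hpos (2 * n))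
    have h2 : 2 ^ n ≤ cden (u ++ List.replicate (2 * n) 1) :=
      (Nat.pow_le_pow_right (by norm_num) (by simp; omega)).trans h1
    exact_mod_cast h2
  classical
  refine ⟨Nat.find hex, Nat.find_spec hex, ?_⟩
  rcases hk : Nat.find hex with _ | k
  · simpa using lt_of_le_of_lt hR (by linarith)
  · have h1 := not_le.1 (Nat.find_min hex (m := k) (by omega))
    have h2 := cden_snoc_le (hpos k) 1
    rw [List.append_assoc, ← List.replicate_succ'] at h2
    have h3 : (cden (u ++ List.replicate (k + 1) 1) : ℝ) ≤ (1 + 1) * cden (u ++ List.replicate k 1) := by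
      exact_mod_cast h2
    linarith

/-- The image of 1/2 has distance at least 1/(8 q(u)²) from both endpoints of the cylinder. -/
theorem mem_image_of_near_half {u : List ℕ} (hu : PosWord u) {x : ℝ}
    (hx : |x - cfEval u (1 / 2)| < 1 / (8 * (cden u : ℝ) ^ 2)) :
    ∃ y : ℝ, 0 < y ∧ y < 1 ∧ x = cfEval u y := by
  have h1 := hu.eval_sub (K := ℝ) (y := 1 / 2) (z := 0) (by norm_num) le_rfl
  have h2 := hu.eval_sub (K := ℝ) (y := 1) (z := 1 / 2) (by norm_num) (by norm_num)
  have hX : ∀ y : ℝ, 0 ≤ y → y ≤ 1 → ∀ z : ℝ, 0 ≤ z → z ≤ 1 →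
      1 / (8 * (cden u : ℝ) ^ 2) ≤
        (1 / 2) / ((cden u + cden' u * y : ℝ) * (cden u + cden' u * z)) := by
    intro y hy hy1 z hz hz1
    have h3 := hu.eval_den_le hy hy1
    have h4 := hu.eval_den_le hz hz1
    have h5 := hu.eval_den_pos hy
    have h6 := hu.eval_den_pos hz
    have h7 := hu.one_le_cden_real
    rw [div_le_div_iff₀ (by positivity) (by positivity)]
    nlinarith [mul_le_mul h3 h4 h6.le (by linarith)]
  have h3 := hX (1 / 2) (by norm_num) (by norm_num) 0 le_rfl (by norm_num)
  have h4 := hX 1 (by norm_num) le_rfl (1 / 2) (by norm_num) (by norm_num)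
  rw [show (1 : ℝ) / 2 - 0 = 1 / 2 by norm_num] at h1
  rw [show (1 : ℝ) - 1 / 2 = 1 / 2 by norm_num] at h2
  rw [abs_lt] at hx
  have hmem : x ∈ Set.uIoo (cfEval u (0 : ℝ)) (cfEval u 1) := by
    rcases neg_one_pow_eq_or ℝ u.length with h | h <;> rw [h] at h1 h2
    · rw [Set.uIoo_of_le (by linarith)]
      constructor <;> linarith
    · rw [Set.uIoo_of_ge (by linarith)]
      constructor <;> linarith
  obtain ⟨y, hy, rfl⟩ := uIoo_subset_image hu hmem
  exact ⟨y, hy.1, hy.2, rfl⟩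

theorem stopWords_center_sep {n : ℕ} {j j' : List ℕ} (hj : j ∈ stopWords n) (hj' : j' ∈ stopWords n)
    (hne : j ≠ j') :
    1 / (72 * ((2 : ℝ) ^ n) ^ 2) ≤ |cfEval j (1 / 2 : ℝ) - cfEval j' (1 / 2)| := by
  by_contra! hcon
  have hp := (mem_stopWords.1 hj).1.pos
  have hp' := (mem_stopWords.1 hj').1.pos
  have h1 := cden_le_of_mem_stopWords hj
  have h2 := hp.one_le_cden_real
  obtain ⟨y, hy, hy1, h⟩ := mem_image_of_near_half hp (x := cfEval j' (1 / 2)) (by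
    rw [abs_sub_comm]
    refine hcon.trans_le (one_div_le_one_div_of_le (by positivity) ?_)
    nlinarith)
  rcases prefix_or_prefix_of_eval_eq hp hp' hy hy1 (by norm_num : (0 : ℝ) < 1 / 2) (by norm_num)
    h.symm with h | h
  · exact hne (isIncomparable_stopWords n j hj j' hj' h)
  · exact hne (isIncomparable_stopWords n j' hj' j hj h).symm

theorem exists_branching {g g' : List ℕ} (h : ¬ g <+: g') (h' : ¬ g' <+: g) :
    ∃ k c c' r r', c ≠ c' ∧ g = k ++ c :: r ∧ g' = k ++ c' :: r' := by
  induction g generalizing g' with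
  | nil => simp at h
  | cons c r ih =>
    cases g' with
    | nil => simp at h'
    | cons c' r' =>
      by_cases hc : c = c'
      · subst hc
        obtain ⟨k, d, d', s, s', hd, rfl, rfl⟩ := ih (g' := r') (by simpa using h) (by simpa using h')
        exact ⟨c :: k, d, d', s, s', hd, rfl, rfl⟩
      · exact ⟨[], c, c', r, r', hc, rfl, rfl⟩

theorem third_le_cfEval {u : List ℕ} (hu : IsWord 2 u) (hne : u ≠ []) {y : ℝ} (hy : 0 ≤ y)
    (hy1 : y ≤ 1) : 1 / 3 ≤ cfEval u y := by
  cases u with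
  | nil => exact absurd rfl hne
  | cons c u =>
    obtain ⟨hc, hu⟩ := isWord_cons.1 hu
    rw [cfEval_cons c hu.pos hy, one_div]
    have h1 := cfEval_nonneg u hy
    have h2 := hu.pos.eval_le_one hy hy1
    have h3 : (c : ℝ) ≤ 2 := by exact_mod_cast hc.2
    have h4 : (1 : ℝ) ≤ c := by exact_mod_cast hc.1
    exact inv_anti₀ (by linarith) (by linarith)

/-- The words split after a common prefix `g.take i`, and the cylinder map of that prefix contracts
by at most a factor comparable to the square of its denominator. The appended letter 1 makes both
remaining tails nonempty, hence with values in [1/3, 1]; so the different letters at the branching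
leave a gap of at least 1/3. -/
theorem slope_sep {g g' : List ℕ} (hg : IsWord 2 g) (hg' : IsWord 2 g') (h : ¬ g <+: g')
    (h' : ¬ g' <+: g) {y : ℝ} (hy : 0 ≤ y) (hy1 : y ≤ 1) :
    ∃ i < g.length, g.take i <+: g' ∧ 1 / (108 * (cden (g.take i) : ℝ) ^ 2) ≤
      |cfEval (g ++ [1]) y - cfEval (g' ++ [1]) y| := by
  obtain ⟨k, c, c', r, r', hcc, rfl, rfl⟩ := exists_branching h h'
  refine ⟨k.length, by simp, by simp, ?_⟩
  rw [List.take_left]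
  obtain ⟨hk, hcr⟩ := isWord_append.1 hg
  obtain ⟨-, hcr'⟩ := isWord_append.1 hg'
  obtain ⟨hc, hr⟩ := isWord_cons.1 hcr
  obtain ⟨hc', hr'⟩ := isWord_cons.1 hcr'
  have h1 : IsWord 2 [1] := by simp [IsWord]
  have hr1 := isWord_append.2 ⟨hr, h1⟩
  have hr1' := isWord_append.2 ⟨hr', h1⟩
  have e1 : cfEval ((k ++ c :: r) ++ [1]) y = cfEval k (((c : ℝ) + cfEval (r ++ [1]) y)⁻¹) := by
    rw [List.append_assoc, List.cons_append,
      cfEval_append k (posWord_cons.2 ⟨hc.1, hr1.pos⟩) hy, cfEval_cons c hr1.pos hy]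
  have e2 : cfEval ((k ++ c' :: r') ++ [1]) y = cfEval k (((c' : ℝ) + cfEval (r' ++ [1]) y)⁻¹) := by
    rw [List.append_assoc, List.cons_append,
      cfEval_append k (posWord_cons.2 ⟨hc'.1, hr1'.pos⟩) hy, cfEval_cons c' hr1'.pos hy]
  rw [e1, e2]
  have b1 := third_le_cfEval hr1 (by simp) hy hy1
  have b2 := hr1.pos.eval_le_one hy hy1
  have b1' := third_le_cfEval hr1' (by simp) hy hy1
  have b2' := hr1'.pos.eval_le_one hy hy1
  set ξ := cfEval (r ++ [1]) y
  set ξ' := cfEval (r' ++ [1]) y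
  have c1 : (1 : ℝ) ≤ c ∧ (c : ℝ) ≤ 2 := by exact_mod_cast hc
  have c1' : (1 : ℝ) ≤ c' ∧ (c' : ℝ) ≤ 2 := by exact_mod_cast hc'
  have i1 : ((c : ℝ) + ξ)⁻¹ ≤ 1 := inv_le_one_of_one_le₀ (by linarith)
  have i1' : ((c' : ℝ) + ξ')⁻¹ ≤ 1 := inv_le_one_of_one_le₀ (by linarith)
  refine le_trans ?_ (hk.pos.le_abs_eval_sub (inv_nonneg.2 (by linarith)) i1
    (inv_nonneg.2 (by linarith)) i1')
  have hgap : 1 / 3 ≤ |((c' : ℝ) + ξ') - (c + ξ)| := by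
    rcases lt_or_gt_of_ne hcc with h | h
    · have : (c : ℝ) + 1 ≤ c' := by exact_mod_cast h
      exact le_trans (by linarith) (le_abs_self _)
    · have : (c' : ℝ) + 1 ≤ c := by exact_mod_cast h
      exact le_trans (by linarith) (neg_le_abs _)
  have hinv : ((c : ℝ) + ξ)⁻¹ - ((c' : ℝ) + ξ')⁻¹ =
      (((c' : ℝ) + ξ') - (c + ξ)) / ((c + ξ) * (c' + ξ')) := by
    have : (c : ℝ) + ξ ≠ 0 := by linarith
    have : (c' : ℝ) + ξ' ≠ 0 := by linarith
    field_simp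
  have hden0 : 0 < ((c : ℝ) + ξ) * (c' + ξ') := mul_pos (by linarith) (by linarith)
  have hden : ((c : ℝ) + ξ) * (c' + ξ') ≤ 9 := by
    nlinarith [mul_le_mul (show (c : ℝ) + ξ ≤ 3 by linarith) (show (c' : ℝ) + ξ' ≤ 3 by linarith)
      (by linarith) (by norm_num)]
  rw [hinv, abs_div, abs_of_pos hden0]
  have hk1 := hk.pos.one_le_cden_real
  calc 1 / (108 * (cden k : ℝ) ^ 2) = 1 / 3 / 9 / (4 * (cden k : ℝ) ^ 2) := by
        field_simp; norm_num
    _ ≤ _ := by gcongr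

/-- Two denominators `X = Q (1 + θ y)` whose ratio is close to `1` at two points `y`. -/
theorem abs_sub_mul_le_of_ratio {U U' : List ℕ} (hU : PosWord U) (hU' : PosWord U')
    (hUU : (cden U : ℝ) ≤ 12 * cden U') {η y z : ℝ} (hy : 0 ≤ y) (hy1 : y ≤ 1) (hz : 0 ≤ z)
    (hz1 : z ≤ 1)
    (h1 : |(cden U' + cden' U' * y) / (cden U + cden' U * y) - 1| ≤ η)
    (h2 : |(cden U' + cden' U' * z) / (cden U + cden' U * z) - 1| ≤ η) :
    |y - z| * |(cden' U : ℝ) / cden U - cden' U' / cden U'| ≤ 96 * η := by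
  have hQ := hU.one_le_cden_real
  have hQ' := hU'.one_le_cden_real
  have hX := hU.eval_den_pos hy
  have hZ := hU.eval_den_pos hz
  have hX2 := hU.eval_den_le hy hy1
  have hZ2 := hU.eval_den_le hz hz1
  have key : ((cden U' + cden' U' * y) / (cden U + cden' U * y) - 1) -
      ((cden U' + cden' U' * z) / (cden U + cden' U * z) - 1) =
      -(((y - z) * ((cden' U : ℝ) / cden U - cden' U' / cden U')) *
        ((cden U * cden U') / ((cden U + cden' U * y) * (cden U + cden' U * z)))) := by
    have : (cden U : ℝ) ≠ 0 := by linarith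
    have : (cden U' : ℝ) ≠ 0 := by linarith
    have := hX.ne'
    have := hZ.ne'
    field_simp
    ring
  have hκ : 1 / 48 ≤ ((cden U : ℝ) * cden U') / ((cden U + cden' U * y) * (cden U + cden' U * z)) := by
    rw [div_le_div_iff₀ (by norm_num) (mul_pos hX hZ)]
    have := mul_le_mul hX2 hZ2 hZ.le (by linarith)
    nlinarith
  have h3 := (abs_sub _ _).trans (add_le_add h1 h2)
  rw [key, abs_neg, abs_mul, abs_mul, abs_of_pos (lt_of_lt_of_le (by norm_num) hκ)] at h3
  have h4 : 0 ≤ |y - z| * |(cden' U : ℝ) / cden U - cden' U' / cden U'| := by positivity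
  nlinarith [mul_le_mul_of_nonneg_left hκ h4]

/-- The mass of the suffixes at which two given words have almost the same denominator. -/
theorem ConformalMass.sum_ratio_le {m : List ℕ → ℝ} (hm : ConformalMass 2 m) {n h : ℕ}
    {U U' : List ℕ} (hU : PosWord U) (hU' : PosWord U') (hUU : (cden U : ℝ) ≤ 12 * cden U') {Q : ℝ}
    (hQ : 1 ≤ Q) (hsep : 1 / (108 * Q ^ 2) ≤ |(cden' U : ℝ) / cden U - cden' U' / cden U'|)
    {S : Finset (List ℕ)} (hS : S ⊆ stopWords (n + h))
    (hr : ∀ f ∈ S, |((cden U' : ℝ) + cden' U' * cfEval f 0) / (cden U + cden' U * cfEval f 0) - 1| ≤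
      (((2 : ℝ) ^ n) ^ 2)⁻¹) :
    ∑ f ∈ S, m f ≤ (216 * 10368) * (Q ^ (2 * hausdorffDimBounded 2) *
      ((2 : ℝ) ^ n) ^ (-(2 * hausdorffDimBounded 2))) := by
  set w := hausdorffDimBounded 2 with hw
  have hw0 : 0 ≤ w := hausdorffDimBounded_nonneg 2
  have hw1 : w ≤ 1 := hausdorffDimBounded_le_one 2
  have hSw : ∀ f ∈ S, IsWord 2 f := fun f hf => (mem_stopWords.1 (hS hf)).1
  have hSi := (isIncomparable_stopWords (n + h)).mono hS
  have h2n : (0 : ℝ) < 2 ^ n := by positivity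
  set A : ℝ := Q ^ (2 * w) * ((2 : ℝ) ^ n) ^ (-(2 * w)) with hA
  have hA' : A = (2 ^ n / Q) ^ (-(2 * w)) := by
    rw [hA, Real.div_rpow h2n.le (by linarith), Real.rpow_neg (by linarith : (0 : ℝ) ≤ Q), div_inv_eq_mul,
      mul_comm]
  set B : ℝ := Real.sqrt 10368 with hB
  have hB2 : B ^ 2 = 10368 := Real.sq_sqrt (by norm_num)
  have hB0 : 0 < B := Real.sqrt_pos.2 (by norm_num)
  have hB1 : 1 ≤ B := by nlinarith
  -- By `abs_sub_mul_le_of_ratio` and the separation of slopes, the values of all f in S lie in an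
  -- interval of length 96 · 108 · Q² / (2^n)² = 1/T². If T < 1, the trivial bound by the total mass
  -- 1 suffices.
  set T : ℝ := 2 ^ n / Q / B with hT
  have hQ0 : 0 < Q := by linarith
  have hT0 : 0 < T := by positivity
  have hTA : T ^ (-(2 * w)) ≤ 10368 * A := by
    rw [hA', hT, Real.div_rpow (by positivity) hB0.le, Real.rpow_neg hB0.le, div_inv_eq_mul,
      mul_comm]
    refine mul_le_mul_of_nonneg_right ?_ (by positivity)
    calc B ^ (2 * w) ≤ B ^ (2 : ℝ) := Real.rpow_le_rpow_of_exponent_le hB1 (by linarith)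
      _ = 10368 := by rw [← hB2]; exact Real.rpow_two B
  rcases S.eq_empty_or_nonempty with rfl | hne
  · simp only [Finset.sum_empty]
    positivity
  rcases lt_or_ge T 1 with hT1 | hT1
  · have h1 : ∑ f ∈ S, m f ≤ 1 := by
      rw [← hm.nil]
      exact hm.sum_le hSi hSw (isWord_nil 2) fun u _ => List.nil_prefix
    have h2 : 1 ≤ T ^ (-(2 * w)) :=
      Real.one_le_rpow_of_pos_of_le_one_of_nonpos hT0 hT1.le (by linarith)
    nlinarith
  · obtain ⟨f₀, hf₀, hmin⟩ := S.exists_min_image (fun f => cfEval f (0 : ℝ)) hne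
    have hTT : 1 / T ^ 2 = 10368 * Q ^ 2 * (((2 : ℝ) ^ n) ^ 2)⁻¹ := by
      rw [hT, div_pow, div_pow, hB2]
      field_simp
    have hmeets := hm.sum_le_of_meets (T := T) (α := cfEval f₀ 0) (β := cfEval f₀ 0 + 1 / T ^ 2)
      hSi hSw hT1 (by linarith [show 0 < 1 / T ^ 2 by positivity]) (by linarith) (by
        intro u hu
        refine le_trans ?_ (mem_stopWords.1 (hS hu)).2.2.1
        rw [hT]
        refine (div_le_self (by positivity) hB1).trans ((div_le_self (by positivity) hQ).trans ?_)
        exact pow_le_pow_right₀ (by norm_num) (by omega)) (by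
        intro f hf
        refine ⟨0, by simp, hmin f hf, ?_⟩
        have h1 := abs_sub_mul_le_of_ratio hU hU' hUU (cfEval_nonneg f le_rfl)
          ((hSw f hf).pos.eval_le_one le_rfl zero_le_one) (cfEval_nonneg f₀ le_rfl)
          ((hSw f₀ hf₀).pos.eval_le_one le_rfl zero_le_one) (hr f hf) (hr f₀ hf₀)
        have h2 : |cfEval f (0 : ℝ) - cfEval f₀ 0| * (1 / (108 * Q ^ 2)) ≤
            96 * (((2 : ℝ) ^ n) ^ 2)⁻¹ :=
          (mul_le_mul_of_nonneg_left hsep (abs_nonneg _)).trans h1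
        rw [mul_one_div, div_le_iff₀ (by positivity)] at h2
        have h3 := (le_abs_self _).trans h2
        rw [hTT]
        linarith)
    have h216 : (24 * (((2 : ℕ) : ℝ) + 1) ^ 2 : ℝ) = 216 := by norm_num
    rw [h216] at hmeets
    refine hmeets.trans ?_
    rw [mul_assoc]
    exact mul_le_mul_of_nonneg_left hTA (by norm_num)

theorem cfEval_zero (u : List ℕ) : cfEval u (0 : ℝ) = (cnum u : ℝ) / cden u := by
  simp [cfEval]

/-- The words `v g̃ 1`, where `g̃` is the reversed word. -/
theorem cden'_div_cden_reverse (v g : List ℕ) (hv : PosWord v) :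
    (cden' (v ++ (g ++ [1]).reverse) : ℝ) / cden (v ++ (g ++ [1]).reverse) =
      cfEval (g ++ [1]) (cfEval v.reverse 0) := by
  rw [← cfEval_append _ (posWord_reverse.2 hv) le_rfl, cfEval_zero, ← cnum_reverse,
    ← cden_reverse (v ++ _)]
  simp

/-- For some suffix `f` the collision energy of the denominators is small. -/
theorem ConformalMass.exists_suffix {m : List ℕ → ℝ} (hm : ConformalMass 2 m) {n h : ℕ}
    {v : List ℕ} (hv : PosWord v) (coll : List ℕ → List ℕ → List ℕ → Prop)
    (hcoll : ∀ f ∈ stopWords (n + h), ∀ g ∈ stopWords n, ∀ g' ∈ stopWords n, coll f g g' →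
      |((cden (v ++ (g' ++ [1]).reverse) : ℝ) + cden' (v ++ (g' ++ [1]).reverse) * cfEval f 0) /
        (cden (v ++ (g ++ [1]).reverse) + cden' (v ++ (g ++ [1]).reverse) * cfEval f 0) - 1| ≤
      (((2 : ℝ) ^ n) ^ 2)⁻¹)
    (hUU : ∀ g ∈ stopWords n, ∀ g' ∈ stopWords n,
      (cden (v ++ (g ++ [1]).reverse) : ℝ) ≤ 12 * cden (v ++ (g' ++ [1]).reverse)) :
    ∃ f ∈ stopWords (n + h), ∀ [∀ g g', Decidable (coll f g g')],
      ∑ g ∈ stopWords n, ∑ g' ∈ stopWords n with coll f g g', m g * m g' ≤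
        (4 * (216 * 10368)) * (2 * n + 1) * ((2 : ℝ) ^ n) ^ (-(2 * hausdorffDimBounded 2)) := by
  classical
  set w := hausdorffDimBounded 2 with hw
  set E : ℝ := ((2 : ℝ) ^ n) ^ (-(2 * w)) with hE
  have hE0 : 0 < E := by positivity
  set F := stopWords (n + h) with hF
  set G := stopWords n with hG
  have hGw : ∀ g ∈ G, IsWord 2 g := fun g hg => (mem_stopWords.1 hg).1
  have hFpos : ∀ f ∈ F, 0 < m f := fun f hf => hm.pos (mem_stopWords.1 hf).1
  have hGpos : ∀ g ∈ G, 0 < m g := fun g hg => hm.pos (hGw g hg)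
  have hone : IsWord 2 [1] := by simp [IsWord]
  have hUp : ∀ g ∈ G, PosWord (v ++ (g ++ [1]).reverse) := fun g hg =>
    posWord_append.2 ⟨hv, posWord_reverse.2 (isWord_append.2 ⟨hGw g hg, hone⟩).pos⟩
  set y₀ : ℝ := cfEval v.reverse 0 with hy₀
  have hy0 : 0 ≤ y₀ := cfEval_nonneg _ le_rfl
  have hy1 : y₀ ≤ 1 := (posWord_reverse.2 hv).eval_le_one le_rfl zero_le_one
  have hA1 : ∀ g g', ∑ f ∈ F with coll f g g', m f ≤ 1 := by
    intro g g'
    rw [← hm.sum_stopWords (n + h)]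
    exact Finset.sum_le_sum_of_subset_of_nonneg (Finset.filter_subset _ _)
      fun f hf _ => (hFpos f hf).le
  -- The slopes of the two linear forms are the values of g 1 and g' 1 at the same point, so their
  -- separation is governed by the common prefix of g and g'.
  have hA2 : ∀ g ∈ G, ∀ g' ∈ G, g ≠ g' → ∃ i < g.length, g.take i <+: g' ∧
      ∑ f ∈ F with coll f g g', m f ≤ (216 * 10368) * ((cden (g.take i) : ℝ) ^ (2 * w) * E) := by
    intro g hg g' hg' hne
    have hinc := isIncomparable_stopWords n
    obtain ⟨i, hi, hpre, hsep⟩ := slope_sep (hGw g hg) (hGw g' hg')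
      (fun h => hne (hinc g hg g' hg' h)) (fun h => hne (hinc g' hg' g hg h).symm) hy0 hy1
    refine ⟨i, hi, hpre, ?_⟩
    rw [← cden'_div_cden_reverse v g hv, ← cden'_div_cden_reverse v g' hv] at hsep
    refine hm.sum_ratio_le (hUp g hg) (hUp g' hg') (hUU g hg g' hg')
      ((hGw g hg).pos.of_prefix (List.take_prefix _ _)).one_le_cden_real hsep
      (Finset.filter_subset _ _) fun f hf => ?_
    obtain ⟨hf1, hf2⟩ := Finset.mem_filter.1 hf
    exact hcoll f hf1 g hg g' hg' hf2
  -- The g' are sorted by the length of their common prefix with g. For a prefix of denominator Q,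
  -- the mass of such g' is at most 4 Q^(-2w), which cancels the factor Q^(2w) of the colliding f;
  -- there are at most 2n lengths, and the term g' = g contributes m g.
  have hrow : ∀ g ∈ G, ∑ g' ∈ G, m g' * ∑ f ∈ F with coll f g g', m f ≤
      (4 * (216 * 10368)) * (2 * n + 1) * E := by
    intro g hg
    have hpt : ∀ g' ∈ G, m g' * ∑ f ∈ F with coll f g g', m f ≤
        (if g' = g then m g' else 0) + ∑ i ∈ Finset.range g.length,
          (if g.take i <+: g' then
            m g' * ((216 * 10368) * ((cden (g.take i) : ℝ) ^ (2 * w) * E)) else 0) := by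
      intro g' hg'
      have hterm : ∀ i ∈ Finset.range g.length, 0 ≤ (if g.take i <+: g' then
            m g' * ((216 * 10368) * ((cden (g.take i) : ℝ) ^ (2 * w) * E)) else 0) := by
        intro i _
        have := (hGpos g' hg').le
        split_ifs <;> positivity
      by_cases hgg : g' = g
      · rw [if_pos hgg]
        have h1 := Finset.sum_nonneg hterm
        have h2 := mul_le_mul_of_nonneg_left (hA1 g g') (hGpos g' hg').le
        linarith
      · rw [if_neg hgg, zero_add]
        obtain ⟨i, hi, hpre, hle⟩ := hA2 g hg g' hg' (Ne.symm hgg)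
        refine le_trans ?_ (Finset.single_le_sum hterm (Finset.mem_range.2 hi))
        rw [if_pos hpre]
        exact mul_le_mul_of_nonneg_left hle (hGpos g' hg').le
    refine (Finset.sum_le_sum hpt).trans ?_
    rw [Finset.sum_add_distrib, Finset.sum_ite_eq', if_pos hg, Finset.sum_comm]
    have hcol : ∀ i ∈ Finset.range g.length, ∑ g' ∈ G, (if g.take i <+: g' then
        m g' * ((216 * 10368) * ((cden (g.take i) : ℝ) ^ (2 * w) * E)) else 0) ≤
        4 * (216 * 10368) * E := by
      intro i _
      rw [← Finset.sum_filter, ← Finset.sum_mul]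
      have hk := (hGw g hg).of_prefix (List.take_prefix i g)
      have hk1 := hk.pos.one_le_cden_real
      have h1 : ∑ g' ∈ G with g.take i <+: g', m g' ≤ 4 * (cden (g.take i) : ℝ) ^ (-(2 * w)) := by
        refine (hm.sum_le ((isIncomparable_stopWords n).mono (Finset.filter_subset _ _))
          (fun u hu => hGw u (Finset.filter_subset _ _ hu)) hk
          fun u hu => (Finset.mem_filter.1 hu).2).trans ?_
        exact hm.le_of_le_cden hk (by linarith) le_rfl
      calc _ ≤ 4 * (cden (g.take i) : ℝ) ^ (-(2 * w)) *
            ((216 * 10368) * ((cden (g.take i) : ℝ) ^ (2 * w) * E)) := by gcongr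
        _ = 4 * (216 * 10368) * E *
            ((cden (g.take i) : ℝ) ^ (-(2 * w)) * (cden (g.take i) : ℝ) ^ (2 * w)) := by ring
        _ = 4 * (216 * 10368) * E := by
            rw [← Real.rpow_add (by linarith), neg_add_cancel, Real.rpow_zero, mul_one]
    have hlen : (g.length : ℝ) ≤ 2 * n := by exact_mod_cast (mem_stopWords.1 hg).2.1
    have hmg : m g ≤ 4 * E := hm.le_of_le_cden (hGw g hg) (by positivity) (mem_stopWords.1 hg).2.2.1
    have h2 := Finset.sum_le_sum hcol
    rw [Finset.sum_const, Finset.card_range, nsmul_eq_mul] at h2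
    have h3 : (g.length : ℝ) * (4 * (216 * 10368) * E) ≤ 2 * n * (4 * (216 * 10368) * E) := by
      gcongr
    nlinarith
  -- Averaging the collision energy over f with weights m f of total mass 1 and exchanging the sums;
  -- some f is then no worse than the average.
  have htot : ∑ f ∈ F, m f * ∑ g ∈ G, ∑ g' ∈ G with coll f g g', m g * m g' ≤
      (4 * (216 * 10368)) * (2 * n + 1) * E := by
    have h1 : ∑ f ∈ F, m f * ∑ g ∈ G, ∑ g' ∈ G with coll f g g', m g * m g' =
        ∑ g ∈ G, m g * ∑ g' ∈ G, m g' * ∑ f ∈ F with coll f g g', m f := by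
      simp only [Finset.mul_sum, Finset.sum_filter]
      rw [Finset.sum_comm]
      refine Finset.sum_congr rfl fun g _ => ?_
      rw [Finset.sum_comm]
      refine Finset.sum_congr rfl fun g' _ => Finset.sum_congr rfl fun f _ => ?_
      split_ifs <;> ring
    rw [h1]
    calc _ ≤ ∑ g ∈ G, m g * ((4 * (216 * 10368)) * (2 * n + 1) * E) :=
          Finset.sum_le_sum fun g hg => mul_le_mul_of_nonneg_left (hrow g hg) (hGpos g hg).le
      _ = _ := by rw [← Finset.sum_mul, hm.sum_stopWords, one_mul]
  have hex : ∃ f ∈ F, ∑ g ∈ G, ∑ g' ∈ G with coll f g g', m g * m g' ≤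
      (4 * (216 * 10368)) * (2 * n + 1) * E := by
    by_contra! hcon
    have hne : F.Nonempty := by
      by_contra hemp
      have := hm.sum_stopWords (n + h)
      rw [← hF, Finset.not_nonempty_iff_eq_empty.1 hemp] at this
      simp at this
    have h1 := Finset.sum_lt_sum_of_nonempty hne
      (fun f hf => mul_lt_mul_of_pos_left (hcon f hf) (hFpos f hf))
    rw [← Finset.sum_mul, hm.sum_stopWords, one_mul] at h1
    linarith
  obtain ⟨f, hf, hle⟩ := hex
  refine ⟨f, hf, fun {_} => ?_⟩
  convert hle

end

/-! ### Linearisation of the phase and existence of a fraction with denominator q. -/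

section

open Filter Topology

/-- With r = 2^(2-4w) the quantity is C (2n + 1) r^n, and r < 1 exactly because w > 1/2. -/
theorem exists_level (C : ℝ) {w ε : ℝ} (hw : 1 / 2 < w) (hε : 0 < ε) :
    ∃ n : ℕ, C * (2 * n + 1) * (((2 : ℝ) ^ n) ^ (-(2 * w)) * ((2 : ℝ) ^ n) ^ (-(2 * w)) *
      ((2 : ℝ) ^ n) ^ 2) < ε := by
  set r : ℝ := (2 : ℝ) ^ (2 - 4 * w) with hr
  have hr0 : 0 ≤ r := by positivity
  have hr1 : r < 1 := Real.rpow_lt_one_of_one_lt_of_neg (by norm_num) (by linarith)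
  have e : ∀ n : ℕ, ((2 : ℝ) ^ n) ^ (-(2 * w)) * ((2 : ℝ) ^ n) ^ (-(2 * w)) * ((2 : ℝ) ^ n) ^ 2 =
      r ^ n := by
    intro n
    have h2 : (0 : ℝ) < 2 ^ n := by positivity
    rw [← Real.rpow_two, ← Real.rpow_add h2, ← Real.rpow_add h2, hr, ← Real.rpow_natCast,
      ← Real.rpow_mul (by norm_num), ← Real.rpow_natCast, ← Real.rpow_mul (by norm_num)]
    congr 1
    ring
  have h1 := (tendsto_self_mul_const_pow_of_lt_one hr0 hr1).const_mul (2 * C)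
  have h2 := (tendsto_pow_atTop_nhds_zero_of_lt_one hr0 hr1).const_mul C
  have h3 := h1.add h2
  rw [mul_zero, mul_zero, add_zero] at h3
  obtain ⟨n, hn⟩ := (h3.eventually (gt_mem_nhds hε)).exists
  refine ⟨n, ?_⟩
  rw [e]
  calc _ = 2 * C * (n * r ^ n) + C * r ^ n := by ring
    _ < ε := hn

/-- The chord |exp(2πiτ) - 1| equals 2 |sin πτ|, which is at least four times the distance from τ to
the nearest integer. -/
theorem exists_int_near_of_norm_exp_sub_one {τ δ : ℝ}
    (h : ‖Complex.exp (2 * Real.pi * Complex.I * τ) - 1‖ < δ) : ∃ a : ℤ, |τ - a| ≤ δ / 4 := by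
  refine ⟨round τ, ?_⟩
  have h1 : (2 * Real.pi * Complex.I * τ : ℂ) = Complex.I * ((2 * Real.pi * τ : ℝ) : ℂ) := by
    push_cast; ring
  rw [h1, Complex.norm_exp_I_mul_ofReal_sub_one] at h
  have h2 : |Real.sin (Real.pi * (τ - round τ))| = |Real.sin (2 * Real.pi * τ / 2)| := by
    rw [mul_sub, show 2 * Real.pi * τ / 2 = Real.pi * τ by ring, mul_comm Real.pi (round τ : ℝ),
      Real.sin_sub_int_mul_pi, abs_mul, abs_zpow, abs_neg, abs_one, one_zpow, one_mul]
  rw [Real.norm_eq_abs, abs_mul, abs_two, ← h2] at h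
  have h3 := abs_sub_round τ
  have h4 : 2 * |τ - round τ| ≤ |Real.sin (Real.pi * (τ - round τ))| := by
    have key : ∀ x : ℝ, 0 ≤ x → x ≤ 1 / 2 → 2 * x ≤ Real.sin (Real.pi * x) := by
      intro x hx hx2
      have := Real.mul_le_sin (x := Real.pi * x) (by positivity)
        (by nlinarith [Real.pi_pos])
      have e : 2 / Real.pi * (Real.pi * x) = 2 * x := by
        field_simp
      linarith
    rcases le_total 0 (τ - round τ) with hs | hs
    · rw [abs_of_nonneg hs] at h3 ⊢
      exact (key _ hs h3).trans (le_abs_self _)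
    · rw [abs_of_nonpos hs] at h3 ⊢
      refine (key _ (by linarith) h3).trans ?_
      rw [mul_neg, Real.sin_neg]
      exact neg_le_abs _
  linarith

/-- First-order Taylor expansion of the Möbius map at y, whose derivative is ±1 over the squared
denominator; the quadratic remainder carries the extra factor q'/(q + q'z) ≤ 1. -/
theorem PosWord.abs_eval_add_sub_le {U : List ℕ} (hU : PosWord U) {y z : ℝ} (hy : 0 ≤ y)
    (hz : 0 ≤ z) :
    |cfEval U z - cfEval U y - (-1) ^ U.length * ((z - y) / (cden U + cden' U * y) ^ 2)| ≤
      (z - y) ^ 2 / (cden U + cden' U * y : ℝ) ^ 2 := by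
  have hX := hU.eval_den_pos hy
  have hZ := hU.eval_den_pos hz
  have hQ := hU.one_le_cden_real
  have hQ' : (cden' U : ℝ) ≤ cden U := by exact_mod_cast hU.cden'_le
  have e : cfEval U z - cfEval U y - (-1) ^ U.length * ((z - y) / (cden U + cden' U * y) ^ 2) =
      (-1) ^ U.length * (-((z - y) ^ 2 / (cden U + cden' U * y : ℝ) ^ 2 *
        (cden' U / (cden U + cden' U * z)))) := by
    rw [hU.eval_sub hz hy]
    have := hX.ne'
    have := hZ.ne'
    field_simp
    ring
  have h1 : (cden' U : ℝ) / (cden U + cden' U * z) ≤ 1 := by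
    rw [div_le_one hZ]
    have : (0 : ℝ) ≤ cden' U * z := by positivity
    linarith
  have h0 : (0 : ℝ) ≤ cden' U / (cden U + cden' U * z) := by positivity
  rw [e, abs_mul, abs_pow, abs_neg, abs_one, one_pow, one_mul, abs_neg, abs_of_nonneg (by positivity)]
  exact mul_le_of_le_one_right (by positivity) h1

/-- Rounding s in units of D and β in units of 1/(P D) replaces the real product s β by an integer
product over P, which is an exact phase modulo P. -/
theorem abs_mul_sub_floor_mul_floor_le {s β D P : ℝ} (hs : 0 ≤ s) (hD : 0 < D) (hP : 0 < P) :
    |s * β - (⌊s / D⌋ * ⌊β * P * D⌋ : ℝ) / P| ≤ s / D / P + |β| * D := by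
  have e : s * β - (⌊s / D⌋ * ⌊β * P * D⌋ : ℝ) / P =
      (s / D - ⌊s / D⌋) * (β * D) + ⌊s / D⌋ * (β * P * D - ⌊β * P * D⌋) / P := by
    field_simp
    ring
  have h0 : (0 : ℝ) ≤ ⌊s / D⌋ := by exact_mod_cast Int.floor_nonneg.2 (by positivity)
  have h1 := Int.floor_le (s / D)
  have h2 := Int.lt_floor_add_one (s / D)
  have h3 := Int.floor_le (β * P * D)
  have h4 := Int.lt_floor_add_one (β * P * D)
  rw [e]
  refine (abs_add_le _ _).trans ?_
  rw [add_comm (s / D / P)]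
  refine add_le_add ?_ ?_
  · rw [abs_mul, abs_mul, abs_of_pos hD, abs_of_nonneg (by linarith)]
    exact mul_le_of_le_one_left (by positivity) (by linarith)
  · rw [abs_div, abs_of_pos hP, abs_mul, abs_of_nonneg h0,
      abs_of_nonneg (by linarith : 0 ≤ β * P * D - ⌊β * P * D⌋)]
    refine div_le_div_of_nonneg_right ?_ hP.le
    nlinarith

/-- Equal floors put q/X² and q/X'² within D of each other, which forces the ratio X'/X to be close
to 1. -/
theorem abs_div_sub_one_le_of_floor_eq {q X X' D B : ℝ} (hq : 0 < q) (hX : 0 < X) (hX' : 0 < X')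
    (hD : 0 < D) (hB : X * X' ≤ B) (h : ⌊q / X ^ 2 / D⌋ = ⌊q / X' ^ 2 / D⌋) :
    |X' / X - 1| ≤ D * B / q := by
  have h1 := (Int.abs_sub_lt_one_of_floor_eq_floor h).le
  have e : q / X ^ 2 / D - q / X' ^ 2 / D = (X' / X - 1) * (q * (X' + X) / (D * X * X' ^ 2)) := by
    field_simp
    ring
  rw [e, abs_mul, abs_of_pos (by positivity : 0 < q * (X' + X) / (D * X * X' ^ 2))] at h1
  have h2 : q / (D * B) ≤ q * (X' + X) / (D * X * X' ^ 2) := by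
    have hB0 : 0 < B := lt_of_lt_of_le (by positivity) hB
    rw [div_le_div_iff₀ (by positivity) (by positivity)]
    have h3 : X * X' ^ 2 ≤ (X' + X) * B := by nlinarith [mul_pos hX hX']
    have := mul_le_mul_of_nonneg_left h3 (mul_pos hq hD).le
    nlinarith
  have hB0 : 0 < B := lt_of_lt_of_le (by positivity) hB
  have h4 := (mul_le_mul_of_nonneg_left h2 (abs_nonneg (X' / X - 1))).trans h1
  rw [le_div_iff₀ hq]
  rw [← mul_div_assoc, div_le_one (by positivity)] at h4
  exact h4

theorem floor_eq_of_emod_eq {P a b : ℤ} {ε ε' : ℤ} (hε : ε = 1 ∨ ε = -1) (hε' : ε' = 1 ∨ ε' = -1)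
    (ha : 0 ≤ a) (hb : 0 ≤ b) (haP : 2 * a < P) (hbP : 2 * b < P) (h : ε * a % P = ε' * b % P) :
    a = b := by
  have h1 : P ∣ ε * a - ε' * b := Int.ModEq.dvd (show ε' * b ≡ ε * a [ZMOD P] from h.symm)
  have h2 : ε * a - ε' * b = 0 := by
    refine Int.eq_zero_of_abs_lt_dvd h1 ?_
    rw [abs_lt]
    rcases hε with rfl | rfl <;> rcases hε' with rfl | rfl <;> constructor <;> linarith
  rcases hε with rfl | rfl <;> rcases hε' with rfl | rfl <;> linarith

end

-- The word sought is u, then ones, then 1 g̃, f, j, with g and j of level S = 2^n and f of level S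
-- H. Its denominator is of order √q, so it suffices that q times its value at 1/2 lies close enough
-- to an integer. With f fixed by `ConformalMass.exists_suffix`, this phase is approximately z g ·
-- ζ^(N g · B j), and `exists_phase_near_one` applies.
set_option maxHeartbeats 1600000 in
theorem exists_zaremba_extension :
    ∃ K : ℝ, 1 ≤ K ∧ ∀ (q : ℕ) (u : List ℕ), 1 ≤ q → PosWord u → K * cden u ≤ Real.sqrt q →
      ∃ w, IsWord 2 w ∧ Real.sqrt q ≤ cden (u ++ w) ∧
        ∃ (a : ℤ) (y : ℝ), 0 < y ∧ y < 1 ∧ (a : ℝ) / q = cfEval (u ++ w) y := by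
  obtain ⟨m, hm⟩ := exists_conformalMass (M := 2) (by norm_num)
  obtain ⟨h, hh⟩ : ∃ h : ℕ, h = 60 := ⟨_, rfl⟩
  set w := hausdorffDimBounded 2 with hw
  -- The level makes P ε₁ ε₂ < 1/(2K)² for P = S² H², K = 2^47, ε₁ = 4 · (216 · 10368)(2n + 1) E and
  -- ε₂ = 4E. The number H = 2^60 only has to exceed the absolute constants below; n is chosen after
  -- it.
  obtain ⟨n, hn⟩ := exists_level (16 * (216 * 10368) * (2 ^ h) ^ 2) half_lt_hausdorffDimBounded_two
    (show (0 : ℝ) < 1 / (2 * 2 ^ 47) ^ 2 by positivity)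
  rw [← hw] at hn
  set S : ℝ := 2 ^ n with hS
  have hS1 : 1 ≤ S := one_le_pow₀ (by norm_num)
  set E : ℝ := S ^ (-(2 * w)) with hE
  have hE0 : 0 < E := by positivity
  set H : ℝ := 2 ^ h with hH
  have hH60 : H = 2 ^ 60 := by rw [hH, hh]
  have hSH : (2 : ℝ) ^ (n + h) = S * H := pow_add _ _ _
  have hH1 : 2 ^ 60 ≤ H := hH60.ge
  have hH0 : 0 < H := by positivity
  clear_value H
  clear hh
  refine ⟨S ^ 3 * H, by nlinarith [one_le_pow₀ hS1 (n := 3)], fun q u hq hu hKu => ?_⟩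
  have hq0 : (0 : ℝ) < q := by exact_mod_cast hq
  have hsq : Real.sqrt q ^ 2 = q := Real.sq_sqrt hq0.le
  have hsq0 : 0 < Real.sqrt q := Real.sqrt_pos.2 hq0
  -- Padding by ones brings V S³ H between √q and 2√q, where V = q(v); the words g, f, j contribute
  -- denominators of order S, S H and S.
  obtain ⟨k, hk1, hk2⟩ := exists_append_ones hu (R := Real.sqrt q / (S ^ 3 * H))
    (by rw [le_div_iff₀ (by positivity)]; linarith)
  set v := u ++ List.replicate k 1 with hv
  have hvp : PosWord v := posWord_append.2 ⟨hu, (isWord_replicate_one le_rfl k).pos⟩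
  set V : ℝ := ((cden v : ℕ) : ℝ) with hV
  have hV1 : 1 ≤ V := hvp.one_le_cden_real
  rw [div_le_iff₀ (by positivity)] at hk1
  rw [← mul_div_assoc, lt_div_iff₀ (by positivity)] at hk2
  have hqle : (q : ℝ) ≤ (V * S) ^ 2 * (S ^ 4 * H ^ 2) := by
    rw [← hsq]
    calc _ ≤ (V * (S ^ 3 * H)) ^ 2 := pow_le_pow_left₀ hsq0.le hk1 2
      _ = _ := by ring
  have hqge : (V * S) ^ 2 * (S ^ 4 * H ^ 2) ≤ 4 * q := by
    rw [← hsq]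
    calc _ = (V * (S ^ 3 * H)) ^ 2 := by ring
      _ ≤ (2 * Real.sqrt q) ^ 2 := pow_le_pow_left₀ (by positivity) hk2.le 2
      _ = _ := by ring
  have hone : IsWord 2 [1] := by simp [IsWord]
  set G := stopWords n with hG
  set F := stopWords (n + h) with hF
  have hGw : ∀ g ∈ G, IsWord 2 g := fun g hg => (mem_stopWords.1 hg).1
  have hFw : ∀ f ∈ F, IsWord 2 f := fun f hf => (mem_stopWords.1 hf).1
  set U : List ℕ → List ℕ := fun g => v ++ (g ++ [1]).reverse with hU
  have hg1 : ∀ g ∈ G, IsWord 2 (g ++ [1]) := fun g hg => isWord_append.2 ⟨hGw g hg, hone⟩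
  have hUp : ∀ g ∈ G, PosWord (U g) := fun g hg =>
    posWord_append.2 ⟨hvp, posWord_reverse.2 (hg1 g hg).pos⟩
  have hUge : ∀ g ∈ G, V * S ≤ cden (U g) := by
    intro g hg
    have h1 := cden_mul_le v (g ++ [1]).reverse
    rw [cden_reverse] at h1
    have h2 := cden_le_of_prefix (hg1 g hg).pos (List.prefix_append g [1])
    have h3 : V * cden g ≤ cden (U g) := by
      rw [hV, hU]
      exact_mod_cast (Nat.mul_le_mul_left (cden v) h2).trans h1
    exact (mul_le_mul_of_nonneg_left (mem_stopWords.1 hg).2.2.1 (by linarith)).trans h3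
  have hUle : ∀ g ∈ G, (cden (U g) : ℝ) ≤ 12 * (V * S) := by
    intro g hg
    have h1 := cden_append_le hvp (posWord_reverse.2 (hg1 g hg).pos)
    rw [cden_reverse] at h1
    have h2 := cden_snoc_le (hGw g hg).pos 1
    have h3 : (cden (U g) : ℝ) ≤ 2 * (V * ((1 + 1) * cden g)) := by
      rw [hV, hU]
      exact_mod_cast h1.trans (Nat.mul_le_mul_left 2 (Nat.mul_le_mul_left (cden v) h2))
    have h4 := mul_le_mul_of_nonneg_left (cden_le_of_mem_stopWords hg) (by linarith : 0 ≤ V)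
    linarith
  have hVS : 0 < V * S := by positivity
  -- The mesh for s g = q/X². It is fine enough that equal floors force the ratio of the X to be
  -- within S⁻² of 1, and coarse enough that the floors stay below P/2.
  set D : ℝ := S ^ 2 * H with hD
  have hD0 : 0 < D := by positivity
  clear_value S D
  set X : List ℕ → List ℕ → ℝ := fun f g => (cden (U g) : ℝ) + cden' (U g) * cfEval f 0 with hX
  have hXge : ∀ f, ∀ g ∈ G, V * S ≤ X f g := fun f g hg =>
    (hUge g hg).trans (cfEval_den_ge _ (cfEval_nonneg f le_rfl))
  have hXle : ∀ f ∈ F, ∀ g ∈ G, X f g ≤ 24 * (V * S) := by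
    intro f hf g hg
    have := (hUp g hg).eval_den_le (cfEval_nonneg f le_rfl)
      ((hFw f hf).pos.eval_le_one le_rfl (zero_le_one (α := ℝ)))
    exact this.trans (by linarith [hUle g hg])
  obtain ⟨f, hf, hcoll⟩ := hm.exists_suffix (n := n) (h := h) hvp
    (fun f g g' => ⌊q / X f g ^ 2 / D⌋ = ⌊q / X f g' ^ 2 / D⌋) (by
      intro f hf g hg g' hg' hc
      have hx := hVS.trans_le (hXge f g hg)
      have hx' := hVS.trans_le (hXge f g' hg')
      have hB : X f g * X f g' ≤ 576 * (V * S) ^ 2 :=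
        (mul_le_mul (hXle f hf g hg) (hXle f hf g' hg') hx'.le (by positivity)).trans_eq (by ring)
      refine (abs_div_sub_one_le_of_floor_eq hq0 hx hx' hD0 hB hc).trans ?_
      rw [← hS, div_le_iff₀ hq0, ← div_eq_inv_mul, le_div_iff₀ (by positivity), hD]
      nlinarith) (by
      intro g hg g' hg'
      linarith [hUle g hg, hUge g' hg'])
  classical
  replace hcoll := @hcoll (fun g g' => inferInstance)
  rw [← hw, ← hS, ← hE] at hcoll
  have hfQ : S * H ≤ cden f := by
    rw [← hSH]; exact (mem_stopWords.1 hf).2.2.1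
  have hfQ' : (cden f : ℝ) ≤ 3 * (S * H) := by
    rw [← hSH]; exact cden_le_of_mem_stopWords hf
  set y : ℝ := cfEval f 0 with hy
  have hy0 : 0 ≤ y := cfEval_nonneg f le_rfl
  set Y : List ℕ → ℝ := fun j => cfEval f (cfEval j (1 / 2)) with hY
  have hjc : ∀ j ∈ G, (0 : ℝ) ≤ cfEval j (1 / 2) ∧ cfEval j (1 / 2 : ℝ) ≤ 1 := fun j hj =>
    ⟨cfEval_nonneg _ (by norm_num), (hGw j hj).pos.eval_le_one (by norm_num) (by norm_num)⟩
  have hY0 : ∀ j ∈ G, 0 ≤ Y j := fun j hj => cfEval_nonneg _ (hjc j hj).1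
  have hβ : ∀ j ∈ G, |Y j - y| ≤ 1 / (S ^ 2 * H ^ 2) := by
    intro j hj
    refine ((hFw f hf).pos.abs_eval_sub_le (hjc j hj).1 le_rfl).trans ?_
    rw [sub_zero, abs_of_nonneg (hjc j hj).1]
    calc _ ≤ 1 / (S * H) ^ 2 := by
          gcongr
          exact (hjc j hj).2
      _ = _ := by ring
  obtain ⟨P, hP⟩ : ∃ P : ℕ, P = (2 ^ n) ^ 2 * (2 ^ h) ^ 2 := ⟨_, rfl⟩
  have hPr : (P : ℝ) = S ^ 2 * H ^ 2 := by
    rw [hP, hS, hH]; push_cast; rfl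
  have hP0 : 0 < P := by rw [hP]; positivity
  set s : List ℕ → ℝ := fun g => q / X f g ^ 2 with hs
  have hs0 : ∀ g ∈ G, 0 ≤ s g := fun g hg => by positivity
  have hsle : ∀ g ∈ G, s g ≤ S ^ 4 * H ^ 2 := by
    intro g hg
    rw [hs, div_le_iff₀ (pow_pos (hVS.trans_le (hXge f g hg)) 2)]
    have := pow_le_pow_left₀ hVS.le (hXge f g hg) 2
    nlinarith [mul_le_mul_of_nonneg_left this (show 0 ≤ S ^ 4 * H ^ 2 by positivity)]
  set B : List ℕ → ℤ := fun j => ⌊(Y j - y) * P * D⌋ with hB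
  -- The sign of the derivative of the Möbius map of U g is (-1)^|U g|.
  set N : List ℕ → ℤ := fun g => (-1) ^ (U g).length * ⌊s g / D⌋ with hN
  have hfloor0 : ∀ g ∈ G, 0 ≤ ⌊s g / D⌋ := fun g hg =>
    Int.floor_nonneg.2 (div_nonneg (hs0 g hg) hD0.le)
  have hfloor : ∀ g ∈ G, 2 * ⌊s g / D⌋ < P := by
    intro g hg
    have h1 : s g / D ≤ S ^ 2 * H := by
      rw [div_le_iff₀ hD0, hD]
      exact (hsle g hg).trans_eq (by ring)
    have h2 : (2 * ⌊s g / D⌋ : ℝ) < P := by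
      rw [hPr]
      have h2 := Int.floor_le (s g / D)
      have h3 : S ^ 2 * H * 2 < S ^ 2 * H * H :=
        mul_lt_mul_of_pos_left (by linarith) (by positivity)
      calc _ ≤ S ^ 2 * H * 2 := by linarith
        _ < _ := h3
        _ = _ := by ring
    exact_mod_cast h2
  set ζ : ℂ := Complex.exp (2 * Real.pi * Complex.I / P) with hζ
  have hζP : IsPrimitiveRoot ζ P := Complex.isPrimitiveRoot_exp P hP0.ne'
  set z : List ℕ → ℂ := fun g =>
    Complex.exp (2 * Real.pi * Complex.I * ((q * cfEval (U g) y : ℝ) : ℂ)) with hz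
  have hz1 : ∀ g, ‖z g‖ = 1 := by
    intro g
    have : (2 * Real.pi * Complex.I * ((q * cfEval (U g) y : ℝ) : ℂ) : ℂ) =
        ((2 * Real.pi * (q * cfEval (U g) y) : ℝ) : ℂ) * Complex.I := by push_cast; ring
    rw [hz]
    simp only [this]
    exact Complex.norm_exp_ofReal_mul_I _
  -- With δ = 2^(-22) one has 8/δ² = 2^47.
  obtain ⟨K, hK⟩ : ∃ K : ℕ, K = 2 ^ 47 := ⟨_, rfl⟩
  have hK' : (K : ℝ) = 2 ^ 47 := by rw [hK, Nat.cast_pow, Nat.cast_ofNat]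
  obtain ⟨g, hg, j, hj, hgj⟩ := exists_phase_near_one (G := G) (J := G) (a := m) (b := m)
    (fun g hg => (hm.pos (hGw g hg)).le) (hm.sum_stopWords n)
    (fun g hg => (hm.pos (hGw g hg)).le) (hm.sum_stopWords n) (N := N) (B := B) hP0 hζP hz1
    (K := K) (δ := 1 / 2 ^ 22) (ε₁ := (4 * (216 * 10368)) * (2 * n + 1) * E) (ε₂ := 4 * E)
    (by norm_num) (by rw [hK]; norm_num) (by
      refine le_trans ?_ hcoll
      refine Finset.sum_le_sum fun g hg => ?_
      refine Finset.sum_le_sum_of_subset_of_nonneg ?_ fun g' hg' _ =>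
        mul_nonneg (hm.pos (hGw g hg)).le (hm.pos (hGw g' (Finset.mem_filter.1 hg').1)).le
      intro g' hg'
      obtain ⟨h1, h2⟩ := Finset.mem_filter.1 hg'
      exact Finset.mem_filter.2 ⟨h1, floor_eq_of_emod_eq (neg_one_pow_eq_or ℤ _)
        (neg_one_pow_eq_or ℤ _) (hfloor0 g hg) (hfloor0 g' h1) (hfloor g hg) (hfloor g' h1) h2⟩)
    (fun j hj => hm.le_of_le_cden (hGw j hj) (by positivity) (hS ▸ (mem_stopWords.1 hj).2.2.1)) (by
      intro j hj j' hj' hne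
      have hPD : (P : ℝ) * D = S ^ 4 * H ^ 3 := by rw [hPr, hD]; ring
      constructor
      -- Distinct j have well separated Y j, and rescaling by P D = S⁴ H³ pushes them at least
      -- H/2592 > 1 apart, so the integers B j differ.
      · intro heq
        have h1 := Int.abs_sub_lt_one_of_floor_eq_floor heq
        have h2 : (Y j - y) * P * D - (Y j' - y) * P * D = (Y j - Y j') * (S ^ 4 * H ^ 3) := by
          rw [← hPD]; ring
        rw [h2, abs_mul, abs_of_pos (by positivity : 0 < S ^ 4 * H ^ 3)] at h1
        have h3 := (hFw f hf).pos.le_abs_eval_sub (hjc j hj).1 (hjc j hj).2 (hjc j' hj').1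
          (hjc j' hj').2
        have h4 := stopWords_center_sep hj hj' hne
        rw [← hS] at h4
        have h5 : 1 / (72 * S ^ 2) / (4 * (3 * (S * H)) ^ 2) ≤ |Y j - Y j'| := by
          refine le_trans ?_ h3
          have : (0 : ℝ) < cden f := lt_of_lt_of_le (by positivity) hfQ
          gcongr
        have h6 := mul_le_mul_of_nonneg_right h5 (by positivity : 0 ≤ S ^ 4 * H ^ 3)
        have h7 : 1 / (72 * S ^ 2) / (4 * (3 * (S * H)) ^ 2) * (S ^ 4 * H ^ 3) =
            H / 2592 := by
          field_simp
          norm_num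
        rw [h7] at h6
        linarith
      · have hb : ∀ j ∈ G, |(Y j - y) * P * D| ≤ S ^ 2 * H := by
          intro j hj
          rw [mul_assoc, hPD, abs_mul, abs_of_pos (by positivity : 0 < S ^ 4 * H ^ 3)]
          refine (mul_le_mul_of_nonneg_right (hβ j hj) (by positivity)).trans_eq ?_
          field_simp
        have h1 := abs_le.1 (hb j hj)
        have h2 := abs_le.1 (hb j' hj')
        have f1 := Int.floor_le ((Y j - y) * P * D)
        have f2 := Int.lt_floor_add_one ((Y j - y) * P * D)
        have f3 := Int.floor_le ((Y j' - y) * P * D)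
        have f4 := Int.lt_floor_add_one ((Y j' - y) * P * D)
        have h3 : |(B j - B j' : ℝ)| ≤ 3 * (S ^ 2 * H) := by
          have h1S : 1 ≤ S ^ 2 * H := one_le_mul_of_one_le_of_one_le (one_le_pow₀ hS1) (by linarith)
          rw [abs_le]
          simp only [hB]
          constructor <;> linarith
        have h4 : (K : ℝ) * |(B j - B j' : ℝ)| < P := by
          rw [hPr, hK']
          have h5 : 2 ^ 47 * 3 * (S ^ 2 * H) < H * (S ^ 2 * H) :=
            mul_lt_mul_of_pos_right (by linarith) (by positivity)
          calc _ ≤ (2 : ℝ) ^ 47 * (3 * (S ^ 2 * H)) := mul_le_mul_of_nonneg_left h3 (by positivity)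
            _ = 2 ^ 47 * 3 * (S ^ 2 * H) := by ring
            _ < H * (S ^ 2 * H) := h5
            _ = S ^ 2 * H ^ 2 := by ring
        exact_mod_cast h4)
    (by
      rw [hPr, hK']
      refine lt_of_eq_of_lt ?_ hn
      ring)
  set τ : ℝ := q * cfEval (U g) y + (N g * B j : ℝ) / P with hτ
  have hphase : z g * ζ ^ (N g * B j) = Complex.exp (2 * Real.pi * Complex.I * τ) := by
    rw [hz, hζ, ← Complex.exp_int_mul, ← Complex.exp_add, hτ]
    congr 1
    push_cast
    ring
  rw [hphase] at hgj
  obtain ⟨a, ha⟩ := exists_int_near_of_norm_exp_sub_one hgj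
  have hWp := (hGw j hj).pos
  have hfj : PosWord (f ++ j) := posWord_append.2 ⟨(hFw f hf).pos, hWp⟩
  have hx := hVS.trans_le (hXge f g hg)
  have heval : cfEval (U g ++ (f ++ j)) (1 / 2 : ℝ) = cfEval (U g) (Y j) := by
    rw [cfEval_append _ hfj (by norm_num), cfEval_append f hWp (by norm_num)]
  -- Three errors of at most 1/H each: the quadratic Taylor term, the rounding of s g, and the
  -- rounding of Y j - y.
  have hlin : |q * cfEval (U g) (Y j) - τ| ≤ 3 / H := by
    have h1 := (hUp g hg).abs_eval_add_sub_le hy0 (hY0 j hj)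
    have h2 := abs_mul_sub_floor_mul_floor_le (β := Y j - y) (hs0 g hg) hD0
      (show (0 : ℝ) < P by exact_mod_cast hP0)
    set ε : ℝ := (-1) ^ (U g).length with hε
    have hε1 : |ε| = 1 := by rw [hε, abs_pow, abs_neg, abs_one, one_pow]
    have e : q * cfEval (U g) (Y j) - τ =
        q * (cfEval (U g) (Y j) - cfEval (U g) y - ε * ((Y j - y) / X f g ^ 2)) +
          ε * (s g * (Y j - y) - (⌊s g / D⌋ * ⌊(Y j - y) * P * D⌋ : ℝ) / P) := by
      rw [hτ, hN, hB, hs]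
      push_cast
      rw [← hε]
      ring
    rw [e]
    refine (abs_add_le _ _).trans ?_
    rw [abs_mul, abs_mul, hε1, one_mul, abs_of_pos hq0]
    have b1 : q * |cfEval (U g) (Y j) - cfEval (U g) y - ε * ((Y j - y) / X f g ^ 2)| ≤
        1 / H := by
      calc _ ≤ q * ((Y j - y) ^ 2 / X f g ^ 2) := mul_le_mul_of_nonneg_left h1 hq0.le
        _ = s g * |Y j - y| ^ 2 := by rw [hs, sq_abs]; ring
        _ ≤ (S ^ 4 * H ^ 2) * (1 / (S ^ 2 * H ^ 2)) ^ 2 := by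
          gcongr
          · exact hsle g hg
          · exact hβ j hj
        _ = 1 / H ^ 2 := by field_simp
        _ ≤ _ := one_div_le_one_div_of_le hH0 (by nlinarith)
    have b2 : s g / D / P ≤ 1 / H := by
      calc _ ≤ (S ^ 4 * H ^ 2) / D / P := by
            gcongr
            exact hsle g hg
        _ = 1 / H := by rw [hPr, hD]; field_simp
    have b3 : |Y j - y| * D ≤ 1 / H := by
      calc _ ≤ 1 / (S ^ 2 * H ^ 2) * D := by
            gcongr
            exact hβ j hj
        _ = _ := by rw [hD]; field_simp
    calc _ ≤ 1 / H + (s g / D / P + |Y j - y| * D) := add_le_add b1 h2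
      _ ≤ 1 / H + (1 / H + 1 / H) := by gcongr
      _ = _ := by ring
  have hjQ := (mem_stopWords.1 hj).2.2.1
  have hjQ' := cden_le_of_mem_stopWords hj
  rw [← hS] at hjQ hjQ'
  have hWle : (cden (U g ++ (f ++ j)) : ℝ) ≤ 864 * Real.sqrt q := by
    have h1 := cden_append_le (hUp g hg) hfj
    have h2 := cden_append_le (hFw f hf).pos hWp
    have h3 : (cden (U g ++ (f ++ j)) : ℝ) ≤ 2 * (cden (U g) * (2 * (cden f * cden j))) := by
      exact_mod_cast h1.trans (Nat.mul_le_mul_left 2 (Nat.mul_le_mul_left (cden (U g)) h2))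
    calc _ ≤ _ := h3
      _ ≤ 2 * (12 * (V * S) * (2 * (3 * (S * H) * (3 * S)))) := by
        gcongr
        exact hUle g hg
      _ = 432 * (V * (S ^ 3 * H)) := by ring
      _ ≤ _ := by linarith
  have hWge : Real.sqrt q ≤ cden (U g ++ (f ++ j)) := by
    have h1 := cden_mul_le (U g) (f ++ j)
    have h2 := cden_mul_le f j
    have h3 : (cden (U g) * (cden f * cden j) : ℝ) ≤ cden (U g ++ (f ++ j)) := by
      exact_mod_cast (Nat.mul_le_mul_left (cden (U g)) h2).trans h1
    calc _ ≤ V * (S ^ 3 * H) := hk1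
      _ = V * S * (S * H * S) := by ring
      _ ≤ cden (U g) * (cden f * cden j) := by
        gcongr
        exact hUge g hg
      _ ≤ _ := h3
  have hWpos : PosWord (U g ++ (f ++ j)) := posWord_append.2 ⟨hUp g hg, hfj⟩
  -- The distance to an integer is at most 3/H + 2^(-24) ≤ 2^(-23), and the denominator is at most
  -- 864 √q. The centre criterion therefore needs 8 · 864² < 2^23.
  obtain ⟨x, hx0, hx1, hxe⟩ := mem_image_of_near_half hWpos (x := (a : ℝ) / q) (by
    rw [heval, show (a : ℝ) / q - cfEval (U g) (Y j) = -((q * cfEval (U g) (Y j) - a) / q) by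
      field_simp; ring, abs_neg, abs_div, abs_of_pos hq0, div_lt_div_iff₀ hq0
        (by have := hWpos.one_le_cden_real; positivity)]
    have h1 : |q * cfEval (U g) (Y j) - a| ≤ 1 / 2 ^ 23 := by
      have : q * cfEval (U g) (Y j) - a = (q * cfEval (U g) (Y j) - τ) + (τ - a) := by ring
      rw [this]
      refine (abs_add_le _ _).trans ((add_le_add hlin ha).trans (by rw [hH60]; norm_num))
    have h2 : (cden (U g ++ (f ++ j)) : ℝ) ^ 2 ≤ 864 ^ 2 * q := by
      refine (pow_le_pow_left₀ (Nat.cast_nonneg _) hWle 2).trans_eq ?_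
      rw [mul_pow, hsq]
    calc _ ≤ 1 / 2 ^ 23 * (8 * (864 ^ 2 * (q : ℝ))) := by gcongr
      _ < 1 * (q : ℝ) := by
        rw [← mul_assoc, ← mul_assoc]
        exact mul_lt_mul_of_pos_right (by norm_num) hq0)
  refine ⟨List.replicate k 1 ++ ((g ++ [1]).reverse ++ (f ++ j)), ?_, ?_, a, x, hx0, hx1, ?_⟩
  · exact isWord_append.2 ⟨isWord_replicate_one (by norm_num) k, isWord_append.2
      ⟨isWord_reverse.2 (hg1 g hg), isWord_append.2 ⟨hFw f hf, hGw j hj⟩⟩⟩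
  · simpa [hU, hv] using hWge
  · rw [hxe]
    simp [hU, hv]

/-! ### Residues in real intervals and the upper bound. -/

theorem card_le_of_abs_sub_le {ι : Type*} {s : Finset ι} {f : ι → ℕ} (hf : Set.InjOn f s) {B : ℝ}
    (hB : 0 ≤ B) (h : ∀ a ∈ s, ∀ b ∈ s, |(f a : ℝ) - f b| ≤ B) : s.card ≤ ⌊B⌋₊ + 1 := by
  rcases s.eq_empty_or_nonempty with rfl | hne
  · simp
  obtain ⟨a, ha, hmin⟩ := s.exists_min_image f hne
  have hsub : ∀ b ∈ s, f b ∈ Finset.Icc (f a) (f a + ⌊B⌋₊) := by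
    intro b hb
    refine Finset.mem_Icc.2 ⟨hmin b hb, ?_⟩
    have h1 := (le_abs_self _).trans (h b hb a ha)
    have h2 := hmin b hb
    have h3 : ((f b - f a : ℕ) : ℝ) ≤ B := by rwa [Nat.cast_sub h2]
    have := Nat.le_floor h3
    omega
  have := Finset.card_le_card_of_injOn f hsub hf
  rw [Nat.card_Icc] at this
  omega

theorem le_card_of_forall_mem {q : ℕ} [NeZero q] {A : Finset (ZMod q)} {α β : ℝ} (hα : 0 ≤ α)
    (hβ : β ≤ 1)
    (hA : ∀ b : ℕ, b < q → α < (b : ℝ) / q → (b : ℝ) / q < β → (b : ZMod q) ∈ A) :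
    q * (β - α) - 1 ≤ A.card := by
  have hq : (0 : ℝ) < q := by exact_mod_cast Nat.pos_of_neZero q
  have hlt : ∀ b ∈ Finset.Ioo ⌊q * α⌋₊ ⌈q * β⌉₊, b < q ∧ α < (b : ℝ) / q ∧ (b : ℝ) / q < β := by
    intro b hb
    obtain ⟨h1, h2⟩ := Finset.mem_Ioo.1 hb
    have h3 := (Nat.floor_lt (by positivity)).1 h1
    have h4 := Nat.lt_ceil.1 h2
    refine ⟨?_, (lt_div_iff₀' hq).2 h3, (div_lt_iff₀' hq).2 h4⟩
    have : (b : ℝ) < q := h4.trans_le (by nlinarith)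
    exact_mod_cast this
  have hcard : (Finset.Ioo ⌊q * α⌋₊ ⌈q * β⌉₊).card ≤ A.card := by
    refine Finset.card_le_card_of_injOn (fun b : ℕ => (b : ZMod q))
      (fun b hb => hA b (hlt b hb).1 (hlt b hb).2.1 (hlt b hb).2.2) ?_
    intro b hb b' hb' h
    have := congrArg ZMod.val h
    simpa [ZMod.val_natCast_of_lt (hlt b hb).1, ZMod.val_natCast_of_lt (hlt b' hb').1] using this
  rw [Nat.card_Ioo] at hcard
  have h1 : ⌈q * β⌉₊ ≤ A.card + ⌊q * α⌋₊ + 1 := by omega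
  have h2 : (⌈q * β⌉₊ : ℝ) ≤ A.card + ⌊q * α⌋₊ + 1 := by exact_mod_cast h1
  have h3 := Nat.le_ceil (q * β)
  have h4 := Nat.floor_le (show 0 ≤ q * α by positivity)
  linarith

theorem ncard_residueArc {q : ℕ} (x : ZMod q) {L : ℕ} (hL : L ≤ q) :
    (residueArc x L).ncard = L := by
  have h : residueArc x L = ↑((Finset.range L).image fun i : ℕ => x + (i : ZMod q)) := by
    ext y
    simp [residueArc, eq_comm]
  rw [h, Set.ncard_coe_finset, Finset.card_image_of_injOn, Finset.card_range]
  intro i hi j hj hij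
  have h1 : (i : ZMod q) = j := add_left_cancel hij
  have hi := Finset.mem_range.1 hi
  have hj := Finset.mem_range.1 hj
  have := congrArg ZMod.val h1
  rwa [ZMod.val_natCast_of_lt (by omega), ZMod.val_natCast_of_lt (by omega)] at this

/-- An arc may wrap around 0, so it corresponds to two real intervals of length L/q. -/
theorem val_mem_of_mem_residueArc {q : ℕ} [NeZero q] {x a : ZMod q} {L : ℕ} (hL : L ≤ q)
    (ha : a ∈ residueArc x L) :
    (a.val : ℝ) / q ∈ Set.Icc ((x.val : ℝ) / q) (x.val / q + L / q) ∨
      (a.val : ℝ) / q ∈ Set.Icc ((x.val : ℝ) / q - 1) (x.val / q - 1 + L / q) := by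
  obtain ⟨i, hi, rfl⟩ := ha
  have hq : (0 : ℝ) < q := by exact_mod_cast Nat.pos_of_neZero q
  have hiv : (i : ZMod q).val = i := ZMod.val_natCast_of_lt (by omega)
  have hiL : (i : ℝ) ≤ L := by exact_mod_cast hi.le
  have h0 : (0 : ℝ) ≤ i / q := by positivity
  have h1 : (i : ℝ) / q ≤ L / q := by gcongr
  rcases lt_or_ge (x.val + (i : ZMod q).val) q with h | h
  · left
    rw [ZMod.val_add_of_lt h, hiv]
    push_cast
    rw [add_div]
    constructor <;> linarith
  · right
    have h2 := ZMod.val_add_val_of_le h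
    rw [hiv] at h2
    have h3 : ((x + (i : ZMod q)).val : ℝ) = x.val + i - q := by
      have : (x.val + i : ℝ) = (x + (i : ZMod q)).val + q := by exact_mod_cast h2
      linarith
    rw [h3, sub_div, add_div, div_self hq.ne']
    constructor <;> linarith

/-- Elements of `Z_M(t)` in a real interval of length `1 / T²` with `1 ≤ T ≤ t`. -/
theorem ncard_zarembaSet_le_of_length {M q : ℕ} [NeZero q] (hM : 1 ≤ M) {t T α β : ℝ} (hT : 1 ≤ T)
    (hTt : T ≤ t) (htq : t ≤ Real.sqrt q) (hαβ : α ≤ β) (hlen : β - α ≤ 1 / T ^ 2) :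
    ({a ∈ zarembaSet q M t | (a.val : ℝ) / q ∈ Set.Icc α β}.ncard : ℝ) ≤
      768 * (M + 1) ^ 4 * (q / t ^ 2) * (t / T) ^ (2 * hausdorffDimBounded M) := by
  classical
  obtain ⟨m, hm⟩ := exists_conformalMass hM
  set w := hausdorffDimBounded M with hw
  have hw0 : 0 ≤ w := hausdorffDimBounded_nonneg M
  have hw1 : w ≤ 1 := hausdorffDimBounded_le_one M
  have ht : 1 ≤ t := hT.trans hTt
  have hq : (0 : ℝ) < q := by exact_mod_cast Nat.pos_of_neZero q
  set A : Finset (ZMod q) := Finset.univ.filter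
    fun a => a ∈ zarembaSet q M t ∧ (a.val : ℝ) / q ∈ Set.Icc α β with hA
  have hAn : {a ∈ zarembaSet q M t | (a.val : ℝ) / q ∈ Set.Icc α β}.ncard = A.card := by
    rw [← Set.ncard_coe_finset, hA]
    congr 1
    ext a
    simp
  rw [hAn]
  have hex : ∀ a, ∃ u z, a ∈ A → IsWord M u ∧ IsStop t u ∧ 0 ≤ z ∧ z < 1 ∧
      (a.val : ℝ) / q = cfEval u z := by
    intro a
    by_cases ha : a ∈ A
    · obtain ⟨u, z, h1, h2, h3, h4⟩ :=
        exists_stopWord_of_mem_zarembaSet (Finset.mem_filter.1 ha).2.1 le_rfl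
      exact ⟨u, z, fun _ => ⟨h1, ⟨h2, h3⟩, h4⟩⟩
    · exact ⟨[], 0, fun h => absurd h ha⟩
  choose u z huz using hex
  set S := A.image u with hS
  have hSw : ∀ v ∈ S, IsWord M v ∧ IsStop t v := by
    intro v hv
    obtain ⟨a, ha, rfl⟩ := Finset.mem_image.1 hv
    exact ⟨(huz a ha).1, (huz a ha).2.1⟩
  have hSi : IsIncomparable S := fun v hv v' hv' h =>
    (hSw v hv).2.eq_of_prefix (hSw v' hv').2 (hSw v' hv').1.pos h
  have hsum := hm.sum_le_of_meets (S := S) (T := T) hSi (fun v hv => (hSw v hv).1) hT hαβ hlen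
    (fun v hv => hTt.trans (hSw v hv).2.1) (by
      intro v hv
      obtain ⟨a, ha, rfl⟩ := Finset.mem_image.1 hv
      obtain ⟨-, -, h1, h2, h3⟩ := huz a ha
      exact ⟨z a, ⟨h1, h2.le⟩, h3 ▸ (Finset.mem_filter.1 ha).2.2⟩)
  -- Stopped words have denominator at most (M + 1) t, hence mass bounded below; comparison with the
  -- total mass bounds their number.
  have hlow : (S.card : ℝ) * (((M + 1) * t) ^ (-(2 * w)) / 16) ≤ ∑ v ∈ S, m v := by
    rw [← nsmul_eq_mul]
    refine Finset.card_nsmul_le_sum _ _ _ fun v hv => ?_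
    exact hm.ge_of_cden_le (hSw v hv).1 ((hSw v hv).2.cden_le ht (hSw v hv).1)
  have hM1 : (1 : ℝ) ≤ M + 1 := by linarith [Nat.cast_nonneg (α := ℝ) M]
  have hT0 : 0 < T := by linarith
  have ht0 : 0 < t := by linarith
  have hScard : (S.card : ℝ) ≤ 384 * (M + 1) ^ 4 * (t / T) ^ (2 * w) := by
    have h1 := hlow.trans hsum
    have h2 : (S.card : ℝ) ≤ 384 * (M + 1) ^ 2 * ((((M + 1) * t) ^ (2 * w)) * T ^ (-(2 * w))) := by
      have hx : 0 < ((M + 1) * t) ^ (2 * w) := by positivity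
      rw [Real.rpow_neg (by positivity)] at h1
      have h3 := mul_le_mul_of_nonneg_right h1 hx.le
      have e : (S.card : ℝ) * ((((M + 1) * t) ^ (2 * w))⁻¹ / 16) * ((M + 1) * t) ^ (2 * w) =
          S.card / 16 := by field_simp
      rw [e] at h3
      linarith
    refine h2.trans ?_
    have h4 : ((M + 1 : ℝ)) ^ (2 * w) ≤ (M + 1) ^ 2 := by
      rw [← Real.rpow_two]
      exact Real.rpow_le_rpow_of_exponent_le hM1 (by linarith)
    rw [Real.mul_rpow (by positivity) ht0.le, Real.rpow_neg hT0.le, Real.div_rpow ht0.le hT0.le,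
      div_eq_mul_inv]
    calc 384 * (M + 1 : ℝ) ^ 2 * ((M + 1) ^ (2 * w) * t ^ (2 * w) * (T ^ (2 * w))⁻¹)
        = 384 * (M + 1 : ℝ) ^ 2 * ((M + 1) ^ (2 * w) * (t ^ (2 * w) * (T ^ (2 * w))⁻¹)) := by ring
      _ ≤ 384 * (M + 1) ^ 2 * ((M + 1) ^ 2 * (t ^ (2 * w) * (T ^ (2 * w))⁻¹)) := by gcongr
      _ = _ := by ring
  have hN1 : 1 ≤ q / t ^ 2 := by
    rw [one_le_div (by positivity)]
    exact (pow_le_pow_left₀ ht0.le htq 2).trans_eq (Real.sq_sqrt hq.le)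
  -- Residues with the same stopped word differ by at most q/t² in their representatives.
  have hfib : A.card ≤ (⌊q / t ^ 2⌋₊ + 1) * S.card := by
    refine Finset.card_le_mul_card_image A _ fun v hv => ?_
    refine card_le_of_abs_sub_le (f := ZMod.val) (ZMod.val_injective q).injOn (by positivity) ?_
    intro a ha b hb
    obtain ⟨haA, hav⟩ := Finset.mem_filter.1 ha
    obtain ⟨hbA, hbv⟩ := Finset.mem_filter.1 hb
    obtain ⟨ha1, ha2, ha3, ha4, ha5⟩ := huz a haA
    obtain ⟨-, -, hb3, hb4, hb5⟩ := huz b hbA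
    rw [hbv, ← hav] at hb5
    have h1 := ha1.pos.abs_eval_sub_le ha3 hb3
    have h2 : |z a - z b| ≤ 1 := abs_le.2 ⟨by linarith, by linarith⟩
    rw [← ha5, ← hb5, ← sub_div, abs_div, abs_of_pos hq, div_le_iff₀ hq] at h1
    refine h1.trans ?_
    rw [div_mul_eq_mul_div]
    gcongr
    · exact mul_le_of_le_one_left hq.le h2
    · exact ha2.1
  have hfl : ((⌊q / t ^ 2⌋₊ + 1 : ℕ) : ℝ) ≤ 2 * (q / t ^ 2) := by
    push_cast
    have := Nat.floor_le (show 0 ≤ q / t ^ 2 by positivity)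
    linarith
  calc (A.card : ℝ) ≤ ((⌊q / t ^ 2⌋₊ + 1 : ℕ) : ℝ) * S.card := by exact_mod_cast hfib
    _ ≤ 2 * (q / t ^ 2) * (384 * (M + 1) ^ 4 * (t / T) ^ (2 * w)) :=
      mul_le_mul hfl hScard (Nat.cast_nonneg _) (by positivity)
    _ = _ := by ring

theorem div_sqrt_rpow_two_mul {x y w : ℝ} (hx : 0 ≤ x) (hy : 0 ≤ y) :
    (x / Real.sqrt y) ^ (2 * w) = (x ^ 2 / y) ^ w := by
  rw [Real.rpow_mul (by positivity), Real.rpow_two, div_pow, Real.sq_sqrt hy]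

theorem mul_div_rpow {L N w : ℝ} (hL : 0 ≤ L) (hN : 0 < N) :
    N * (L / N) ^ w = L ^ w * N ^ (1 - w) := by
  rw [Real.div_rpow hL hN.le, Real.rpow_sub hN, Real.rpow_one]
  ring

theorem ncard_zarembaSet_inter_le {M q : ℕ} {t : ℝ} (hM : 2 ≤ M) (hq : 1 ≤ q) (ht : 1 ≤ t)
    (htq : t ≤ Real.sqrt q) {I : Set (ZMod q)} (hI : IsResidueInterval I) :
    ((zarembaSet q M t ∩ I).ncard : ℝ) ≤ 24576 * (M : ℝ) ^ 4 *
      (I.ncard : ℝ) ^ hausdorffDimBounded M * (q / t ^ 2) ^ (1 - hausdorffDimBounded M) := by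
  have : NeZero q := ⟨by omega⟩
  obtain ⟨x, L, hL, rfl⟩ := hI
  rw [ncard_residueArc x hL]
  set w := hausdorffDimBounded M with hw
  have hw1 : w ≤ 1 := hausdorffDimBounded_le_one M
  have hq0 : (0 : ℝ) < q := by exact_mod_cast hq
  have hM2 : (2 : ℝ) ≤ M := by exact_mod_cast hM
  have hN0 : 0 < q / t ^ 2 := by positivity
  have hM4 : (1 : ℝ) ≤ 24576 * (M : ℝ) ^ 4 := by
    nlinarith [one_le_pow₀ (show (1 : ℝ) ≤ M by linarith) (n := 4)]
  have hle : ((zarembaSet q M t ∩ residueArc x L).ncard : ℝ) ≤ L := by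
    have := Set.ncard_le_ncard (Set.inter_subset_right (s := zarembaSet q M t)
      (t := residueArc x L)) (Set.toFinite _)
    rw [ncard_residueArc x hL] at this
    exact_mod_cast this
  rw [mul_assoc, ← mul_div_rpow (Nat.cast_nonneg L) hN0]
  rcases Nat.eq_zero_or_pos L with rfl | hL0
  · refine hle.trans ?_
    rw [Nat.cast_zero]
    positivity
  have hL0 : (0 : ℝ) < L := by exact_mod_cast hL0
  rcases lt_or_ge (L : ℝ) (q / t ^ 2) with h | h
  · refine hle.trans ((?_ : (L : ℝ) ≤ q / t ^ 2 * (L / (q / t ^ 2)) ^ w).trans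
      (le_mul_of_one_le_left (by positivity) hM4))
    have h1 : L / (q / t ^ 2) ≤ (L / (q / t ^ 2)) ^ w := by
      conv_lhs => rw [← Real.rpow_one (L / (q / t ^ 2))]
      exact Real.rpow_le_rpow_of_exponent_ge (by positivity) ((div_le_one hN0).2 h.le) hw1
    calc (L : ℝ) = q / t ^ 2 * (L / (q / t ^ 2)) := by field_simp
      _ ≤ _ := by gcongr
  -- The scale T = √(q/L) makes the real intervals have length exactly 1/T², and L ≥ N gives T ≤ t.
  -- Shorter arcs are handled by the trivial count L.
  · have hT : 1 ≤ Real.sqrt (q / L) := by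
      rw [Real.one_le_sqrt, one_le_div hL0]
      exact_mod_cast hL
    have hTt : Real.sqrt (q / L) ≤ t := by
      rw [Real.sqrt_le_left (by linarith), div_le_iff₀ hL0]
      rwa [div_le_iff₀' (by positivity)] at h
    have hsq : 1 / Real.sqrt (q / L) ^ 2 = L / q := by
      rw [Real.sq_sqrt (by positivity), one_div_div]
    have hLq : 0 ≤ (L : ℝ) / q := by positivity
    have hA := ncard_zarembaSet_le_of_length (M := M) (α := x.val / q) (β := x.val / q + L / q)
      (by omega) hT hTt htq (by linarith) (by rw [hsq]; linarith)
    have hB := ncard_zarembaSet_le_of_length (M := M) (α := x.val / q - 1)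
      (β := x.val / q - 1 + L / q) (by omega) hT hTt htq (by linarith) (by rw [hsq]; linarith)
    have hsub : zarembaSet q M t ∩ residueArc x L ⊆
        {a ∈ zarembaSet q M t | (a.val : ℝ) / q ∈ Set.Icc ((x.val : ℝ) / q) (x.val / q + L / q)} ∪
        {a ∈ zarembaSet q M t |
          (a.val : ℝ) / q ∈ Set.Icc ((x.val : ℝ) / q - 1) (x.val / q - 1 + L / q)} := by
      rintro a ⟨ha, hax⟩
      rcases val_mem_of_mem_residueArc hL hax with h | h
      · exact Or.inl ⟨ha, h⟩
      · exact Or.inr ⟨ha, h⟩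
    have hcard := (Set.ncard_le_ncard hsub (Set.toFinite _)).trans (Set.ncard_union_le _ _)
    have hcard' : ((zarembaSet q M t ∩ residueArc x L).ncard : ℝ) ≤ _ :=
      (Nat.cast_le.2 hcard).trans_eq (Nat.cast_add _ _)
    rw [← hw, div_sqrt_rpow_two_mul (by linarith) (by positivity),
      show t ^ 2 / (q / L) = L / (q / t ^ 2) by field_simp] at hA hB
    have hM1 : ((M : ℝ) + 1) ^ 4 ≤ (2 * M) ^ 4 := by gcongr; linarith
    calc _ ≤ _ := hcard'
      _ ≤ 1536 * (M + 1 : ℝ) ^ 4 * ((q / t ^ 2) * (L / (q / t ^ 2)) ^ w) := by linarith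
      _ ≤ 1536 * (2 * M) ^ 4 * ((q / t ^ 2) * (L / (q / t ^ 2)) ^ w) := by gcongr
      _ = _ := by ring

/-! ### Lower bound for the number of elements in a cylinder. -/

theorem rpow_neg_one_sub_le {τ x : ℝ} (hτ : 0 < τ) (hx : 1 < x) :
    x ^ (-(1 + τ)) ≤ ((x - 1) ^ (-τ) - x ^ (-τ)) / τ := by
  have hx0 : 0 < x := by linarith
  set r := (x - 1) / x with hr
  have hr0 : 0 < r := div_pos (by linarith) hx0
  have h1 : 1 + τ / x ≤ r ^ (-τ) := by
    rw [Real.rpow_def_of_pos hr0]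
    have h2 := Real.add_one_le_exp (Real.log r * -τ)
    have h3 := Real.log_le_sub_one_of_pos hr0
    have h4 : 1 - r = 1 / x := by rw [hr]; field_simp; ring
    have h5 : τ * (1 / x) ≤ τ * (-Real.log r) := mul_le_mul_of_nonneg_left (by linarith) hτ.le
    rw [mul_one_div] at h5
    linarith
  have h2 : (x - 1) ^ (-τ) = x ^ (-τ) * r ^ (-τ) := by
    rw [← Real.mul_rpow hx0.le hr0.le, hr, mul_div_cancel₀ _ hx0.ne']
  have h3 : x ^ (-(1 + τ)) = x ^ (-τ) * (1 / x) := by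
    rw [show -(1 + τ) = -τ - 1 by ring, Real.rpow_sub_one hx0.ne', mul_one_div]
  rw [le_div_iff₀ hτ, h2, h3]
  have h4 : 0 < x ^ (-τ) := by positivity
  calc x ^ (-τ) * (1 / x) * τ = x ^ (-τ) * (1 + τ / x) - x ^ (-τ) := by ring
    _ ≤ _ := by gcongr

theorem sum_Icc_div_rpow_le {τ : ℝ} (hτ : 0 < τ) {c n : ℕ} (hc : 1 ≤ c) :
    ∑ k ∈ Finset.Icc c n, ((c : ℝ) / k) ^ (1 + τ) ≤ (1 + 1 / τ) * c := by
  have hc0 : (0 : ℝ) < c := by exact_mod_cast hc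
  rcases lt_or_ge n c with hn | hn
  · rw [Finset.Icc_eq_empty (by omega), Finset.sum_empty]
    positivity
  have key : ∑ k ∈ Finset.Icc c n, (k : ℝ) ^ (-(1 + τ)) ≤
      (c : ℝ) ^ (-(1 + τ)) + ((c : ℝ) ^ (-τ) - (n : ℝ) ^ (-τ)) / τ := by
    induction n, hn using Nat.le_induction with
    | base => simp
    | succ n hn ih =>
      rw [Finset.sum_Icc_succ_top (by omega)]
      have h := rpow_neg_one_sub_le hτ (x := ((n + 1 : ℕ) : ℝ)) (by
        have : 1 ≤ n := hc.trans hn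
        exact_mod_cast Nat.lt_succ_of_le this)
      rw [show (((n + 1 : ℕ) : ℝ) - 1) = n by push_cast; ring] at h
      rw [sub_div] at h ih ⊢
      linarith
  have hterm : ∀ k ∈ Finset.Icc c n, ((c : ℝ) / k) ^ (1 + τ) =
      (c : ℝ) ^ (1 + τ) * (k : ℝ) ^ (-(1 + τ)) := by
    intro k _
    rw [Real.div_rpow hc0.le (Nat.cast_nonneg k), Real.rpow_neg (Nat.cast_nonneg k), div_eq_mul_inv]
  rw [Finset.sum_congr rfl hterm, ← Finset.mul_sum]
  have h1 : (0 : ℝ) ≤ (n : ℝ) ^ (-τ) := by positivity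
  have h2 : (c : ℝ) ^ (1 + τ) * (c : ℝ) ^ (-(1 + τ)) = 1 := by
    rw [← Real.rpow_add hc0, add_neg_cancel, Real.rpow_zero]
  have h3 : (c : ℝ) ^ (1 + τ) * (c : ℝ) ^ (-τ) = c := by
    rw [← Real.rpow_add hc0, add_neg_cancel_right, Real.rpow_one]
  have hc1 : (1 : ℝ) ≤ c := by exact_mod_cast hc
  calc _ ≤ (c : ℝ) ^ (1 + τ) * ((c : ℝ) ^ (-(1 + τ)) + (c : ℝ) ^ (-τ) / τ) := by
        refine mul_le_mul_of_nonneg_left (key.trans ?_) (by positivity)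
        gcongr
        linarith
    _ = 1 + c / τ := by rw [mul_add, h2, ← mul_div_assoc, h3]
    _ ≤ _ := by
      rw [add_mul, one_mul, div_mul_eq_mul_div, one_mul]
      linarith

/-- The elements of `Z_M(t)` in the open cylinder of the word `v`. -/
noncomputable def zarembaCylinder (q M : ℕ) [NeZero q] (t : ℝ) (v : List ℕ) : Finset (ZMod q) := by
  classical
  exact Finset.univ.filter fun a => a ∈ zarembaSet q M t ∧
    ∃ y : ℝ, 0 < y ∧ y < 1 ∧ (a.val : ℝ) / q = cfEval v y

theorem mem_zarembaCylinder {q M : ℕ} [NeZero q] {t : ℝ} {v : List ℕ} {a : ZMod q} :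
    a ∈ zarembaCylinder q M t v ↔ a ∈ zarembaSet q M t ∧
      ∃ y : ℝ, 0 < y ∧ y < 1 ∧ (a.val : ℝ) / q = cfEval v y := by
  simp [zarembaCylinder]

/-- The bound holds with K from `exists_zaremba_extension`, independent of M, since the extensions
use only the letters 1 and 2. -/
theorem exists_forall_le_card_zarembaCylinder :
    ∃ K : ℝ, 1 ≤ K ∧ ∀ (M q : ℕ) [NeZero q] (t : ℝ) (v : List ℕ), 2 ≤ M → t ≤ Real.sqrt q →
      IsWord M v → K * cden v ≤ t → q / t ^ 2 / 16 ≤ (zarembaCylinder q M t v).card := by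
  obtain ⟨K, hK, hext⟩ := exists_zaremba_extension
  refine ⟨K, hK, fun M q _ t v hM htq hv hvt => ?_⟩
  have hq : (0 : ℝ) < q := by exact_mod_cast Nat.pos_of_neZero q
  have hv1 := hv.pos.one_le_cden_real
  have hvt' : (cden v : ℝ) ≤ t := le_trans (by nlinarith) hvt
  have ht1 : 1 ≤ t := hv1.trans hvt'
  have ht0 : 0 < t := by linarith
  have hval : ∀ b : ℕ, b < q → ((b : ZMod q).val : ℝ) = b := fun b hb => by
    rw [ZMod.val_natCast_of_lt hb]
  rcases lt_or_ge (q / t ^ 2) 16 with hN | hN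
  -- For N < 16 a single element suffices.
  · obtain ⟨w, hw, hwq, a, y, hy, hy1, ha⟩ := hext q v (Nat.pos_of_neZero q) hv.pos (hvt.trans htq)
    have hvw : IsWord M (v ++ w) := isWord_append.2 ⟨hv, hw.mono hM⟩
    have ha0 : 0 < (a : ℝ) / q := ha ▸ hvw.pos.eval_pos hy
    have ha1 : (a : ℝ) / q < 1 := ha ▸ hvw.pos.eval_lt_one hy hy1
    rw [div_lt_one hq] at ha1
    have ha0 : 0 < a := by
      have := (div_pos_iff_of_pos_right hq).1 ha0
      exact_mod_cast this
    lift a to ℕ using ha0.le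
    have haq : a < q := by exact_mod_cast ha1
    rw [Int.cast_natCast] at ha
    have hva := hval a haq
    have hmem : (a : ZMod q) ∈ zarembaCylinder q M t v := by
      rw [mem_zarembaCylinder, hva]
      refine ⟨mem_zarembaSet_of_eval hvw (htq.trans hwq) hy hy1 (by rw [hva, ha]),
        cfEval w y, hw.pos.eval_pos hy, hw.pos.eval_lt_one hy hy1, ?_⟩
      rw [← cfEval_append v hw.pos hy.le, ha]
    have : (1 : ℝ) ≤ (zarembaCylinder q M t v).card := by
      exact_mod_cast Finset.card_pos.2 ⟨_, hmem⟩
    linarith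
  -- For N ≥ 16, ones bring the denominator into [t, 2t). The resulting cylinder has length at least
  -- 1/(8t²) and contains at least N/8 - 1 ≥ N/16 fractions.
  · obtain ⟨k, hk1, hk2⟩ := exists_append_ones hv.pos hvt'
    have hone := isWord_replicate_one (M := M) (by omega) k
    have hu : IsWord M (v ++ List.replicate k 1) := isWord_append.2 ⟨hv, hone⟩
    set u := v ++ List.replicate k 1 with hu_def
    have hlen := le_abs_eval_one_sub hu.pos
    have hb0 := cfEval_nonneg u (le_refl (0 : ℝ))
    have hb0' := hu.pos.eval_le_one le_rfl (zero_le_one (α := ℝ))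
    have hb1 := cfEval_nonneg u (zero_le_one (α := ℝ))
    have hb1' := hu.pos.eval_le_one zero_le_one (le_refl (1 : ℝ))
    have hcard := le_card_of_forall_mem (q := q) (A := zarembaCylinder q M t v)
      (α := min (cfEval u 0) (cfEval u 1)) (β := max (cfEval u 0) (cfEval u 1))
      (le_min hb0 hb1) (max_le hb0' hb1') (by
        intro b hb h1 h2
        obtain ⟨y, ⟨hy, hy1⟩, hye⟩ := uIoo_subset_image hu.pos (a := (b : ℝ) / q) ⟨h1, h2⟩
        have hva := hval b hb
        rw [mem_zarembaCylinder, hva]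
        refine ⟨mem_zarembaSet_of_eval hu hk1 hy hy1 (by rw [hva, hye]),
          cfEval (List.replicate k 1) y, hone.pos.eval_pos hy, hone.pos.eval_lt_one hy hy1, ?_⟩
        rw [← cfEval_append v hone.pos hy.le, ← hye])
    rw [max_sub_min_eq_abs] at hcard
    have hQ := hu.pos.one_le_cden_real
    have h1 : 1 / (8 * t ^ 2) ≤ |cfEval u (1 : ℝ) - cfEval u 0| := by
      refine le_trans (one_div_le_one_div_of_le (by positivity) ?_) hlen
      nlinarith
    have h2 := mul_le_mul_of_nonneg_left h1 hq.le
    have h3 : q * (1 / (8 * t ^ 2)) = q / t ^ 2 / 8 := by field_simp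
    linarith

theorem zarembaCylinder_append_subset {q M : ℕ} [NeZero q] {t : ℝ} {v w : List ℕ}
    (hw : PosWord w) : zarembaCylinder q M t (v ++ w) ⊆ zarembaCylinder q M t v := by
  intro a ha
  obtain ⟨ha, y, hy, hy1, h⟩ := mem_zarembaCylinder.1 ha
  exact mem_zarembaCylinder.2 ⟨ha, cfEval w y, hw.eval_pos hy, hw.eval_lt_one hy hy1,
    by rw [h, cfEval_append v hw hy.le]⟩

theorem sum_card_zarembaCylinder_le {q M : ℕ} [NeZero q] {t : ℝ} {v : List ℕ} (hv : IsWord M v) :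
    ∑ c ∈ Finset.Icc 1 M, (zarembaCylinder q M t (v ++ [c])).card ≤
      (zarembaCylinder q M t v).card := by
  classical
  have hpos : ∀ c ∈ Finset.Icc 1 M, PosWord (v ++ [c]) := fun c hc =>
    (isWord_append.2 ⟨hv, isWord_singleton.2 (Finset.mem_Icc.1 hc)⟩).pos
  rw [← Finset.card_biUnion]
  · refine Finset.card_le_card (Finset.biUnion_subset.2 fun c hc => ?_)
    exact zarembaCylinder_append_subset (posWord_append.1 (hpos c hc)).2
  · intro c hc c' hc' hne
    rw [Function.onFun, Finset.disjoint_left]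
    intro a ha ha'
    obtain ⟨-, y, hy, hy1, h⟩ := mem_zarembaCylinder.1 ha
    obtain ⟨-, z, hz, hz1, h'⟩ := mem_zarembaCylinder.1 ha'
    rcases prefix_or_prefix_of_eval_eq (hpos c hc) (hpos c' hc') hy hy1 hz hz1 (h.symm.trans h')
      with hp | hp
    · simpa using hne (by simpa using hp.eq_of_length (by simp))
    · simpa using hne (by simpa using (hp.eq_of_length (by simp)).symm)

/-- The masses of the children `v c` whose denominators are at least `θ` are dominated by those
with `c < 2 c₀`. -/
theorem ConformalMass.sum_large_children_le {M : ℕ} {m : List ℕ → ℝ} (hm : ConformalMass M m)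
    {σ : ℝ} (hσ : 1 < σ) (hσw : σ ≤ 2 * hausdorffDimBounded M) {v : List ℕ} (hv : IsWord M v)
    {θ : ℝ} (hθ : 0 < θ) {c₀ : ℕ} (hc₀ : 1 ≤ c₀) (hc₀M : c₀ ≤ M) (hc₀θ : θ ≤ cden (v ++ [c₀])) :
    ∑ c ∈ Finset.Icc c₀ M, m (v ++ [c]) ≤
      16 * (1 + 1 / (σ - 1)) * θ ^ (-(2 * hausdorffDimBounded M)) *
        (Finset.Icc c₀ (min (2 * c₀) M)).card := by
  set w := hausdorffDimBounded M with hw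
  have hw1 : w ≤ 1 := hausdorffDimBounded_le_one M
  have hc0 : (0 : ℝ) < c₀ := by exact_mod_cast hc₀
  have hQ0 : (0 : ℝ) < cden v := lt_of_lt_of_le one_pos hv.pos.one_le_cden_real
  have hτ : 0 < σ - 1 := by linarith
  have hword : ∀ c ∈ Finset.Icc c₀ M, IsWord M (v ++ [c]) := fun c hc =>
    isWord_append.2 ⟨hv, isWord_singleton.2 ⟨hc₀.trans (Finset.mem_Icc.1 hc).1,
      (Finset.mem_Icc.1 hc).2⟩⟩
  have hθ2 : θ ≤ 2 * c₀ * cden v := by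
    refine hc₀θ.trans ?_
    have h1 := cden_snoc_le hv.pos c₀
    have h2 : (cden (v ++ [c₀]) : ℝ) ≤ (c₀ + 1) * cden v := by exact_mod_cast h1
    have : (1 : ℝ) ≤ c₀ := by exact_mod_cast hc₀
    nlinarith
  have hE : 0 < θ ^ (-(2 * w)) := by positivity
  have hA : 0 < 1 / (σ - 1) := by positivity
  rcases le_or_gt M (2 * c₀) with hM | hM
  · rw [min_eq_right hM]
    have h1 : ∀ c ∈ Finset.Icc c₀ M, m (v ++ [c]) ≤ 4 * θ ^ (-(2 * w)) := by
      intro c hc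
      refine hm.le_of_le_cden (hword c hc) hθ (hc₀θ.trans ?_)
      rw [cden_snoc, cden_snoc]
      have := Nat.mul_le_mul_right (cden v) (Finset.mem_Icc.1 hc).1
      exact_mod_cast Nat.add_le_add_left this _
    refine (Finset.sum_le_card_nsmul _ _ _ h1).trans ?_
    rw [nsmul_eq_mul, mul_comm]
    have h2 : (4 : ℝ) ≤ 16 * (1 + 1 / (σ - 1)) := by linarith
    gcongr
  · rw [min_eq_left hM.le]
    have h1 : ∀ c ∈ Finset.Icc c₀ M, m (v ++ [c]) ≤
        16 * θ ^ (-(2 * w)) * ((c₀ : ℝ) / c) ^ (1 + (σ - 1)) := by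
      intro c hc
      obtain ⟨hcc, hcM⟩ := Finset.mem_Icc.1 hc
      have hc0' : (0 : ℝ) < c := by exact_mod_cast hc₀.trans hcc
      have hcc' : (c₀ : ℝ) ≤ c := by exact_mod_cast hcc
      -- The first large child satisfies θ ≤ q(v c₀) ≤ 2 c₀ q(v), so q(v c) ≥ c q(v) grows at least
      -- linearly from θ/2. The masses then decay like (c₀/c)^σ with σ > 1.
      have hT : θ / 2 * (c / c₀) ≤ cden (v ++ [c]) := by
        have h2 : (c * cden v : ℝ) ≤ cden (v ++ [c]) := by
          rw [cden_snoc]; push_cast; linarith [Nat.cast_nonneg (α := ℝ) (cden' v)]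
        refine le_trans ?_ h2
        rw [← mul_div_assoc, div_le_iff₀ hc0]
        nlinarith
      refine (hm.le_of_le_cden (hword c hc) (by positivity) hT).trans ?_
      rw [Real.mul_rpow (by positivity) (by positivity), Real.div_rpow hθ.le (by norm_num),
        Real.rpow_neg (by positivity : (0 : ℝ) ≤ 2), div_inv_eq_mul]
      have h3 : (2 : ℝ) ^ (2 * w) ≤ 4 := by
        calc (2 : ℝ) ^ (2 * w) ≤ 2 ^ (2 : ℝ) :=
              Real.rpow_le_rpow_of_exponent_le (by norm_num) (by linarith)
          _ = 4 := by norm_num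
      have h4 : ((c : ℝ) / c₀) ^ (-(2 * w)) ≤ ((c₀ : ℝ) / c) ^ (1 + (σ - 1)) := by
        rw [Real.rpow_neg (by positivity), ← Real.inv_rpow (by positivity), inv_div]
        exact Real.rpow_le_rpow_of_exponent_ge (by positivity) ((div_le_one hc0').2 hcc')
          (by linarith)
      calc _ ≤ 4 * (θ ^ (-(2 * w)) * 4 * ((c₀ : ℝ) / c) ^ (1 + (σ - 1))) := by gcongr
        _ = _ := by ring
    refine (Finset.sum_le_sum h1).trans ?_
    rw [← Finset.mul_sum]
    have h2 := sum_Icc_div_rpow_le hτ (c := c₀) (n := M) hc₀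
    have h3 : (c₀ : ℝ) ≤ (Finset.Icc c₀ (2 * c₀)).card := by
      rw [Nat.card_Icc]
      exact_mod_cast (by omega : c₀ ≤ 2 * c₀ + 1 - c₀)
    calc _ ≤ 16 * θ ^ (-(2 * w)) * ((1 + 1 / (σ - 1)) * c₀) := by gcongr
      _ = 16 * (1 + 1 / (σ - 1)) * θ ^ (-(2 * w)) * c₀ := by ring
      _ ≤ _ := by gcongr

/-- Induction down the tree to the threshold θ = t/(4K). Children below θ are covered by the
induction, while the total mass of the remaining children is dominated by the number of those with c
between c₀ and 2c₀, each containing at least N/16 elements. The constant is uniform in M since the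
exponent of decay is at least 2w₂ > 1. -/
theorem exists_forall_mass_le_card_zarembaCylinder :
    ∃ K c : ℝ, 1 ≤ K ∧ 0 < c ∧ ∀ (M q : ℕ) [NeZero q] (t : ℝ) (m : List ℕ → ℝ), 2 ≤ M →
      ConformalMass M m → 0 < t → t ≤ Real.sqrt q → ∀ v, IsWord M v → cden v < t / (4 * K) →
        c * (q / t ^ 2) * (t / (4 * K)) ^ (2 * hausdorffDimBounded M) * m v ≤
          (zarembaCylinder q M t v).card := by
  obtain ⟨K, hK, hB⟩ := exists_forall_le_card_zarembaCylinder
  have hσ := half_lt_hausdorffDimBounded_two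
  set σ := 2 * hausdorffDimBounded 2 with hσ_def
  have hσ1 : 1 < σ := by linarith
  set A := 16 * (1 + 1 / (σ - 1)) with hA
  have hA0 : 0 < A := by
    have : 0 < 1 / (σ - 1) := one_div_pos.2 (by linarith)
    positivity
  refine ⟨K, 1 / (16 * A), hK, by positivity, fun M q _ t m hM hm ht htq => ?_⟩
  set w := hausdorffDimBounded M with hw
  have hσw : σ ≤ 2 * w := by
    have := hausdorffDimBounded_mono hM
    linarith
  set θ := t / (4 * K) with hθ
  have hθ0 : 0 < θ := by positivity
  have hKθ : K * (4 * θ) = t := by rw [hθ]; field_simp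
  have hq : (0 : ℝ) < q := by exact_mod_cast Nat.pos_of_neZero q
  set N := q / t ^ 2 with hN
  have hN0 : 0 < N := by positivity
  set B := 1 / (16 * A) * N * θ ^ (2 * w) with hB_def
  have hB0 : 0 < B := by positivity
  obtain ⟨n, hn⟩ := pow_unbounded_of_one_lt θ (one_lt_two : (1 : ℝ) < 2)
  have main : ∀ k : ℕ, ∀ v, IsWord M v → cden v < θ → 2 * n ≤ v.length + k →
      B * m v ≤ (zarembaCylinder q M t v).card := by
    intro k
    induction k with
    | zero =>
      intro v hv hvθ hlen
      exfalso
      have h1 := two_pow_le_cden hv.pos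
      have h2 : 2 ^ n ≤ cden v := (Nat.pow_le_pow_right (by norm_num) (by omega)).trans h1
      have h3 : (2 : ℝ) ^ n ≤ cden v := by exact_mod_cast h2
      linarith
    | succ k ih =>
      intro v hv hvθ hlen
      have hword : ∀ c ∈ Finset.Icc 1 M, IsWord M (v ++ [c]) := fun c hc =>
        isWord_append.2 ⟨hv, isWord_singleton.2 (Finset.mem_Icc.1 hc)⟩
      have hsmall : ∀ c ∈ Finset.Icc 1 M, (cden (v ++ [c]) : ℝ) < θ →
          B * m (v ++ [c]) ≤ (zarembaCylinder q M t (v ++ [c])).card := fun c hc h =>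
        ih _ (hword c hc) h (by simp; omega)
      have hsum : (∑ c ∈ Finset.Icc 1 M, ((zarembaCylinder q M t (v ++ [c])).card : ℝ)) ≤
          (zarembaCylinder q M t v).card := by
        exact_mod_cast sum_card_zarembaCylinder_le hv
      refine le_trans ?_ hsum
      rw [hm.add v hv, Finset.mul_sum]
      by_cases hex : ∃ c, 1 ≤ c ∧ c ≤ M ∧ θ ≤ cden (v ++ [c])
      swap
      · push Not at hex
        refine Finset.sum_le_sum fun c hc => hsmall c hc ?_
        obtain ⟨h1, h2⟩ := Finset.mem_Icc.1 hc
        exact hex c h1 h2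
      classical
      obtain ⟨h1, h2, h3⟩ := Nat.find_spec hex
      have hmin : ∀ c, 1 ≤ c → c < Nat.find hex → (cden (v ++ [c]) : ℝ) < θ := by
        intro c hc hlt
        have := Nat.find_min hex hlt
        push Not at this
        exact this hc (by omega)
      set c₀ := Nat.find hex with hc₀
      clear_value c₀
      -- Since c₀ is the first letter reaching θ and q(v) < θ, one more unit in the letter adds less
      -- than θ. The letters up to 2c₀ then stay below 4θ = t/K, which explains the 4 in θ.
      have hc₀θ : (cden (v ++ [c₀]) : ℝ) ≤ 2 * θ := by
        rcases Nat.lt_or_ge 1 c₀ with h | h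
        · have h4 := hmin (c₀ - 1) (by omega) (by omega)
          rw [cden_snoc] at h4 ⊢
          have h5 : cden' v + c₀ * cden v = cden' v + (c₀ - 1) * cden v + cden v := by
            conv_lhs => rw [show c₀ = c₀ - 1 + 1 by omega]
            ring
          rw [h5, Nat.cast_add]
          linarith
        · have h4 := cden_snoc_le hv.pos c₀
          have h5 : c₀ = 1 := by omega
          rw [h5] at h4 ⊢
          have h6 : (cden (v ++ [1]) : ℝ) ≤ (1 + 1) * cden v := by exact_mod_cast h4
          linarith
      have hlarge : ∀ c ∈ Finset.Icc c₀ (min (2 * c₀) M),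
          N / 16 ≤ (zarembaCylinder q M t (v ++ [c])).card := by
        intro c hc
        obtain ⟨hc1, hc2⟩ := Finset.mem_Icc.1 hc
        refine hB M q t _ hM htq (hword c (Finset.mem_Icc.2 ⟨by omega, by omega⟩)) ?_
        rw [← hKθ]
        refine mul_le_mul_of_nonneg_left ?_ (by linarith)
        have h4 : cden (v ++ [c]) ≤ 2 * cden (v ++ [c₀]) := by
          rw [cden_snoc, cden_snoc]
          have := Nat.mul_le_mul_right (cden v) (show c ≤ 2 * c₀ by omega)
          rw [mul_assoc] at this
          omega
        have h5 : (cden (v ++ [c]) : ℝ) ≤ 2 * cden (v ++ [c₀]) := by exact_mod_cast h4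
        linarith
      have hfil : (Finset.Icc 1 M).filter (fun c => ¬ c < c₀) = Finset.Icc c₀ M := by
        ext c
        simp only [Finset.mem_filter, Finset.mem_Icc]
        omega
      rw [← Finset.sum_filter_add_sum_filter_not (Finset.Icc 1 M) (fun c => c < c₀),
        ← Finset.sum_filter_add_sum_filter_not (Finset.Icc 1 M) (fun c => c < c₀)
          (fun c => ((zarembaCylinder q M t (v ++ [c])).card : ℝ)), hfil]
      refine add_le_add (Finset.sum_le_sum fun c hc => ?_) ?_
      · obtain ⟨hc1, hc2⟩ := Finset.mem_filter.1 hc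
        exact hsmall c hc1 (hmin c (Finset.mem_Icc.1 hc1).1 hc2)
      · rw [← Finset.mul_sum]
        have h4 := hm.sum_large_children_le hσ1 hσw hv hθ0 h1 h2 h3
        have h5 := Finset.card_nsmul_le_sum _ _ _ hlarge
        rw [nsmul_eq_mul] at h5
        have h6 : (∑ c ∈ Finset.Icc c₀ (min (2 * c₀) M),
            ((zarembaCylinder q M t (v ++ [c])).card : ℝ)) ≤
            ∑ c ∈ Finset.Icc c₀ M, ((zarembaCylinder q M t (v ++ [c])).card : ℝ) :=
          Finset.sum_le_sum_of_subset_of_nonneg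
            (Finset.Icc_subset_Icc_right (min_le_right _ _)) fun _ _ _ => Nat.cast_nonneg _
        refine (mul_le_mul_of_nonneg_left h4 hB0.le).trans (le_trans (le_of_eq ?_) (h5.trans h6))
        rw [hB_def, ← hA, ← hw, Real.rpow_neg hθ0.le]
        have : θ ^ (2 * w) ≠ 0 := by positivity
        field_simp
  exact fun v hv hvθ => main (2 * n) v hv hvθ (by omega)

/-! ### Lower bound around an element of Z_M(t). -/

theorem PosWord.uIoo_eval_subset_image {u : List ℕ} (hu : PosWord u) {y z : ℝ} (hy : 0 ≤ y)
    (hyz : y ≤ z) (hz : z ≤ 1) :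
    Set.uIoo (cfEval u y) (cfEval u z) ⊆ cfEval u '' Set.Ioo y z := by
  have hc := (continuousOn_cfEval hu).mono (Set.Icc_subset_Icc hy hz)
  intro x hx
  rcases le_total (cfEval u y) (cfEval u z) with h | h
  · rw [Set.uIoo_of_le h] at hx
    exact intermediate_value_Ioo hyz hc hx
  · rw [Set.uIoo_of_ge h] at hx
    exact intermediate_value_Ioo' hyz hc hx

theorem PosWord.eval_mem_uIcc {u : List ℕ} (hu : PosWord u) {x y z : ℝ} (hy : 0 ≤ y) (hyx : y ≤ x)
    (hxz : x ≤ z) : cfEval u x ∈ Set.uIcc (cfEval u y) (cfEval u z) := by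
  have hx : 0 ≤ x := hy.trans hyx
  have hz : 0 ≤ z := hx.trans hxz
  have h1 := hu.eval_sub hx hy
  have h2 := hu.eval_sub hz hx
  have h3 : 0 ≤ (x - y) / ((cden u + cden' u * x) * (cden u + cden' u * y)) :=
    div_nonneg (by linarith) (mul_pos (hu.eval_den_pos hx) (hu.eval_den_pos hy)).le
  have h4 : 0 ≤ (z - x) / ((cden u + cden' u * z) * (cden u + cden' u * x)) :=
    div_nonneg (by linarith) (mul_pos (hu.eval_den_pos hz) (hu.eval_den_pos hx)).le
  rw [Set.mem_uIcc]
  rcases neg_one_pow_eq_or ℝ u.length with h | h <;> rw [h] at h1 h2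
  · left; constructor <;> linarith
  · right; constructor <;> linarith

/-- Around each element of `Z_M(t)` there is an interval consisting of elements of `Z_M(t)`. -/
theorem exists_interval_subset_zarembaSet {q M : ℕ} [NeZero q] {t : ℝ} (ht : 1 ≤ t) {a : ZMod q}
    (ha : a ∈ zarembaSet q M t) :
    ∃ α β : ℝ, 0 ≤ α ∧ β ≤ 1 ∧ α ≤ (a.val : ℝ) / q ∧ (a.val : ℝ) / q ≤ β ∧
      1 / (6 * t ^ 2) ≤ β - α ∧
      ∀ b : ZMod q, α < (b.val : ℝ) / q → (b.val : ℝ) / q < β → b ∈ zarembaSet q M t := by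
  have ht0 : 0 < t := by linarith
  obtain ⟨u, z, hu, hut, hpred, hz, hz1, h⟩ := exists_stopWord_of_mem_zarembaSet ha le_rfl
  rcases List.eq_nil_or_concat' u with rfl | ⟨p, c, rfl⟩
  · rw [cfEval_nil] at h
    refine ⟨0, 1, le_rfl, le_rfl, by rw [h]; exact hz, by rw [h]; exact hz1.le, ?_, fun b hb hb1 =>
      mem_zarembaSet_of_eval hu hut hb hb1 (by rw [cfEval_nil])⟩
    rw [sub_zero, div_le_one (by positivity)]
    nlinarith
  have hpt := hpred (by simp)
  rw [List.dropLast_concat] at hpt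
  obtain ⟨hp, hc⟩ := isWord_append.1 hu
  obtain ⟨hc1, hcM⟩ := isWord_singleton.1 hc
  classical
  -- Let e be the least last letter for which the denominator reaches t. The cylinders of p e, …, p
  -- M together fill the image under p of the interval from 1/(M + 1) to 1/e, which is long even
  -- when the single cylinder of the given word is short.
  have hex : ∃ c, 1 ≤ c ∧ t ≤ cden (p ++ [c]) := ⟨c, hc1, hut⟩
  obtain ⟨h1, h2⟩ := Nat.find_spec hex
  have hcle : Nat.find hex ≤ c := Nat.find_min' hex ⟨hc1, hut⟩
  have hX2 : (cden (p ++ [Nat.find hex]) : ℝ) ≤ 2 * t := by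
    rcases Nat.lt_or_ge 1 (Nat.find hex) with h | h
    · have h4 := Nat.find_min hex (m := Nat.find hex - 1) (by omega)
      push Not at h4
      have h5 := h4 (by omega)
      rw [cden_snoc] at h5 ⊢
      have h6 : cden' p + Nat.find hex * cden p =
          cden' p + (Nat.find hex - 1) * cden p + cden p := by
        conv_lhs => rw [show Nat.find hex = Nat.find hex - 1 + 1 by omega]
        ring
      rw [h6, Nat.cast_add]
      linarith
    · have h5 : Nat.find hex = 1 := by omega
      rw [h5]
      have h6 : (cden (p ++ [1]) : ℝ) ≤ (1 + 1) * cden p := by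
        exact_mod_cast cden_snoc_le hp.pos 1
      linarith
  set e := Nat.find hex with he
  clear_value e
  have he1 : (1 : ℝ) ≤ e := by exact_mod_cast h1
  have heM : (e : ℝ) + 1 ≤ M + 1 := by exact_mod_cast (by omega : e + 1 ≤ M + 1)
  have hec : (e : ℝ) ≤ c := by exact_mod_cast hcle
  have hcM' : (c : ℝ) ≤ M := by exact_mod_cast hcM
  have hy1 : (0 : ℝ) ≤ (M + 1 : ℝ)⁻¹ := by positivity
  have hy2 : (e : ℝ)⁻¹ ≤ 1 := inv_le_one_of_one_le₀ he1
  have hy12 : (M + 1 : ℝ)⁻¹ ≤ (e : ℝ)⁻¹ := inv_anti₀ (by linarith) (by linarith)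
  rw [cfEval_append p (isWord_append.1 hu).2.pos hz, cfEval_singleton] at h
  have hmem := hp.pos.eval_mem_uIcc hy1 (x := (c + z)⁻¹) (z := (e : ℝ)⁻¹)
    (inv_anti₀ (by linarith) (by linarith)) (inv_anti₀ (by linarith) (by linarith))
  rw [← h] at hmem
  have hQ := hp.pos.one_le_cden_real
  refine ⟨min (cfEval p (M + 1 : ℝ)⁻¹) (cfEval p (e : ℝ)⁻¹),
    max (cfEval p (M + 1 : ℝ)⁻¹) (cfEval p (e : ℝ)⁻¹),
    le_min (cfEval_nonneg _ hy1) (cfEval_nonneg _ (hy1.trans hy12)),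
    max_le (hp.pos.eval_le_one hy1 (hy12.trans hy2)) (hp.pos.eval_le_one (hy1.trans hy12) hy2),
    hmem.1, hmem.2, ?_, fun b hb hb1 => ?_⟩
  · rw [max_sub_min_eq_abs, hp.pos.abs_eval_sub (hy1.trans hy12) hy1,
      abs_of_nonneg (sub_nonneg.2 hy12)]
    rw [cden_snoc] at h2 hX2
    push_cast at h2 hX2
    have hX0 : (0 : ℝ) < cden' p + e * cden p := by linarith
    have hk : (1 : ℝ) ≤ M + 1 - e := by linarith
    have hY0 : (0 : ℝ) < cden' p + (M + 1) * cden p := by positivity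
    have e1 : ((e : ℝ)⁻¹ - (M + 1 : ℝ)⁻¹) /
        ((cden p + cden' p * (e : ℝ)⁻¹) * (cden p + cden' p * (M + 1 : ℝ)⁻¹)) =
        (M + 1 - e) / ((cden' p + e * cden p) * (cden' p + (M + 1) * cden p)) := by
      have : (e : ℝ) ≠ 0 := by linarith
      have : (M + 1 : ℝ) ≠ 0 := by linarith
      field_simp
      rw [add_comm (e * cden p : ℝ), add_comm ((M + 1) * cden p : ℝ)]
    rw [e1, div_le_div_iff₀ (by positivity) (by positivity), one_mul]
    -- The left side is q(p e) + (M + 1 - e) q(p), at most 2t + (M + 1 - e) t, and M + 1 - e ≥ 1.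
    have hY : (cden' p + (M + 1) * cden p : ℝ) ≤ (3 * (M + 1 - e)) * t := by
      nlinarith
    calc _ ≤ (2 * t) * ((3 * (M + 1 - e)) * t) := by gcongr
      _ = _ := by ring
  · obtain ⟨y, ⟨hby, hby1⟩, hye⟩ := hp.pos.uIoo_eval_subset_image hy1 hy12 hy2
      (a := (b.val : ℝ) / q) ⟨hb, hb1⟩
    have hy0 : 0 < y := lt_of_le_of_lt hy1 hby
    have hζ1 : (e : ℝ) < y⁻¹ := (lt_inv_comm₀ (by linarith) hy0).2 hby1
    have hζ2 : y⁻¹ < M + 1 := (inv_lt_comm₀ (by positivity) hy0).1 hby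
    have hfl1 : e ≤ ⌊y⁻¹⌋₊ := Nat.le_floor hζ1.le
    have hfl2 : ⌊y⁻¹⌋₊ < M + 1 := (Nat.floor_lt (by positivity)).2 (by exact_mod_cast hζ2)
    -- The inverse of y may be an integer, when b/q is a common endpoint of two cylinders, so
    -- membership is read off from the floor of the inverse rather than from an open cylinder.
    refine mem_zarembaSet_of_eval_inv (u := p) (c := ⌊y⁻¹⌋₊)
      (isWord_append.2 ⟨hp, isWord_singleton.2 ⟨by omega, by omega⟩⟩) (h2.trans ?_)
      (lt_of_le_of_lt he1 hζ1) (Nat.floor_le (by positivity)) (Nat.lt_floor_add_one _)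
      (by rw [inv_inv, hye])
    rw [cden_snoc, cden_snoc]
    exact_mod_cast Nat.add_le_add_left (Nat.mul_le_mul_right _ hfl1) _

/-- For N ≤ 64 the element a itself suffices. Otherwise at least half of the interval around a
filled with elements of Z_M(t) lies on one side of a, and a piece of length 1/(12t²) stays within
distance L/2 after scaling by q. -/
theorem le_ncard_near {q M : ℕ} [NeZero q] {t L : ℝ} (ht : 1 ≤ t) {a : ZMod q}
    (ha : a ∈ zarembaSet q M t) (hL : q / t ^ 2 ≤ L) :
    q / t ^ 2 / 64 ≤ ({b ∈ zarembaSet q M t | |(b.val : ℝ) - a.val| < L / 2}.ncard : ℝ) := by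
  classical
  have hq : (0 : ℝ) < q := by exact_mod_cast Nat.pos_of_neZero q
  have ht0 : 0 < t := by linarith
  have hN0 : 0 < q / t ^ 2 := by positivity
  set A : Finset (ZMod q) := Finset.univ.filter
    fun b => b ∈ zarembaSet q M t ∧ |(b.val : ℝ) - a.val| < L / 2 with hA
  have hAn : {b ∈ zarembaSet q M t | |(b.val : ℝ) - a.val| < L / 2}.ncard = A.card := by
    rw [← Set.ncard_coe_finset, hA]
    congr 1
    ext b
    simp
  rw [hAn]
  rcases le_or_gt (q / t ^ 2) 64 with h64 | h64
  · have hmem : a ∈ A := Finset.mem_filter.2 ⟨Finset.mem_univ _, ha, by simp; linarith⟩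
    have : (1 : ℝ) ≤ A.card := by exact_mod_cast Finset.card_pos.2 ⟨_, hmem⟩
    linarith
  obtain ⟨α, β, hα, hβ, haα, haβ, hlen, hsub⟩ := exists_interval_subset_zarembaSet ht ha
  have hval : ∀ b : ℕ, b < q → ((b : ZMod q).val : ℝ) = b := fun b hb => by
    rw [ZMod.val_natCast_of_lt hb]
  set r : ℝ := 1 / (12 * t ^ 2) with hr
  have hr0 : 0 < r := by positivity
  have hr2 : 1 / (6 * t ^ 2) = 2 * r := by rw [hr]; field_simp; norm_num
  have hqr : q * r = q / t ^ 2 / 12 := by rw [hr]; field_simp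
  have key : ∀ α' β' : ℝ, α ≤ α' → β' ≤ β → a.val / q - r ≤ α' → β' ≤ a.val / q + r →
      q * (β' - α') - 1 ≤ A.card := by
    intro α' β' h1 h2 h3 h4
    refine le_card_of_forall_mem (hα.trans h1) (h2.trans hβ) fun b hb hb1 hb2 => ?_
    rw [hA, Finset.mem_filter, hval b hb]
    refine ⟨Finset.mem_univ _, hsub _ (by rw [hval b hb]; linarith) (by rw [hval b hb]; linarith), ?_⟩
    have h5 : |(b : ℝ) / q - a.val / q| < r := abs_lt.2 ⟨by linarith, by linarith⟩
    rw [← sub_div, abs_div, abs_of_pos hq, div_lt_iff₀' hq, hqr] at h5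
    linarith
  rcases le_total (r : ℝ) (β - a.val / q) with h | h
  · have := key (a.val / q) (a.val / q + r) haα (by linarith) (by linarith) le_rfl
    rw [add_sub_cancel_left, hqr] at this
    linarith
  · have := key (a.val / q - r) (a.val / q) (by linarith) haβ le_rfl (by linarith)
    rw [sub_sub_cancel, hqr] at this
    linarith

theorem mem_residueArc_of_abs_val_sub_lt {q : ℕ} [NeZero q] {x a b : ZMod q} {L k : ℕ}
    (hk : 2 * k + 1 = L ∨ 2 * k = L ∨ 2 * k + 2 = L) (ha : a = x + (k : ZMod q))
    (h : |(b.val : ℝ) - a.val| < L / 2) : b ∈ residueArc x L := by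
  set d : ℤ := (b.val : ℤ) - a.val with hd
  have h1 : |(d : ℝ)| < L / 2 := by rw [hd]; push_cast; exact h
  rw [abs_lt] at h1
  have h2 : -(L : ℤ) < 2 * d := by
    have : -(L : ℝ) < 2 * d := by linarith
    exact_mod_cast this
  have h3 : 2 * d < (L : ℤ) := by
    have : 2 * (d : ℝ) < L := by linarith
    exact_mod_cast this
  have h0 : 0 ≤ k + d := by omega
  refine ⟨(k + d).toNat, by omega, ?_⟩
  have h4 : (((k + d).toNat : ℕ) : ZMod q) = ((k + d : ℤ) : ZMod q) := by
    rw [← Int.cast_natCast, Int.toNat_of_nonneg h0]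
  rw [h4, hd]
  push_cast
  rw [ZMod.natCast_zmod_val, ZMod.natCast_zmod_val, ha]
  ring

/-- An element of a stop cylinder of level `T` lies in a cylinder of diameter at most `1 / T²` whose
denominator is at most `√(8 M) T`. -/
theorem exists_small_cylinder {M : ℕ} {T : ℝ} (hT : 1 < T) {u : List ℕ} (hu : IsWord M u)
    (huT : IsStop T u) {z : ℝ} (hz : 0 ≤ z) (hz1 : z < 1) :
    ∃ v, IsWord M v ∧ (cden v : ℝ) ^ 2 ≤ 8 * M * T ^ 2 ∧
      ∀ y, 0 ≤ y → y ≤ 1 → |cfEval v y - cfEval u z| ≤ 1 / T ^ 2 := by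
  have hT0 : 0 < T := by linarith
  rcases List.eq_nil_or_concat' u with rfl | ⟨p, c, rfl⟩
  · have := huT.1
    simp at this
    linarith
  have hpT := huT.2 (by simp)
  rw [List.dropLast_concat] at hpT
  obtain ⟨hp, hc⟩ := isWord_append.1 hu
  obtain ⟨hc1, hcM⟩ := isWord_singleton.1 hc
  set Q : ℝ := ((cden p : ℕ) : ℝ) with hQ_def
  have hQ := hp.pos.one_le_cden_real
  rw [← hQ_def] at hQ
  have hQ0 : 0 < Q := by linarith
  set R : ℝ := T ^ 2 / Q ^ 2 with hR
  have hR1 : 1 ≤ R := by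
    rw [hR, one_le_div (by positivity)]
    gcongr
  set n := ⌈R⌉₊ with hn
  have hn1 : 1 ≤ n := Nat.one_le_ceil_iff.2 (by linarith)
  have hnR : (n : ℝ) ≤ 2 * R := by
    have := Nat.ceil_lt_add_one (show 0 ≤ R by linarith)
    rw [← hn] at this
    linarith
  -- A large last letter c is lowered to about R = T²/Q². All tails with letter at least R have
  -- values below 1/R, hence points within 1/(R Q²) = 1/T² of each other, while e ≤ M and e ≤ 2R
  -- give 4 e² Q² ≤ 8 M T². This geometric mean is the source of a loss √M instead of M in the
  -- denominator.
  set e := min c n with he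
  have he1 : 1 ≤ e := le_min hc1 hn1
  have heM : e ≤ M := (min_le_left _ _).trans hcM
  have hew : IsWord M [e] := isWord_singleton.2 ⟨he1, heM⟩
  have hv : IsWord M (p ++ [e]) := isWord_append.2 ⟨hp, hew⟩
  have he1' : (1 : ℝ) ≤ e := by exact_mod_cast he1
  refine ⟨p ++ [e], hv, ?_, fun y hy hy1 => ?_⟩
  · have h1 : (cden (p ++ [e]) : ℝ) ≤ (e + 1) * Q := by
      rw [hQ_def]
      exact_mod_cast cden_snoc_le hp.pos e
    have h2 : (e : ℝ) ≤ 2 * R := le_trans (by exact_mod_cast min_le_right c n) hnR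
    have h3 : (e : ℝ) ≤ M := by exact_mod_cast heM
    have h4 : R * Q ^ 2 = T ^ 2 := by rw [hR]; field_simp
    calc (cden (p ++ [e]) : ℝ) ^ 2 ≤ (2 * e * Q) ^ 2 := by
          refine pow_le_pow_left₀ (Nat.cast_nonneg _) (h1.trans ?_) 2
          gcongr
          linarith
      _ = 4 * e * e * Q ^ 2 := by ring
      _ ≤ 4 * M * (2 * R) * Q ^ 2 := by gcongr
      _ = 8 * M * (R * Q ^ 2) := by ring
      _ = _ := by rw [h4]
  · rcases le_total c n with h | h
    · rw [he, min_eq_left h]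
      refine (hu.pos.abs_eval_sub_le hy hz).trans ?_
      have h1 : |y - z| ≤ 1 := abs_le.2 ⟨by linarith, by linarith⟩
      have := huT.1
      gcongr
    · rw [he, min_eq_right h]
      have hnR' : R ≤ n := Nat.le_ceil R
      have hcn : (n : ℝ) ≤ c := by exact_mod_cast h
      have hR0 : 0 < R := by linarith
      rw [cfEval_append p (isWord_append.1 hu).2.pos hz, cfEval_singleton,
        cfEval_append p (posWord_append.1 (isWord_append.2 ⟨hp, isWord_singleton.2
          ⟨hn1, h.trans hcM⟩⟩).pos).2 hy, cfEval_singleton]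
      have b1 : (0 : ℝ) ≤ (n + y : ℝ)⁻¹ := by positivity
      have b2 : (n + y : ℝ)⁻¹ ≤ R⁻¹ := inv_anti₀ hR0 (by linarith)
      have b3 : (0 : ℝ) ≤ (c + z : ℝ)⁻¹ := by positivity
      have b4 : (c + z : ℝ)⁻¹ ≤ R⁻¹ := inv_anti₀ hR0 (by linarith)
      refine (hp.pos.abs_eval_sub_le b1 b3).trans ?_
      have h1 : |(n + y : ℝ)⁻¹ - (c + z : ℝ)⁻¹| ≤ R⁻¹ := abs_le.2 ⟨by linarith, by linarith⟩
      calc _ ≤ R⁻¹ / Q ^ 2 := by gcongr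
        _ = 1 / T ^ 2 := by rw [hR]; field_simp

/-- A small cylinder near a, of diameter comparable to L/q, has denominator at most √(8M) T, hence
mass ≫ (M T²)^(-w), and the bound in terms of mass applies. If it is already too deep for that
bound, L/N is ≪ M and the local estimate N/64 suffices. -/
theorem exists_forall_le_ncard_near :
    ∃ c : ℝ, 0 < c ∧ ∀ (M q : ℕ) [NeZero q] (t L : ℝ) (a : ZMod q), 2 ≤ M → 1 ≤ t →
      t ≤ Real.sqrt q → a ∈ zarembaSet q M t → q / t ^ 2 ≤ L → L ≤ q →
        c * (M : ℝ)⁻¹ * (q / t ^ 2 * (L / (q / t ^ 2)) ^ hausdorffDimBounded M) ≤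
          ({b ∈ zarembaSet q M t | |(b.val : ℝ) - a.val| < L / 2}.ncard : ℝ) := by
  obtain ⟨K, c, hK, hc, hC⟩ := exists_forall_mass_le_card_zarembaCylinder
  set c₁ : ℝ := min (1 / (64 * (512 * K ^ 2))) (c / (16 * 8 * (64 * K ^ 2))) with hc₁
  have hK0 : 0 < K := by linarith
  have hc₁0 : 0 < c₁ := lt_min (by positivity) (by positivity)
  refine ⟨c₁, hc₁0, fun M q _ t L a hM ht htq ha hL hLq => ?_⟩
  set w := hausdorffDimBounded M with hw
  have hw0 : 0 ≤ w := hausdorffDimBounded_nonneg M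
  have hw1 : w ≤ 1 := hausdorffDimBounded_le_one M
  have hq : (0 : ℝ) < q := by exact_mod_cast Nat.pos_of_neZero q
  have ht0 : 0 < t := by linarith
  have hM2 : (2 : ℝ) ≤ M := by exact_mod_cast hM
  have hM0 : (0 : ℝ) < M := by linarith
  set N := q / t ^ 2 with hN
  have hN0 : 0 < N := by positivity
  have hL0 : 0 < L := hN0.trans_le hL
  have hx1 : 1 ≤ L / N := (one_le_div hN0).2 hL
  have hcase : L / N ≤ 512 * K ^ 2 * M → c₁ * (M : ℝ)⁻¹ * (N * (L / N) ^ w) ≤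
      ({b ∈ zarembaSet q M t | |(b.val : ℝ) - a.val| < L / 2}.ncard : ℝ) := by
    intro h
    refine le_trans ?_ (le_ncard_near ht ha hL)
    have h1 : (L / N) ^ w ≤ 512 * K ^ 2 * M := by
      refine le_trans ?_ h
      conv_rhs => rw [← Real.rpow_one (L / N)]
      exact Real.rpow_le_rpow_of_exponent_le hx1 hw1
    calc _ ≤ 1 / (64 * (512 * K ^ 2)) * (M : ℝ)⁻¹ * (N * (512 * K ^ 2 * M)) := by
          gcongr
          exact min_le_left _ _
      _ = N / 64 := by field_simp
      _ = _ := by rw [hN]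
  rcases lt_or_ge (L / N) 4 with h4 | h4
  · exact hcase (by nlinarith [one_le_pow₀ hK (n := 2)])
  -- Points of the small cylinder are within q/T² = L/4 < L/2 of a.
  set T : ℝ := Real.sqrt (4 * q / L) with hT
  have hT2 : T ^ 2 = 4 * q / L := Real.sq_sqrt (by positivity)
  have hT1 : 1 < T := by
    rw [hT, Real.lt_sqrt (by norm_num), lt_div_iff₀ hL0]
    linarith
  have hTt : T ≤ t := by
    rw [hT, Real.sqrt_le_left ht0.le, div_le_iff₀ hL0]
    rw [le_div_iff₀ hN0, hN, ← mul_div_assoc, div_le_iff₀ (by positivity)] at h4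
    linarith
  have hxT : L / N = 4 * (t ^ 2 / T ^ 2) := by
    rw [hT2, hN]
    field_simp
  obtain ⟨u, z, hu, huT, hus, hz, hz1, hau⟩ := exists_stopWord_of_mem_zarembaSet ha hTt
  obtain ⟨v, hv, hvT, hvnear⟩ := exists_small_cylinder hT1 hu ⟨huT, hus⟩ hz hz1
  -- In the first case t/(4K) ≤ q(v) and q(v)² ≤ 8 M T², so L/N = 4t²/T² ≤ 512 K² M.
  rcases le_or_gt (t / (4 * K)) (cden v) with hθ | hθ
  · refine hcase ?_
    have h1 := (pow_le_pow_left₀ (by positivity) hθ 2).trans hvT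
    rw [hxT, ← mul_div_assoc, div_le_iff₀ (by positivity)]
    rw [div_pow, div_le_iff₀ (by positivity)] at h1
    nlinarith
  obtain ⟨m, hm⟩ := exists_conformalMass (M := M) (by omega)
  have hmain := hC M q t m hM hm ht0 htq v hv hθ
  have hsub : (↑(zarembaCylinder q M t v) : Set (ZMod q)) ⊆
      {b ∈ zarembaSet q M t | |(b.val : ℝ) - a.val| < L / 2} := by
    intro b hb
    obtain ⟨hbZ, y, hy, hy1, hby⟩ := mem_zarembaCylinder.1 (Finset.mem_coe.1 hb)
    refine ⟨hbZ, ?_⟩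
    have h1 := hvnear y hy.le hy1.le
    rw [← hby, ← hau, ← sub_div, abs_div, abs_of_pos hq, div_le_iff₀ hq, hT2] at h1
    have h2 : 1 / (4 * q / L) * q = L / 4 := by field_simp
    linarith
  have hcard := Set.ncard_le_ncard hsub (Set.toFinite _)
  rw [Set.ncard_coe_finset] at hcard
  refine le_trans (le_trans ?_ hmain) (Nat.cast_le.2 hcard)
  set V : ℝ := Real.sqrt (8 * M * T ^ 2) with hV
  have hV0 : 0 < V := Real.sqrt_pos.2 (by positivity)
  have hvV : (cden v : ℝ) ≤ V := Real.le_sqrt_of_sq_le hvT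
  have hmv := hm.ge_of_cden_le hv hvV
  rw [← hw] at hmv ⊢
  have h5 : (t / (4 * K)) ^ (2 * w) * V ^ (-(2 * w)) = (L / N / (64 * K ^ 2 * (8 * M))) ^ w := by
    rw [Real.rpow_neg hV0.le, ← div_eq_mul_inv, ← Real.div_rpow (by positivity) hV0.le,
      Real.rpow_mul (by positivity), Real.rpow_two, div_pow, hV, Real.sq_sqrt (by positivity), hxT]
    congr 1
    field_simp
    norm_num
  -- The factor 64 K² · 8M is at least 1 and w ≤ 1, so its w-th power is at most itself; this is
  -- where M^(-w) is weakened to M⁻¹.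
  have h6 : (L / N) ^ w / (64 * K ^ 2 * (8 * M)) ≤ (L / N / (64 * K ^ 2 * (8 * M))) ^ w := by
    rw [Real.div_rpow (x := L / N) (y := 64 * K ^ 2 * (8 * M)) (by positivity) (by positivity)]
    refine div_le_div_of_nonneg_left (by positivity) (by positivity) ?_
    refine Real.rpow_le_self_of_one_le ?_ hw1
    nlinarith [one_le_pow₀ hK (n := 2)]
  calc _ ≤ c / (16 * 8 * (64 * K ^ 2)) * (M : ℝ)⁻¹ * (N * (L / N) ^ w) := by
        gcongr
        exact min_le_right _ _
    _ = c * N / 16 * ((L / N) ^ w / (64 * K ^ 2 * (8 * M))) := by field_simp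
    _ ≤ c * N / 16 * ((t / (4 * K)) ^ (2 * w) * V ^ (-(2 * w))) := by rw [h5]; gcongr
    _ = c * N * (t / (4 * K)) ^ (2 * w) * (V ^ (-(2 * w)) / 16) := by ring
    _ ≤ _ := by gcongr

theorem lemma3p1 (δ : ℝ) (hδ : 0 < δ) :
    ∃ C c : ℝ, 0 < C ∧ 0 < c ∧
      ∀ (M q : ℕ) (t N : ℝ), 2 ≤ M → 1 ≤ q → 1 ≤ t → t ≤ Real.sqrt (q : ℝ) → δ * (M : ℝ) ≤ t →
        N = (q : ℝ) / t ^ 2 →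
        (∀ I : Set (ZMod q), IsResidueInterval I →
          ((zarembaSet q M t ∩ I).ncard : ℝ) ≤
            C * (M : ℝ) ^ 4 * (I.ncard : ℝ) ^ hausdorffDimBounded M *
              N ^ (1 - hausdorffDimBounded M)) ∧
        (∀ (I : Set (ZMod q)) (a : ZMod q), IsResidueIntervalCenteredAt I a →
          a ∈ zarembaSet q M t → N ≤ (I.ncard : ℝ) →
          c * (M : ℝ)⁻¹ * (I.ncard : ℝ) ^ hausdorffDimBounded M *
              N ^ (1 - hausdorffDimBounded M) ≤
            ((zarembaSet q M t ∩ I).ncard : ℝ)) := by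
  obtain ⟨c, hc, hlower⟩ := exists_forall_le_ncard_near
  refine ⟨24576, c, by norm_num, hc, ?_⟩
  rintro M q t N hM hq ht htq - rfl
  refine ⟨fun I hI => ncard_zarembaSet_inter_le hM hq ht htq hI, ?_⟩
  rintro I a ⟨x, L, k, hL, rfl, -, hk, hak⟩ ha hN
  have : NeZero q := ⟨by omega⟩
  rw [ncard_residueArc x hL] at hN ⊢
  have hq0 : (0 : ℝ) < q := by exact_mod_cast hq
  have hsub : {b ∈ zarembaSet q M t | |(b.val : ℝ) - a.val| < L / 2} ⊆
      zarembaSet q M t ∩ residueArc x L := fun b hb =>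
    ⟨hb.1, mem_residueArc_of_abs_val_sub_lt hk hak hb.2⟩
  rw [mul_assoc, ← mul_div_rpow (Nat.cast_nonneg L) (by positivity)]
  exact (hlower M q t L a hM ht htq ha hN (by exact_mod_cast hL)).trans
    (Nat.cast_le.2 (Set.ncard_le_ncard hsub (Set.toFinite _)))
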